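/- Let $0<q<1$ and $\alpha_1,\alpha_2,\alpha_3>0$. Write $(a;q)_n=\prod_{i=0}^{n-1}(1-aq^i)$ and ${}_{r+1}\phi_r$ for the basic hypergeometric series. For integers $0\le x,n\le N$ let $$h_n(x,\alpha,\beta,N;q)=(q^{\alpha+1};q)_n(q^{-N};q)_n\,{}_3\phi_2\!\left({q^{-n},\,q^{n+\alpha+\beta+1},\,q^{-x}\atop q^{\alpha+1},\,q^{-N}};q,q\right),$$ $$\omega(x;\alpha,\beta,N;q)=\frac{(q^{\alpha+1};q)_x(q^{\beta+1};q)_{N-x}}{(q;q)_x(q;q)_{N-x}}q^{(N-x)(\alpha+1)},$$ $$\eta(n,\alpha,\beta,N;q)=\frac{(q^{\alpha+\beta+2};q)_{n+N}}{(q;q)_{N-n}}q^{2\binom n2-2Nn}\frac{1-q^{\alpha+\beta+1}}{1-q^{2n+\alpha+\beta+1}}\frac{(q;q)_n(q^{\alpha+1};q)_n(q^{\beta+1};q)_n}{(q^{\alpha+\beta+1};q)_n}q^{n(\alpha+1)},$$ and $\widehat h_n=\sqrt{\omega/\eta}\;h_n$, with $\widehat h_n(x,\alpha,\beta,N;q)=0$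 if the integers $n\ge 0$, $x$, $N$ do not satisfy $0\le x\le N$ and $n\le N$. For $\mathbf n=(n_1,n_2,n_3)$, $\mathbf m=(m_1,m_2,m_3)$, $\mathbf y=(y_1,y_2,y_3)$ in $\mathbb Z_{\ge0}^3$, with $N_k=\sum_{i\le k}n_i$, $M_k=\sum_{i\le k}m_i$, $Y_k=\sum_{i\le k}y_i$, let $$\Psi_{\mathbf n}(\mathbf y)=\delta_{N_3Y_3}\,\widehat h_{n_1}(y_1,\alpha_1,\alpha_2,y_1+y_2;q)\,\widehat h_{n_2}(y_1+y_2-n_1,\,2n_1+\alpha_1+\alpha_2+1,\,\alpha_3,\,Y_3-n_1;q),$$ $$\Xi_{\mathbf m}(\mathbf y)=\delta_{M_3Y_3}\,\widehat h_{m_1}(y_2,\alpha_2,\alpha_3,y_2+y_3;q)\,\widehat h_{m_2}(y_1,\,\alpha_1,\,2m_1+\alpha_2+\alpha_3+1,\,Y_3-m_1;q).$$ Further, let $$r_n(x,a,b,c,N;q)=(q^{a+1};q)_n(q^{b+c+1};q)_n(q^{-N};q)_n\,q^{n(N-c)/2}\,{}_4\phi_3\!\left({q^{-n},\,q^{n+a+b+1},\,q^{-x},\,q^{x+c-N}\atop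 q^{a+1},\,q^{b+c+1},\,q^{-N}};q,q\right),$$ $$\sigma(x,a,b,c,N;q)=\frac{1-q^{2x+c-N}}{1-q^{c-N}}\,\frac{(q^{c-N};q)_x(q^{a+1};q)_x(q^{b+c+1};q)_x(q^{-N};q)_x}{(q;q)_x(q^{c-a-N};q)_x(q^{-b-N};q)_x(q^{c+1};q)_x}\,q^{-x(a+b+1)},$$ $$\upsilon(n,a,b,c,N;q)=\frac{(q^{-c};q)_N(q^{a+b+2};q)_N}{(q^{a-c+1};q)_N(q^{b+1};q)_N}(q;q)_n(q^{a+1};q)_n(q^{b+1};q)_n(q^{a-c+1};q)_n(q^{b+c+1};q)_n(q^{-N};q)_n\frac{1-q^{a+b+1}}{1-q^{2n+a+b+1}}\frac{(q^{N+a+b+2};q)_n}{(q^{a+b+1};q)_n},$$ and $\widehat r_n=\sqrt{\sigma/\upsilon}\;r_n$. There is exactly one family of real coefficients $\mathcal R_{\mathbf m}(\mathbf n)$ such that $\Xi_{\mathbf m}(\mathbf y)=\sum_{\mathbf n}\mathcal R_{\mathbf m}(\mathbf n)\Psi_{\mathbf n}(\mathbf y)$ for all $\mathbf m,\mathbf y$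 (for each $\mathbf y$ the sum is finite), and for all $\mathbf m,\mathbf n$ $$\mathcal R_{\mathbf m}(\mathbf n)=\sum_{\mathbf y}\Xi_{\mathbf m}(\mathbf y)\Psi_{\mathbf n}(\mathbf y)=\delta_{m_3n_3}\,\delta_{M_2N_2}\,(-1)^{m_1}\,\widehat r_{m_1}(n_1,\alpha_2,\alpha_3,n_1+n_2+\alpha_1+\alpha_2+1,n_1+n_2;q).$$ In particular, for $m_3=n_3$ the coefficient does not depend on $m_3=n_3$ and may be written $\mathcal R^{(\alpha_1,\alpha_2,\alpha_3)}_{m_1,m_2}(n_1,n_2)$. (If $N_2\ne M_2$ the right-hand side is read as $0$.) -/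

import Mathlib

namespace QRacah

noncomputable section

/-- The `q`-Pochhammer symbol `(a; q)_n = (1 - a) (1 - a q) ⋯ (1 - a q^(n-1))`. -/
def qPoch (a q : ℝ) (n : ℕ) : ℝ := ∏ i ∈ Finset.range n, (1 - a * q ^ i)

/-- The basic hypergeometric series `_rφ_s(as; bs; q, z)`. It is used below only for terminating
series, whose summands vanish from some index on. -/
def basicHyp (as bs : List ℝ) (q z : ℝ) : ℝ :=
  ∑' k : ℕ, (as.map (fun a => qPoch a q k)).prod /
      (qPoch q q k * (bs.map (fun b => qPoch b q k)).prod) *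
    ((-1) ^ k * q ^ (k.choose 2)) ^ (1 + (bs.length : ℤ) - (as.length : ℤ)) * z ^ k

/-- The `q`-Hahn polynomial `h_n(x, α, β, N; q)`. -/
def qHahn (q : ℝ) (n x : ℕ) (α β : ℝ) (N : ℕ) : ℝ :=
  qPoch (q ^ (α + 1)) q n * qPoch (q ^ (-(N : ℝ))) q n *
    basicHyp [q ^ (-(n : ℝ)), q ^ ((n : ℝ) + α + β + 1), q ^ (-(x : ℝ))]
      [q ^ (α + 1), q ^ (-(N : ℝ))] q q

/-- The `q`-Hahn weight `ω(x; α, β, N; q)`, for `x ≤ N`. -/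
def qHahnWeight (q : ℝ) (x : ℕ) (α β : ℝ) (N : ℕ) : ℝ :=
  qPoch (q ^ (α + 1)) q x * qPoch (q ^ (β + 1)) q (N - x) /
      (qPoch q q x * qPoch q q (N - x)) *
    q ^ (((N - x : ℕ) : ℝ) * (α + 1))

/-- The `q`-Hahn normalization coefficient `η(n, α, β, N; q)`, for `n ≤ N`. -/
def qHahnNorm (q : ℝ) (n : ℕ) (α β : ℝ) (N : ℕ) : ℝ :=
  qPoch (q ^ (α + β + 2)) q (n + N) / qPoch q q (N - n) *
    q ^ (2 * (n.choose 2 : ℝ) - 2 * (N : ℝ) * (n : ℝ)) *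
    ((1 - q ^ (α + β + 1)) / (1 - q ^ (2 * (n : ℝ) + α + β + 1))) *
    (qPoch q q n * qPoch (q ^ (α + 1)) q n * qPoch (q ^ (β + 1)) q n /
      qPoch (q ^ (α + β + 1)) q n) *
    q ^ ((n : ℝ) * (α + 1))

/-- The `q`-Hahn function `ĥ_n(x, α, β, N; q)`, the orthonormal `q`-Hahn polynomial times the square
root of its weight. It vanishes outside the range `0 ≤ x ≤ N`, `0 ≤ n ≤ N`. -/
def qHahnFun (q : ℝ) (n x : ℕ) (α β : ℝ) (N : ℕ) : ℝ :=
  if x ≤ N ∧ n ≤ N then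
    Real.sqrt (qHahnWeight q x α β N / qHahnNorm q n α β N) * qHahn q n x α β N
  else 0

/-- The first orthonormal basis `Ψ_n(y)` of multivariate `q`-Hahn functions for `d = 3`; here `n 0`,
`n 1`, `n 2` stand for `n₁`, `n₂`, `n₃`, and similarly for `y` and `α`. The first factor vanishes
unless `n₁ ≤ y₁ + y₂`, so that the subtractions in the second factor are never truncated in a
nonzero product. -/
def Psi (q : ℝ) (α : Fin 3 → ℝ) (n y : Fin 3 → ℕ) : ℝ :=
  if n 0 + n 1 + n 2 = y 0 + y 1 + y 2 then
    qHahnFun q (n 0) (y 0) (α 0) (α 1) (y 0 + y 1) *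
      qHahnFun q (n 1) (y 0 + y 1 - n 0) (2 * (n 0 : ℝ) + α 0 + α 1 + 1) (α 2)
        (y 0 + y 1 + y 2 - n 0)
  else 0

/-- The second orthonormal basis `Ξ_m(y)` of multivariate `q`-Hahn functions for `d = 3`. The first
factor vanishes unless `m₁ ≤ y₂ + y₃`. -/
def Xi (q : ℝ) (α : Fin 3 → ℝ) (m y : Fin 3 → ℕ) : ℝ :=
  if m 0 + m 1 + m 2 = y 0 + y 1 + y 2 then
    qHahnFun q (m 0) (y 1) (α 1) (α 2) (y 1 + y 2) *
      qHahnFun q (m 1) (y 0) (α 0) (2 * (m 0 : ℝ) + α 1 + α 2 + 1)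
        (y 0 + y 1 + y 2 - m 0)
  else 0

/-- `R m n` is a family of connection coefficients `R_m(n)` from the basis `Ψ` to the basis `Ξ`:
`Ξ_m(y) = ∑_n R_m(n) Ψ_n(y)` for all `m` and `y`. For each `y` only finitely many `Ψ_n(y)` are
nonzero. -/
def IsConnectionCoeff (q : ℝ) (α : Fin 3 → ℝ) (R : (Fin 3 → ℕ) → (Fin 3 → ℕ) → ℝ) : Prop :=
  ∀ m y : Fin 3 → ℕ, HasSum (fun n : Fin 3 → ℕ => R m n * Psi q α n y) (Xi q α m y)

/-- The `q`-Racah polynomial `r_n(x, a, b, c, N; q)`. -/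
def qRacah (q : ℝ) (n x : ℕ) (a b c : ℝ) (N : ℕ) : ℝ :=
  qPoch (q ^ (a + 1)) q n * qPoch (q ^ (b + c + 1)) q n * qPoch (q ^ (-(N : ℝ))) q n *
    q ^ ((n : ℝ) * ((N : ℝ) - c) / 2) *
    basicHyp [q ^ (-(n : ℝ)), q ^ ((n : ℝ) + a + b + 1), q ^ (-(x : ℝ)), q ^ ((x : ℝ) + c - N)]
      [q ^ (a + 1), q ^ (b + c + 1), q ^ (-(N : ℝ))] q q

/-- The `q`-Racah weight `σ(x, a, b, c, N; q)`. -/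
def qRacahWeight (q : ℝ) (x : ℕ) (a b c : ℝ) (N : ℕ) : ℝ :=
  (1 - q ^ (2 * (x : ℝ) + c - N)) / (1 - q ^ (c - N)) *
    (qPoch (q ^ (c - N)) q x * qPoch (q ^ (a + 1)) q x * qPoch (q ^ (b + c + 1)) q x *
        qPoch (q ^ (-(N : ℝ))) q x /
      (qPoch q q x * qPoch (q ^ (c - a - N)) q x * qPoch (q ^ (-b - N)) q x *
        qPoch (q ^ (c + 1)) q x)) *
    q ^ (-((x : ℝ) * (a + b + 1)))

/-- The `q`-Racah normalization coefficient `υ(n, a, b, c, N; q)`. -/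
def qRacahNorm (q : ℝ) (n : ℕ) (a b c : ℝ) (N : ℕ) : ℝ :=
  qPoch (q ^ (-c)) q N * qPoch (q ^ (a + b + 2)) q N /
      (qPoch (q ^ (a - c + 1)) q N * qPoch (q ^ (b + 1)) q N) *
    (qPoch q q n * qPoch (q ^ (a + 1)) q n * qPoch (q ^ (b + 1)) q n) *
    (qPoch (q ^ (a - c + 1)) q n * qPoch (q ^ (b + c + 1)) q n * qPoch (q ^ (-(N : ℝ))) q n) *
    ((1 - q ^ (a + b + 1)) / (1 - q ^ (2 * (n : ℝ) + a + b + 1))) *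
    (qPoch (q ^ ((N : ℝ) + a + b + 2)) q n / qPoch (q ^ (a + b + 1)) q n)

/-- The orthonormal `q`-Racah function `r̂_n(x, a, b, c, N; q)`. -/
def qRacahFun (q : ℝ) (n x : ℕ) (a b c : ℝ) (N : ℕ) : ℝ :=
  Real.sqrt (qRacahWeight q x a b c N / qRacahNorm q n a b c N) * qRacah q n x a b c N

end

end QRacah

/-! Write A, B, C for q^(α₁+1), q^(α₂+1), q^(α₃+1), and strip Ψ and Ξ of weights and norms. What
remains are products of two q-Hahn polynomials, `polyPsi` and `polyXi`; call K = n₁+n₂ (resp. m₁+m₂)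
the degree and |y| = y₁+y₂+y₃ the level.

Two first-order q-difference operators carry the argument. The operator `raise₃` uses values at
level |y|-1 and sends every member of degree K, in either family, to q^K - q^|y| times itself
(`raise₃_polyPsi`, `raise₃_polyXi`). Hence a linear relation between members of degree K that holds
at level K holds at all higher levels with the same coefficients; so the connection preserves n₁+n₂
and does not see the third index.

At level |y| = K both families lie in the kernel of `lower₃`, and an element of that kernel is
determined by its values at y₁ = 0 (`eq_zero_of_lower₃`). There `polyPsi` is a product of
q-Pochhammer symbols, while `polyXi` is a constant times one q-Hahn polynomial. Expanding the latter
in the former is, term by term, a terminating very-well-poised sum (`sum_vwpTerm`,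
`sum_boundaryTerm`). The coefficients come out as an explicit factor times a ₄φ₃, the q-Racah
polynomial (`polyConn`, `polyXi_eq_sum`).

To normalise, the square of the explicit factor times the quotient of the squared norms is compared
with the q-Racah weight over its norm (`connFactor_sq_mul_normPsi`, `racahNorm_mul_connConst`). The
sign lost by squaring is found separately and is (-1)^m₁ (`polyConn_mul_sqrt`).

Uniqueness and the formula R = ∑ Ξ Ψ need only the orthonormality of Ψ, which reduces to
one-variable q-Hahn orthogonality with norm (`sum_hahn_mul_hahn_eq_zero`, `sum_hahn_sq`). Both
follow from the one-variable operators `raise` and `lower`, which are adjoint for the weight and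
nearly diagonal on the q-Hahn polynomials. -/

namespace QRacah

open Finset.HasAntidiagonal (antidiagonal)

/-! ### q-Pochhammer symbols -/

theorem qPoch_zero (a q : ℝ) : qPoch a q 0 = 1 := by simp [qPoch]

theorem qPoch_succ (a q : ℝ) (n : ℕ) : qPoch a q (n + 1) = qPoch a q n * (1 - a * q ^ n) := by
  simp [qPoch, Finset.prod_range_succ]

theorem qPoch_add (a q : ℝ) (m n : ℕ) :
    qPoch a q (m + n) = qPoch a q m * qPoch (a * q ^ m) q n := by
  simp only [qPoch, Finset.prod_range_add]
  congr 1
  exact Finset.prod_congr rfl fun i _ => by rw [pow_add]; ring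

theorem qPoch_one (a q : ℝ) : qPoch a q 1 = 1 - a := by simp [qPoch]

theorem qPoch_succ_left (a q : ℝ) (n : ℕ) :
    qPoch a q (n + 1) = (1 - a) * qPoch (a * q) q n := by
  rw [add_comm, qPoch_add, qPoch_one, pow_one]

theorem qPoch_pos {a q : ℝ} (hq0 : 0 < q) (hq1 : q < 1) (ha0 : 0 ≤ a) (ha1 : a < 1) (n : ℕ) :
    0 < qPoch a q n := by
  refine Finset.prod_pos fun i _ => ?_
  have : a * q ^ i ≤ a * 1 := mul_le_mul_of_nonneg_left (pow_le_one₀ hq0.le hq1.le) ha0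
  linarith

theorem qPoch_self_pos {q : ℝ} (hq0 : 0 < q) (hq1 : q < 1) (n : ℕ) : 0 < qPoch q q n :=
  qPoch_pos hq0 hq1 hq0.le hq1 n

theorem qPoch_inv_pow_eq_zero {q : ℝ} (hq0 : 0 < q) {x j : ℕ} (h : x < j) :
    qPoch (q ^ x)⁻¹ q j = 0 := by
  refine Finset.prod_eq_zero (Finset.mem_range.2 h) ?_
  rw [inv_mul_cancel₀ (pow_pos hq0 x).ne', sub_self]

theorem inv_pow_mul_pow_ne_one {q : ℝ} (hq0 : 0 < q) (hq1 : q < 1) {x i : ℕ} (h : i < x) :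
    1 < (q ^ x)⁻¹ * q ^ i := by
  have h1 : q ^ x < q ^ i := pow_lt_pow_right_of_lt_one₀ hq0 hq1 h
  rw [inv_mul_eq_div]
  exact (one_lt_div (pow_pos hq0 x)).2 h1

theorem qPoch_inv_pow_ne_zero {q : ℝ} (hq0 : 0 < q) (hq1 : q < 1) {x j : ℕ} (h : j ≤ x) :
    qPoch (q ^ x)⁻¹ q j ≠ 0 := by
  refine Finset.prod_ne_zero_iff.2 fun i hi => ?_
  have := inv_pow_mul_pow_ne_one hq0 hq1 (lt_of_lt_of_le (Finset.mem_range.1 hi) h)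
  linarith

/-- Reversal of the order of the factors. -/
theorem qPoch_reverse {d q : ℝ} (hd : d ≠ 0) (hq : q ≠ 0) (n : ℕ) :
    qPoch (q / (d * q ^ n)) q n * (d ^ n * q ^ (n.choose 2)) = (-1) ^ n * qPoch d q n := by
  induction n with
  | zero => simp [qPoch_zero]
  | succ n ih =>
    have e : q / (d * q ^ (n + 1)) * q = q / (d * q ^ n) := by
      field_simp
      ring
    rw [qPoch_succ_left, e, qPoch_succ, Nat.choose_succ_succ' n 1, Nat.choose_one_right, pow_add q n,
      pow_succ d, pow_succ (-1 : ℝ)]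
    calc _ = (qPoch (q / (d * q ^ n)) q n * (d ^ n * q ^ (n.choose 2))) *
          ((1 - q / (d * q ^ (n + 1))) * (d * q ^ n)) := by norm_num; ring
      _ = _ := by
        rw [ih]
        have : (1 - q / (d * q ^ (n + 1))) * (d * q ^ n) = d * q ^ n - 1 := by
          field_simp
          ring
        rw [this]; ring

/-- This is `qPoch_reverse` with d = q^(m+1), where (d;q)_n (q;q)_m = (q;q)_(n+m). -/
theorem qPoch_inv_pow {q : ℝ} (hq0 : 0 < q) (n m : ℕ) :
    qPoch (q ^ (n + m))⁻¹ q n * qPoch q q m * (q ^ (n * (m + 1)) * q ^ (n.choose 2)) =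
      (-1) ^ n * qPoch q q (n + m) := by
  have h := qPoch_reverse (d := q ^ (m + 1)) (pow_ne_zero _ hq0.ne') hq0.ne' n
  have e : q / (q ^ (m + 1) * q ^ n) = (q ^ (n + m))⁻¹ := by
    field_simp; ring
  rw [e, ← pow_mul, mul_comm (m + 1) n] at h
  rw [add_comm n m, qPoch_add q q m n]
  rw [show q * q ^ m = q ^ (m + 1) by ring, add_comm m n]
  linear_combination qPoch q q m * h

/-! ### q-Hahn polynomials with denominators cleared, and the raising operator -/

/-- Coefficients of the `q`-Hahn polynomial. -/
noncomputable def hahnCoeff (q A B : ℝ) (n j : ℕ) : ℝ :=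
  qPoch (q ^ n)⁻¹ q j * qPoch (A * B / q * q ^ n) q j * qPoch (A * q ^ j) q (n - j) * q ^ j /
    qPoch q q j

/-- The `q`-Hahn polynomial with parameters `A = q^(α+1)`, `B = q^(β+1)`, `N = x + x'`. -/
noncomputable def hahn (q A B : ℝ) (n x x' : ℕ) : ℝ :=
  ∑ j ∈ Finset.range (n + 1), hahnCoeff q A B n j *
    (qPoch (q ^ x)⁻¹ q j * qPoch (q ^ j * (q ^ (x + x'))⁻¹) q (n - j))

theorem qPoch_pow_inv_eq_zero {q : ℝ} (hq0 : 0 < q) {j N k : ℕ} (h1 : j ≤ N) (h2 : N < j + k) :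
    qPoch (q ^ j * (q ^ N)⁻¹) q k = 0 := by
  refine Finset.prod_eq_zero (i := N - j) (Finset.mem_range.2 (by omega)) ?_
  have : q ^ j * (q ^ N)⁻¹ * q ^ (N - j) = 1 := by
    have h : q ^ N = q ^ j * q ^ (N - j) := by rw [← pow_add]; congr 1; omega
    have := pow_pos hq0 j
    have := pow_pos hq0 (N - j)
    rw [h]; field_simp
  rw [this, sub_self]

/-- Each summand vanishes: (q^(-x);q)_j does if j > x, and otherwise j ≤ N = x + x' < n puts a zero
factor into (q^(j-N);q)_(n-j). This builds the convention that degrees above N give zero into the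
polynomial itself. -/
theorem hahn_eq_zero {q : ℝ} (hq0 : 0 < q) (A B : ℝ) {n x x' : ℕ} (h : x + x' < n) :
    hahn q A B n x x' = 0 := by
  refine Finset.sum_eq_zero fun j hj => ?_
  have hj := Finset.mem_range.1 hj
  by_cases hjx : x < j
  · rw [qPoch_inv_pow_eq_zero hq0 hjx]; ring
  · rw [qPoch_pow_inv_eq_zero (j := j) (k := n - j) hq0 (by omega) (by omega)]; ring

theorem hahn_zero_left (q A B : ℝ) (n x' : ℕ) :
    hahn q A B n 0 x' = qPoch A q n * qPoch (q ^ x')⁻¹ q n := by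
  unfold hahn
  rw [Finset.sum_eq_single 0]
  · simp [hahnCoeff, qPoch_zero]
  · intro j _ hj
    obtain ⟨i, rfl⟩ := Nat.exists_eq_succ_of_ne_zero hj
    simp [qPoch_succ_left]
  · simp

/-- The two symbols share all but their end factors. Multiplying by 1 - q^x keeps the relation true
at x = 0, where `x - 1` is truncated. -/
theorem one_sub_mul_qPoch_inv_pow_pred {q : ℝ} (hq0 : 0 < q) (x j : ℕ) :
    (1 - q ^ x) * qPoch (q ^ (x - 1))⁻¹ q j = (q ^ j - q ^ x) * qPoch (q ^ x)⁻¹ q j := by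
  rcases x with _ | x
  · rcases j with _ | j
    · simp
    · simp [qPoch_succ_left]
  · have h := qPoch_succ (q ^ (x + 1))⁻¹ q j
    rw [qPoch_succ_left] at h
    have e : (q ^ (x + 1))⁻¹ * q = (q ^ x)⁻¹ := by field_simp; ring
    rw [e] at h
    have hx := pow_pos hq0 (x + 1)
    have e1 : (1 - (q ^ (x + 1))⁻¹) * q ^ (x + 1) = q ^ (x + 1) - 1 := by field_simp
    have e2 : (1 - (q ^ (x + 1))⁻¹ * q ^ j) * q ^ (x + 1) = q ^ (x + 1) - q ^ j := by field_simp
    simp only [Nat.add_sub_cancel]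
    linear_combination (-q ^ (x + 1)) * h + qPoch (q ^ x)⁻¹ q j * e1 - qPoch (q ^ (x + 1))⁻¹ q j * e2

theorem qPoch_level_pred {q : ℝ} (hq0 : 0 < q) (j k N : ℕ) :
    (q ^ j - q ^ (N + 1)) * qPoch (q ^ j * (q ^ N)⁻¹) q k =
      (q ^ (j + k) - q ^ (N + 1)) * qPoch (q ^ j * (q ^ (N + 1))⁻¹) q k := by
  have h := qPoch_succ (q ^ j * (q ^ (N + 1))⁻¹) q k
  rw [qPoch_succ_left] at h
  have e : q ^ j * (q ^ (N + 1))⁻¹ * q = q ^ j * (q ^ N)⁻¹ := by field_simp; ring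
  rw [e] at h
  have hx := pow_pos hq0 (N + 1)
  have e1 : (1 - q ^ j * (q ^ (N + 1))⁻¹) * q ^ (N + 1) = q ^ (N + 1) - q ^ j := by field_simp
  have e2 : (1 - q ^ j * (q ^ (N + 1))⁻¹ * q ^ k) * q ^ (N + 1) = q ^ (N + 1) - q ^ (j + k) := by
    rw [pow_add q j k]; field_simp
  linear_combination (-q ^ (N + 1)) * h + qPoch (q ^ j * (q ^ N)⁻¹) q k * e1 -
    qPoch (q ^ j * (q ^ (N + 1))⁻¹) q k * e2

/-- The raising operator maps the `q`-Hahn polynomials for `N - 1` to those for `N`. -/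
theorem hahn_raise {q : ℝ} (hq0 : 0 < q) (A B : ℝ) (n x x' : ℕ) :
    (1 - q ^ x) * hahn q A B n (x - 1) x' + q ^ x * (1 - q ^ x') * hahn q A B n x (x' - 1) =
      (q ^ n - q ^ (x + x')) * hahn q A B n x x' := by
  by_cases h0 : x + x' = 0
  · obtain ⟨rfl, rfl⟩ : x = 0 ∧ x' = 0 := by omega
    rw [hahn_zero_left]
    rcases n with _ | n <;> simp [qPoch_succ_left]
  obtain ⟨N, hN⟩ := Nat.exists_eq_succ_of_ne_zero h0
  -- The operator acts diagonally on each basis function: the two contributions q^j - q^x and q^x -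
  -- q^(x+x') add up to q^j - q^(x+x'), and passing from level N to N + 1 replaces q^j by q^n. The
  -- eigenvalue is thus the same for all j.
  have key : ∀ j ∈ Finset.range (n + 1),
      (1 - q ^ x) * (qPoch (q ^ (x - 1))⁻¹ q j * qPoch (q ^ j * (q ^ (x - 1 + x'))⁻¹) q (n - j)) +
      q ^ x * (1 - q ^ x') * (qPoch (q ^ x)⁻¹ q j *
        qPoch (q ^ j * (q ^ (x + (x' - 1)))⁻¹) q (n - j)) =
      (q ^ n - q ^ (x + x')) *
        (qPoch (q ^ x)⁻¹ q j * qPoch (q ^ j * (q ^ (x + x'))⁻¹) q (n - j)) := by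
    intro j hj
    have hj := Finset.mem_range.1 hj
    have h1 : (1 - q ^ x) * (qPoch (q ^ (x - 1))⁻¹ q j *
        qPoch (q ^ j * (q ^ (x - 1 + x'))⁻¹) q (n - j)) =
        (q ^ j - q ^ x) * qPoch (q ^ x)⁻¹ q j * qPoch (q ^ j * (q ^ N)⁻¹) q (n - j) := by
      rw [← one_sub_mul_qPoch_inv_pow_pred hq0]
      rcases Nat.eq_zero_or_pos x with rfl | hx
      · simp
      · rw [show x - 1 + x' = N by omega]; ring
    have h2 : q ^ x * (1 - q ^ x') * (qPoch (q ^ x)⁻¹ q j *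
        qPoch (q ^ j * (q ^ (x + (x' - 1)))⁻¹) q (n - j)) =
        (q ^ x - q ^ (x + x')) * qPoch (q ^ x)⁻¹ q j * qPoch (q ^ j * (q ^ N)⁻¹) q (n - j) := by
      rcases Nat.eq_zero_or_pos x' with rfl | hx
      · simp
      · rw [show x + (x' - 1) = N by omega, pow_add]; ring
    have h3 := qPoch_level_pred hq0 j (n - j) N
    rw [show j + (n - j) = n by omega] at h3
    rw [h1, h2, hN, Nat.succ_eq_add_one]
    linear_combination qPoch (q ^ x)⁻¹ q j * h3
  unfold hahn
  simp only [Finset.mul_sum]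
  rw [← Finset.sum_add_distrib]
  refine Finset.sum_congr rfl fun j hj => ?_
  linear_combination hahnCoeff q A B n j * key j hj

theorem one_sub_mul_pow_pos {a q : ℝ} (hq0 : 0 < q) (hq1 : q < 1) (ha0 : 0 ≤ a) (ha1 : a < 1)
    (n : ℕ) : 0 < 1 - a * q ^ n := by
  have : a * q ^ n ≤ a * 1 := mul_le_mul_of_nonneg_left (pow_le_one₀ hq0.le hq1.le) ha0
  linarith

/-! ### The q-Chu–Vandermonde sum and the q-Hahn polynomial of top degree -/

/-- The `q`-Chu–Vandermonde sum. -/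
theorem q_vandermonde {q : ℝ} (hq0 : 0 < q) (hq1 : q < 1) (x : ℕ) :
    ∀ (M : ℕ) (b c : ℝ), 0 ≤ c → c < 1 → x < M →
      ∑ j ∈ Finset.range M, qPoch (q ^ x)⁻¹ q j * qPoch b q j / (qPoch q q j * qPoch c q j) * q ^ j =
        (∏ i ∈ Finset.range x, (b - c * q ^ i)) / qPoch c q x := by
  induction x with
  | zero =>
    intro M b c hc0 hc1 hM
    rw [Finset.sum_eq_single 0]
    · simp [qPoch_zero]
    · intro j _ hj
      obtain ⟨i, rfl⟩ := Nat.exists_eq_succ_of_ne_zero hj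
      simp [qPoch_succ_left]
    · intro h; exact absurd (Finset.mem_range.2 hM) h
  | succ x ih =>
    intro M b c hc0 hc1 hM
    obtain ⟨M, rfl⟩ := Nat.exists_eq_succ_of_ne_zero (by omega : M ≠ 0)
    have h1 := ih (M + 1) b c hc0 hc1 (by omega)
    have h2 := ih M (b * q) (c * q) (by positivity) (by nlinarith) (by omega)
    have hcx := (qPoch_pos hq0 hq1 hc0 hc1 x).ne'
    have hcx1 := (one_sub_mul_pow_pos hq0 hq1 hc0 hc1 x).ne'
    have hc : 1 - c ≠ 0 := by linarith
    have hcqx := (qPoch_pos hq0 hq1 (by positivity : 0 ≤ c * q) (by nlinarith) x).ne'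
    have hcc : qPoch c q x * (1 - c * q ^ x) = (1 - c) * qPoch (c * q) q x := by
      rw [← qPoch_succ, qPoch_succ_left]
    have hqx := pow_pos hq0 x
    -- Contiguous relation: replacing q^(-x) by q^(-x-1) changes the j-th term by a multiple of the
    -- (j-1)-st term with b, c replaced by bq, cq.
    have step : ∑ j ∈ Finset.range (M + 1),
        qPoch (q ^ (x + 1))⁻¹ q j * qPoch b q j / (qPoch q q j * qPoch c q j) * q ^ j =
        ∑ j ∈ Finset.range (M + 1),
          qPoch (q ^ x)⁻¹ q j * qPoch b q j / (qPoch q q j * qPoch c q j) * q ^ j -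
        (q ^ x)⁻¹ * (1 - b) / (1 - c) * ∑ j ∈ Finset.range M,
          qPoch (q ^ x)⁻¹ q j * qPoch (b * q) q j / (qPoch q q j * qPoch (c * q) q j) * q ^ j := by
      rw [eq_sub_iff_add_eq, Finset.sum_range_succ', Finset.sum_range_succ', Finset.mul_sum]
      simp only [qPoch_zero]
      rw [add_right_comm, ← Finset.sum_add_distrib]
      congr 1
      refine Finset.sum_congr rfl fun j _ => ?_
      have e : (q ^ (x + 1))⁻¹ * q = (q ^ x)⁻¹ := by field_simp; ring
      have hqj := (qPoch_self_pos hq0 hq1 j).ne'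
      have hqj1 := (one_sub_mul_pow_pos hq0 hq1 hq0.le hq1 j).ne'
      have hcj := (qPoch_pos hq0 hq1 (by positivity : 0 ≤ c * q) (by nlinarith) j).ne'
      rw [qPoch_succ_left (q ^ (x + 1))⁻¹, e, qPoch_succ (q ^ x)⁻¹, qPoch_succ_left b,
        qPoch_succ_left c, qPoch_succ q]
      field_simp
      ring
    rw [Nat.succ_eq_add_one, step, h1, h2, Finset.prod_range_succ, qPoch_succ]
    have hp : ∏ i ∈ Finset.range x, (b * q - c * q * q ^ i) =
        q ^ x * ∏ i ∈ Finset.range x, (b - c * q ^ i) := by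
      have : q ^ x = ∏ _i ∈ Finset.range x, q := by simp
      rw [this, ← Finset.prod_mul_distrib]
      exact Finset.prod_congr rfl fun i _ => by ring
    rw [hp]
    have : qPoch (c * q) q x = qPoch c q x * (1 - c * q ^ x) / (1 - c) := by
      rw [hcc]; field_simp
    rw [this]
    field_simp
    ring

/-- For `n = N` the `q`-Hahn polynomial is a product. -/
theorem hahn_top {q A : ℝ} (hq0 : 0 < q) (hq1 : q < 1) (hA0 : 0 < A) (hA1 : A < 1) (B : ℝ)
    {n x x' : ℕ} (h : x + x' = n) :
    hahn q A B n x x' = qPoch A q n * qPoch (q ^ n)⁻¹ q n *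
      ((∏ i ∈ Finset.range x, (A * B / q * q ^ n - A * q ^ i)) / qPoch A q x) := by
  rw [← q_vandermonde hq0 hq1 x (n + 1) _ _ hA0.le hA1 (by omega), Finset.mul_sum]
  refine Finset.sum_congr rfl fun j hj => ?_
  have hj := Finset.mem_range.1 hj
  obtain ⟨i, rfl⟩ : ∃ i, n = j + i := ⟨n - j, by omega⟩
  have hqj := (qPoch_self_pos hq0 hq1 j).ne'
  have hcj := (qPoch_pos hq0 hq1 hA0.le hA1 j).ne'
  rw [h, hahnCoeff, qPoch_add A, qPoch_add (q ^ (j + i))⁻¹, Nat.add_sub_cancel_left,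
    mul_comm (q ^ j)]
  field_simp

theorem choose_two_succ (x : ℕ) : (x + 1).choose 2 = x + x.choose 2 := by
  rw [Nat.choose_succ_succ' x 1, Nat.choose_one_right]

/-- The i-th factor is -A q^i (1 - B q^(x+x'-1-i)), so the product in `hahn_top` consists of the
last x factors of (B;q)_(x+x'). -/
theorem prod_top (q A B : ℝ) (hq : q ≠ 0) (x : ℕ) : ∀ x' : ℕ,
    (∏ i ∈ Finset.range x, (A * B / q * q ^ (x + x') - A * q ^ i)) * qPoch B q x' =
      (-A) ^ x * q ^ (x.choose 2) * qPoch B q (x + x') := by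
  induction x with
  | zero => intro x'; simp
  | succ x ih =>
    intro x'
    have h := ih (x' + 1)
    rw [qPoch_succ, show x + (x' + 1) = x + 1 + x' by ring] at h
    rw [Finset.prod_range_succ, choose_two_succ, pow_add q x]
    have e : A * B / q * q ^ (x + 1 + x') - A * q ^ x = - A * q ^ x * (1 - B * q ^ x') := by
      field_simp; ring
    rw [e, pow_succ (-A)]
    linear_combination (-A * q ^ x) * h

/-! ### The lowering operator -/

/-- The operator adjoint to the raising operator. -/
noncomputable def lower (q A B : ℝ) (g : ℕ → ℕ → ℝ) (u u' : ℕ) : ℝ :=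
  (1 - A * q ^ u) * g (u + 1) u' + A * q ^ u * (1 - B * q ^ u') * g u (u' + 1)

/-- The truncated subtractions do no harm: the coefficient 1 - q^0 vanishes where they would matter.
-/
noncomputable def raise (q : ℝ) (f : ℕ → ℕ → ℝ) (x x' : ℕ) : ℝ :=
  (1 - q ^ x) * f (x - 1) x' + q ^ x * (1 - q ^ x') * f x (x' - 1)

/-- A q-commutation relation whose correction is a scalar at each level. It moves knowledge of
`lower` from one level to the next. -/
theorem lower_raise (q A B : ℝ) (f : ℕ → ℕ → ℝ) (u u' : ℕ) :
    lower q A B (raise q f) u u' = q * raise q (lower q A B f) u u' +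
      (1 - q) * (1 - A * B * q ^ (2 * (u + u'))) * f u u' := by
  rcases u with _ | u <;> rcases u' with _ | u' <;> simp [lower, raise] <;> ring

theorem raise_hahn {q : ℝ} (hq0 : 0 < q) (A B : ℝ) (n : ℕ) :
    raise q (hahn q A B n) = fun x x' => (q ^ n - q ^ (x + x')) * hahn q A B n x x' := by
  funext x x'
  exact hahn_raise hq0 A B n x x'

/-- The starting point for `lower_hahn`: on the level just below n, only the product formula for h_n
at N = n enters, and the two terms cancel. -/
theorem lower_hahn_top {q A : ℝ} (hq0 : 0 < q) (hq1 : q < 1) (hA0 : 0 < A) (hA1 : A < 1) (B : ℝ)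
    (u u' : ℕ) : lower q A B (hahn q A B (u + u' + 1)) u u' = 0 := by
  have hA := (qPoch_pos hq0 hq1 hA0.le hA1 u).ne'
  have hA1 := (one_sub_mul_pow_pos hq0 hq1 hA0.le hA1 u).ne'
  rw [lower, hahn_top hq0 hq1 hA0 ‹_› B (show u + 1 + u' = u + u' + 1 by ring),
    hahn_top hq0 hq1 hA0 ‹_› B (show u + (u' + 1) = u + u' + 1 by ring), Finset.prod_range_succ,
    qPoch_succ A q u]
  have e : A * B / q * q ^ (u + u' + 1) - A * q ^ u = - A * q ^ u * (1 - B * q ^ u') := by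
    field_simp; ring
  rw [e]
  field_simp
  ring

/-- Below level n everything vanishes, with `lower_hahn_top` on the borderline. Above it,
`lower_raise` and the eigenvalue equation of `raise` express `lower` at level N + 1 through `lower`
at level N; the factor q^n - q^(N+2) to be cancelled is nonzero. -/
theorem lower_hahn {q A : ℝ} (hq0 : 0 < q) (hq1 : q < 1) (hA0 : 0 < A) (hA1 : A < 1) (B : ℝ)
    (n N : ℕ) : ∀ u u' : ℕ, u + u' = N →
    q ^ n * lower q A B (hahn q A B n) u u' = (1 - A * B * q ^ (n + N)) * hahn q A B n u u' := by
  have small : ∀ u u' : ℕ, u + u' < n →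
      q ^ n * lower q A B (hahn q A B n) u u' =
        (1 - A * B * q ^ (n + (u + u'))) * hahn q A B n u u' := by
    intro u u' h
    rw [hahn_eq_zero hq0 A B h, mul_zero]
    rcases Nat.lt_or_ge (u + u' + 1) n with h' | h'
    · rw [lower, hahn_eq_zero hq0 A B (by omega : u + 1 + u' < n),
        hahn_eq_zero hq0 A B (by omega : u + (u' + 1) < n)]
      ring
    · obtain rfl : n = u + u' + 1 := by omega
      rw [lower_hahn_top hq0 hq1 hA0 hA1, mul_zero]
  induction N with
  | zero =>
    intro u u' h
    rcases Nat.lt_or_ge (u + u') n with hn | hn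
    · rw [small u u' hn, h]
    · obtain ⟨rfl, rfl, rfl⟩ : u = 0 ∧ u' = 0 ∧ n = 0 := by omega
      -- At level 0 both coefficients of `raise` vanish, so the commutation relation alone gives the
      -- value, up to the factor 1 - q.
      have h1 := lower_raise q A B (hahn q A B 0) 0 0
      rw [raise_hahn hq0, raise] at h1
      have hne : 1 - q ≠ 0 := by linarith
      apply mul_left_cancel₀ hne
      simp only [lower, pow_zero, zero_add, mul_one, add_zero, mul_zero, sub_self, zero_mul,
        pow_one] at h1 ⊢
      linear_combination h1
  | succ N ih =>
    intro u u' h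
    rcases Nat.lt_or_ge (u + u') n with hn | hn
    · rw [small u u' hn, h]
    have h1 := lower_raise q A B (hahn q A B n) u u'
    rw [raise_hahn hq0] at h1
    have h2 : lower q A B (fun x x' => (q ^ n - q ^ (x + x')) * hahn q A B n x x') u u' =
        (q ^ n - q ^ (N + 2)) * lower q A B (hahn q A B n) u u' := by
      simp only [lower]
      rw [show u + 1 + u' = N + 2 by omega, show u + (u' + 1) = N + 2 by omega]
      ring
    have h3 : q ^ n * raise q (lower q A B (hahn q A B n)) u u' =
        (1 - A * B * q ^ (n + N)) * raise q (hahn q A B n) u u' := by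
      simp only [raise]
      have e1 : (1 - q ^ u) * (q ^ n * lower q A B (hahn q A B n) (u - 1) u') =
          (1 - q ^ u) * ((1 - A * B * q ^ (n + N)) * hahn q A B n (u - 1) u') := by
        rcases u with _ | u
        · simp
        · rw [ih _ _ (by omega)]
      have e2 : (1 - q ^ u') * (q ^ n * lower q A B (hahn q A B n) u (u' - 1)) =
          (1 - q ^ u') * ((1 - A * B * q ^ (n + N)) * hahn q A B n u (u' - 1)) := by
        rcases u' with _ | u'
        · simp
        · rw [ih _ _ (by omega)]
      linear_combination e1 + q ^ u * e2
    rw [raise_hahn hq0] at h3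
    simp only [] at h3
    rw [h2] at h1
    rw [h] at h1 h3
    have hne : q ^ n - q ^ (N + 2) ≠ 0 := by
      have := pow_lt_pow_right_of_lt_one₀ hq0 hq1 (show n < N + 2 by omega)
      linarith
    apply mul_left_cancel₀ hne
    linear_combination q ^ n * h1 + q * h3

/-! ### Orthogonality and norm of the q-Hahn polynomials -/

/-- The `q`-Hahn weight. -/
noncomputable def wt (q A B : ℝ) (x x' : ℕ) : ℝ :=
  qPoch A q x * qPoch B q x' / (qPoch q q x * qPoch q q x') * A ^ x'

/-- Summation by parts: each half of `raise` is shifted by one step in x or in x', and the quotients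
of neighbouring weights are the coefficients of `lower`. -/
theorem sum_raise_mul {q : ℝ} (hq0 : 0 < q) (hq1 : q < 1) (A B : ℝ) (f g : ℕ → ℕ → ℝ) (N : ℕ) :
    ∑ p ∈ antidiagonal (N + 1), wt q A B p.1 p.2 * (raise q f p.1 p.2 * g p.1 p.2) =
      ∑ p ∈ antidiagonal N, wt q A B p.1 p.2 * (f p.1 p.2 * lower q A B g p.1 p.2) := by
  have h : ∀ p : ℕ × ℕ, wt q A B p.1 p.2 * (raise q f p.1 p.2 * g p.1 p.2) =
      wt q A B p.1 p.2 * ((1 - q ^ p.1) * f (p.1 - 1) p.2 * g p.1 p.2) +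
      wt q A B p.1 p.2 * (q ^ p.1 * (1 - q ^ p.2) * f p.1 (p.2 - 1) * g p.1 p.2) := by
    intro p; rw [raise]; ring
  rw [Finset.sum_congr rfl fun p _ => h p, Finset.sum_add_distrib,
    Finset.Nat.sum_antidiagonal_succ, Finset.Nat.sum_antidiagonal_succ']
  simp only [pow_zero, sub_self, zero_mul, mul_zero, zero_add, Nat.add_sub_cancel]
  rw [← Finset.sum_add_distrib]
  refine Finset.sum_congr rfl fun p _ => ?_
  have h1 := (qPoch_self_pos hq0 hq1 p.1).ne'
  have h2 := (qPoch_self_pos hq0 hq1 p.2).ne'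
  have h3 := (one_sub_mul_pow_pos hq0 hq1 hq0.le hq1 p.1).ne'
  have h4 := (one_sub_mul_pow_pos hq0 hq1 hq0.le hq1 p.2).ne'
  simp only [wt, lower, qPoch_succ, pow_succ']
  generalize 1 - q * q ^ p.1 = c at h3 ⊢
  generalize 1 - q * q ^ p.2 = c' at h4 ⊢
  field_simp

/-- Evaluating both sides of the adjointness relation on h_n and h_m gives a one-step recursion in N
for their inner product, from which orthogonality and norm both follow. -/
theorem sum_hahn_mul_hahn_succ {q A : ℝ} (hq0 : 0 < q) (hq1 : q < 1) (hA0 : 0 < A) (hA1 : A < 1)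
    (B : ℝ) (n m N : ℕ) :
    q ^ m * (q ^ n - q ^ (N + 1)) * ∑ p ∈ antidiagonal (N + 1),
        wt q A B p.1 p.2 * (hahn q A B n p.1 p.2 * hahn q A B m p.1 p.2) =
      (1 - A * B * q ^ (m + N)) * ∑ p ∈ antidiagonal N,
        wt q A B p.1 p.2 * (hahn q A B n p.1 p.2 * hahn q A B m p.1 p.2) := by
  have h := sum_raise_mul hq0 hq1 A B (hahn q A B n) (hahn q A B m) N
  rw [mul_assoc]
  calc _ = q ^ m * ∑ p ∈ antidiagonal (N + 1), wt q A B p.1 p.2 *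
        (raise q (hahn q A B n) p.1 p.2 * hahn q A B m p.1 p.2) := by
        rw [Finset.mul_sum (a := q ^ n - q ^ (N + 1))]
        congr 1
        refine Finset.sum_congr rfl fun p hp => ?_
        simp only [raise_hahn hq0]
        rw [Finset.HasAntidiagonal.mem_antidiagonal.1 hp]
        ring
    _ = _ := by
        rw [h, Finset.mul_sum, Finset.mul_sum]
        refine Finset.sum_congr rfl fun p hp => ?_
        have := lower_hahn hq0 hq1 hA0 hA1 B m N p.1 p.2 (Finset.HasAntidiagonal.mem_antidiagonal.1 hp)
        linear_combination wt q A B p.1 p.2 * hahn q A B n p.1 p.2 * this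

/-- For n < m the inner product vanishes at levels below m, since h_m does, and the recursion
propagates the zero because q^n ≠ q^(N+1) from there on. -/
theorem sum_hahn_mul_hahn_eq_zero {q A : ℝ} (hq0 : 0 < q) (hq1 : q < 1) (hA0 : 0 < A) (hA1 : A < 1)
    (B : ℝ) (N : ℕ) : ∀ n m : ℕ, n ≠ m → ∑ p ∈ antidiagonal N,
        wt q A B p.1 p.2 * (hahn q A B n p.1 p.2 * hahn q A B m p.1 p.2) = 0 := by
  have big : ∀ N n m : ℕ, N < m → ∑ p ∈ antidiagonal N,
        wt q A B p.1 p.2 * (hahn q A B n p.1 p.2 * hahn q A B m p.1 p.2) = 0 := by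
    intro N n m h
    refine Finset.sum_eq_zero fun p hp => ?_
    rw [hahn_eq_zero (n := m) hq0 A B (by rwa [Finset.HasAntidiagonal.mem_antidiagonal.1 hp])]
    ring
  have main : ∀ n m : ℕ, n < m → ∑ p ∈ antidiagonal N,
        wt q A B p.1 p.2 * (hahn q A B n p.1 p.2 * hahn q A B m p.1 p.2) = 0 := by
    induction N with
    | zero => exact fun n m h => big 0 n m (by omega)
    | succ N ih =>
      intro n m h
      rcases Nat.lt_or_ge (N + 1) m with h' | h'
      · exact big _ _ _ h'
      have h1 := sum_hahn_mul_hahn_succ hq0 hq1 hA0 hA1 B n m N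
      rw [ih n m h, mul_zero] at h1
      have := pow_lt_pow_right_of_lt_one₀ hq0 hq1 (show n < N + 1 by omega)
      refine (mul_eq_zero.1 h1).resolve_left (mul_ne_zero (pow_pos hq0 m).ne' (by linarith))
  intro n m h
  rcases lt_or_gt_of_ne h with h | h
  · exact main n m h
  · rw [← main m n h]
    exact Finset.sum_congr rfl fun p _ => by ring

/-- A q-Vandermonde sum in symmetric form, needed for the squared norm of h_n at N = n. -/
theorem sum_norm_top {q : ℝ} (hq0 : 0 < q) (hq1 : q < 1) (n : ℕ) : ∀ A B : ℝ,
    0 < A → A < 1 → 0 < B → B < 1 →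
    ∑ p ∈ antidiagonal n, A ^ p.1 * (q ^ (p.1.choose 2)) ^ 2 /
        (qPoch q q p.1 * qPoch A q p.1 * (qPoch q q p.2 * qPoch B q p.2)) =
      qPoch (A * B / q * q ^ n) q n / (qPoch q q n * qPoch A q n * qPoch B q n) := by
  induction n with
  | zero => intro A B _ _ _ _; simp [qPoch_zero]
  | succ n ih =>
    intro A B hA0 hA1 hB0 hB1
    have h1 := ih (A * q) B (by positivity) (by nlinarith) hB0 hB1
    have h2 := ih A (B * q) hA0 hA1 (by positivity) (by nlinarith)
    have hq : 1 - q * q ^ n ≠ 0 := (one_sub_mul_pow_pos hq0 hq1 hq0.le hq1 n).ne'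
    have hA : 1 - A ≠ 0 := by linarith
    have hB : 1 - B ≠ 0 := by linarith
    -- With p.1 + p.2 = n + 1, split 1 - q^(n+1) = (1 - q^p.1) q^p.2 + (1 - q^p.2). Each part
    -- cancels a factor of (q;q) and shifts one index, which replaces A by Aq or B by Bq.
    have step : (1 - q * q ^ n) * ∑ p ∈ antidiagonal (n + 1),
        A ^ p.1 * (q ^ (p.1.choose 2)) ^ 2 /
          (qPoch q q p.1 * qPoch A q p.1 * (qPoch q q p.2 * qPoch B q p.2)) =
        A * q ^ n / (1 - A) * ∑ p ∈ antidiagonal n, (A * q) ^ p.1 *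
          (q ^ (p.1.choose 2)) ^ 2 /
          (qPoch q q p.1 * qPoch (A * q) q p.1 * (qPoch q q p.2 * qPoch B q p.2)) +
        1 / (1 - B) * ∑ p ∈ antidiagonal n, A ^ p.1 * (q ^ (p.1.choose 2)) ^ 2 /
          (qPoch q q p.1 * qPoch A q p.1 * (qPoch q q p.2 * qPoch (B * q) q p.2)) := by
      have hs : ∀ p ∈ antidiagonal (n + 1), (1 - q * q ^ n) *
          (A ^ p.1 * (q ^ (p.1.choose 2)) ^ 2 /
          (qPoch q q p.1 * qPoch A q p.1 * (qPoch q q p.2 * qPoch B q p.2))) =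
          (1 - q ^ p.1) * q ^ p.2 * (A ^ p.1 * (q ^ (p.1.choose 2)) ^ 2 /
          (qPoch q q p.1 * qPoch A q p.1 * (qPoch q q p.2 * qPoch B q p.2))) +
          (1 - q ^ p.2) * (A ^ p.1 * (q ^ (p.1.choose 2)) ^ 2 /
          (qPoch q q p.1 * qPoch A q p.1 * (qPoch q q p.2 * qPoch B q p.2))) := by
        intro p hp
        rw [← pow_succ', ← Finset.HasAntidiagonal.mem_antidiagonal.1 hp, pow_add]
        ring
      rw [Finset.mul_sum, Finset.sum_congr rfl hs, Finset.sum_add_distrib,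
        Finset.Nat.sum_antidiagonal_succ, Finset.Nat.sum_antidiagonal_succ', Finset.mul_sum,
        Finset.mul_sum]
      simp only [pow_zero, sub_self, zero_mul, zero_add]
      congr 1
      · refine Finset.sum_congr rfl fun p hp => ?_
        have h1 := (qPoch_self_pos hq0 hq1 p.1).ne'
        have h2 := (qPoch_self_pos hq0 hq1 p.2).ne'
        have h3 := (one_sub_mul_pow_pos hq0 hq1 hq0.le hq1 p.1).ne'
        have h4 := (qPoch_pos hq0 hq1 hB0.le hB1 p.2).ne'
        have h5 := (qPoch_pos hq0 hq1 (by positivity : 0 ≤ A * q) (by nlinarith) p.1).ne'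
        rw [← Finset.HasAntidiagonal.mem_antidiagonal.1 hp, qPoch_succ q, qPoch_succ_left A, choose_two_succ,
          pow_succ' q p.1]
        field_simp
        ring
      · refine Finset.sum_congr rfl fun p hp => ?_
        have h1 := (qPoch_self_pos hq0 hq1 p.1).ne'
        have h2 := (qPoch_self_pos hq0 hq1 p.2).ne'
        have h3 := (one_sub_mul_pow_pos hq0 hq1 hq0.le hq1 p.2).ne'
        have h4 := (qPoch_pos hq0 hq1 hA0.le hA1 p.1).ne'
        have h5 := (qPoch_pos hq0 hq1 (by positivity : 0 ≤ B * q) (by nlinarith) p.2).ne'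
        rw [qPoch_succ q, qPoch_succ_left B, pow_succ' q p.2]
        field_simp
    apply mul_left_cancel₀ hq
    rw [step, h1, h2]
    have h1 := (qPoch_self_pos hq0 hq1 n).ne'
    have hA' := (qPoch_pos hq0 hq1 hA0.le hA1 n).ne'
    have hB' := (qPoch_pos hq0 hq1 hB0.le hB1 n).ne'
    have hAn := (one_sub_mul_pow_pos hq0 hq1 hA0.le hA1 n).ne'
    have hBn := (one_sub_mul_pow_pos hq0 hq1 hB0.le hB1 n).ne'
    have eA : qPoch (A * q) q n = qPoch A q n * (1 - A * q ^ n) / (1 - A) := by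
      rw [← qPoch_succ, qPoch_succ_left]; field_simp
    have eB : qPoch (B * q) q n = qPoch B q n * (1 - B * q ^ n) / (1 - B) := by
      rw [← qPoch_succ, qPoch_succ_left]; field_simp
    have e1 : A * q * B / q * q ^ n = A * B / q * q ^ (n + 1) := by field_simp; ring
    have e2 : A * (B * q) / q * q ^ n = A * B / q * q ^ (n + 1) := by field_simp; ring
    have e3 : 1 - A * B / q * q ^ (n + 1) * q ^ n = 1 - A * B * q ^ n * q ^ n := by
      field_simp; ring
    rw [eA, eB, e1, e2, qPoch_succ, qPoch_succ, qPoch_succ, qPoch_succ, e3]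
    generalize qPoch (A * B / q * q ^ (n + 1)) q n = T
    generalize 1 - q * q ^ n = w at hq ⊢
    have hAn' : 1 - q ^ n * A ≠ 0 := by rwa [mul_comm]
    have hBn' : 1 - q ^ n * B ≠ 0 := by rwa [mul_comm]
    generalize q ^ n = z at hAn hBn hAn' hBn' ⊢
    field_simp
    ring

/-- The part of the norm of the `q`-Hahn polynomial that does not depend on `N`. -/
noncomputable def normFactor (q A B : ℝ) (n : ℕ) : ℝ :=
  qPoch q q n * qPoch A q n * qPoch B q n * A ^ n * (q ^ (n.choose 2)) ^ 2 *
    qPoch (A * B / q * q ^ n) q n / qPoch (A * B) q (2 * n)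

/-- Induction on d = N - n: the base N = n is `hahn_top` with `sum_norm_top`, the step is the
recursion `sum_hahn_mul_hahn_succ`. -/
theorem sum_hahn_sq {q A B : ℝ} (hq0 : 0 < q) (hq1 : q < 1) (hA0 : 0 < A) (hA1 : A < 1)
    (hB0 : 0 < B) (hB1 : B < 1) (n d : ℕ) :
    ∑ p ∈ antidiagonal (n + d),
        wt q A B p.1 p.2 * (hahn q A B n p.1 p.2 * hahn q A B n p.1 p.2) =
      qPoch (A * B) q (2 * n + d) / qPoch q q d * (q ^ ((n + d) * n))⁻¹ ^ 2 *
        normFactor q A B n := by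
  have hAB0 : 0 < A * B := by positivity
  have hAB1 : A * B < 1 := by nlinarith
  have hABn := fun k => (qPoch_pos hq0 hq1 hAB0.le hAB1 k).ne'
  induction d with
  | zero =>
    have hqn := (qPoch_self_pos hq0 hq1 n).ne'
    have hAn := (qPoch_pos hq0 hq1 hA0.le hA1 n).ne'
    have hBn := (qPoch_pos hq0 hq1 hB0.le hB1 n).ne'
    have ht : ∀ p ∈ antidiagonal n,
        wt q A B p.1 p.2 * (hahn q A B n p.1 p.2 * hahn q A B n p.1 p.2) =
        A ^ n * (qPoch A q n * qPoch (q ^ n)⁻¹ q n * qPoch B q n) ^ 2 *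
        (A ^ p.1 * (q ^ (p.1.choose 2)) ^ 2 /
        (qPoch q q p.1 * qPoch A q p.1 * (qPoch q q p.2 * qPoch B q p.2))) := by
      intro p hp
      have hp := Finset.HasAntidiagonal.mem_antidiagonal.1 hp
      have h1 := (qPoch_self_pos hq0 hq1 p.1).ne'
      have h2 := (qPoch_self_pos hq0 hq1 p.2).ne'
      have h3 := (qPoch_pos hq0 hq1 hA0.le hA1 p.1).ne'
      have h4 := (qPoch_pos hq0 hq1 hB0.le hB1 p.2).ne'
      have h5 := prod_top q A B hq0.ne' p.1 p.2
      rw [hp, ← eq_div_iff h4] at h5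
      have h6 : ((-A) ^ p.1) ^ 2 = A ^ p.1 * A ^ p.1 := by
        rw [← pow_mul, mul_comm, pow_mul, neg_sq, ← pow_mul, mul_comm, pow_mul, sq]
      rw [hahn_top hq0 hq1 hA0 hA1 B hp, h5, wt]
      have h7 : A ^ n = A ^ p.1 * A ^ p.2 := by rw [← pow_add, hp]
      rw [h7]
      field_simp
      rw [h6]
      ring
    rw [add_zero, Finset.sum_congr rfl ht, ← Finset.mul_sum,
      sum_norm_top hq0 hq1 n A B hA0 hA1 hB0 hB1, normFactor]
    have h := qPoch_inv_pow hq0 n 0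
    simp only [add_zero, qPoch_zero, mul_one, zero_add] at h ⊢
    -- Only the square of (q^(-n);q)_n occurs, so its sign drops out.
    have h8 : (qPoch (q ^ n)⁻¹ q n * (q ^ n * q ^ n.choose 2)) ^ 2 = qPoch q q n ^ 2 := by
      rw [h, mul_pow, ← pow_mul, mul_comm n 2, pow_mul]; simp
    have h9 : q ^ (n * n) = q ^ n * (q ^ n.choose 2) ^ 2 := by
      rw [← pow_mul, ← pow_add]
      congr 1
      have := Nat.triangle_succ n
      rw [Nat.choose_two_right]
      rw [Nat.div_mul_cancel (Nat.even_mul_pred_self n).two_dvd]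
      cases n <;> simp; ring
    rw [h9]
    have := hABn (2 * n)
    have hc := pow_pos hq0 (n.choose 2)
    have hn := pow_pos hq0 n
    generalize qPoch (A * B / q * q ^ n) q n = T
    generalize qPoch (q ^ n)⁻¹ q n = U at *
    field_simp
    have h10 : U ^ 2 * (q ^ n) ^ 2 * (q ^ n.choose 2) ^ 2 = qPoch q q n ^ 2 := by
      rw [← h8]; ring
    linear_combination T * h10
  | succ d ih =>
    have h := sum_hahn_mul_hahn_succ hq0 hq1 hA0 hA1 B n n (n + d)
    rw [ih] at h
    have hlt := pow_lt_pow_right_of_lt_one₀ hq0 hq1 (show n < n + d + 1 by omega)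
    have hne : q ^ n * (q ^ n - q ^ (n + d + 1)) ≠ 0 :=
      mul_ne_zero (pow_pos hq0 n).ne' (by linarith)
    have hd := (qPoch_self_pos hq0 hq1 d).ne'
    have hd1 := (one_sub_mul_pow_pos hq0 hq1 hq0.le hq1 d).ne'
    apply mul_left_cancel₀ hne
    rw [← add_assoc n d 1, h, ← add_assoc (2 * n) d 1, qPoch_succ, qPoch_succ,
      show n + (n + d) = 2 * n + d by ring, show (n + d + 1) * n = (n + d) * n + n by ring,
      pow_add q ((n + d) * n), show n + d + 1 = n + (d + 1) by ring, pow_add q n (d + 1),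
      pow_succ' q d]
    have hn := pow_pos hq0 n
    have hnd := pow_pos hq0 ((n + d) * n)
    field_simp

/-! ### The unnormalised bases in three variables and their raising and lowering operators -/

/-- The polynomial part of the basis `Ψ`. -/
noncomputable def polyPsi (q A B C : ℝ) (n₁ n₂ y₁ y₂ y₃ : ℕ) : ℝ :=
  hahn q A B n₁ y₁ y₂ * hahn q (A * B * q ^ (2 * n₁)) C n₂ (y₁ + y₂ - n₁) y₃

/-- The polynomial part of the basis `Ξ`. -/
noncomputable def polyXi (q A B C : ℝ) (m₁ m₂ y₁ y₂ y₃ : ℕ) : ℝ :=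
  (q ^ (m₁ * y₁))⁻¹ * hahn q B C m₁ y₂ y₃ *
    hahn q A (B * C * q ^ (2 * m₁)) m₂ y₁ (y₂ + y₃ - m₁)

noncomputable def raise₃ (q : ℝ) (f : ℕ → ℕ → ℕ → ℝ) (y₁ y₂ y₃ : ℕ) : ℝ :=
  (1 - q ^ y₁) * f (y₁ - 1) y₂ y₃ + q ^ y₁ * (1 - q ^ y₂) * f y₁ (y₂ - 1) y₃ +
    q ^ (y₁ + y₂) * (1 - q ^ y₃) * f y₁ y₂ (y₃ - 1)

noncomputable def lower₃ (q A B C : ℝ) (f : ℕ → ℕ → ℕ → ℝ) (y₁ y₂ y₃ : ℕ) : ℝ :=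
  (1 - A * q ^ y₁) * f (y₁ + 1) y₂ y₃ + A * q ^ y₁ * (1 - B * q ^ y₂) * f y₁ (y₂ + 1) y₃ +
    A * B * q ^ (y₁ + y₂) * (1 - C * q ^ y₃) * f y₁ y₂ (y₃ + 1)

/-- Lets truncated arguments be rewritten under a factor 1 - q^x, since at x = 0 nothing has to be
proved. -/
theorem one_sub_pow_mul_congr (q : ℝ) {x : ℕ} {s t : ℝ} (h : x ≠ 0 → s = t) :
    (1 - q ^ x) * s = (1 - q ^ x) * t := by
  rcases Nat.eq_zero_or_pos x with rfl | hx
  · simp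
  · rw [h hx.ne']

/-- The first two terms form `raise` in (y₁, y₂), with eigenvalue q^n₁ (1 - q^d), d = y₁ + y₂ - n₁.
Together with the third they form q^n₁ times `raise` in (d, y₃) acting on the second factor. -/
theorem raise₃_polyPsi {q : ℝ} (hq0 : 0 < q) (A B C : ℝ) (n₁ n₂ y₁ y₂ y₃ : ℕ) :
    raise₃ q (polyPsi q A B C n₁ n₂) y₁ y₂ y₃ =
      (q ^ (n₁ + n₂) - q ^ (y₁ + y₂ + y₃)) * polyPsi q A B C n₁ n₂ y₁ y₂ y₃ := by
  simp only [raise₃, polyPsi]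
  rcases Nat.lt_or_ge (y₁ + y₂) n₁ with h | h
  · rw [hahn_eq_zero hq0 A B h, hahn_eq_zero hq0 A B (by omega : y₁ - 1 + y₂ < n₁),
      hahn_eq_zero hq0 A B (by omega : y₁ + (y₂ - 1) < n₁)]
    ring
  obtain ⟨d, hd⟩ := Nat.exists_eq_add_of_le h
  set G := hahn q (A * B * q ^ (2 * n₁)) C n₂ with hG
  have e1 : (1 - q ^ y₁) * (hahn q A B n₁ (y₁ - 1) y₂ * G (y₁ - 1 + y₂ - n₁) y₃) =
      (1 - q ^ y₁) * (hahn q A B n₁ (y₁ - 1) y₂ * G (d - 1) y₃) :=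
    one_sub_pow_mul_congr q fun h => by rw [show y₁ - 1 + y₂ - n₁ = d - 1 by omega]
  have e2 : (1 - q ^ y₂) * (hahn q A B n₁ y₁ (y₂ - 1) * G (y₁ + (y₂ - 1) - n₁) y₃) =
      (1 - q ^ y₂) * (hahn q A B n₁ y₁ (y₂ - 1) * G (d - 1) y₃) :=
    one_sub_pow_mul_congr q fun h => by rw [show y₁ + (y₂ - 1) - n₁ = d - 1 by omega]
  have h1 := hahn_raise hq0 A B n₁ y₁ y₂
  have h2 := hahn_raise hq0 (A * B * q ^ (2 * n₁)) C n₂ d y₃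
  rw [← hG] at h2
  rw [e1, mul_assoc (q ^ y₁), e2, show y₁ + y₂ - n₁ = d by omega]
  rw [hd] at h1 ⊢
  simp only [pow_add] at h1 h2 ⊢
  linear_combination G (d - 1) y₃ * h1 + q ^ n₁ * hahn q A B n₁ y₁ y₂ * h2

/-- Here the last two terms combine first and yield a factor q^m₁. The power q^(-m₁ y₁) in `polyXi`
supplies the same factor in the first term, so that `raise` in (y₁, d) appears. -/
theorem raise₃_polyXi {q : ℝ} (hq0 : 0 < q) (A B C : ℝ) (m₁ m₂ y₁ y₂ y₃ : ℕ) :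
    raise₃ q (polyXi q A B C m₁ m₂) y₁ y₂ y₃ =
      (q ^ (m₁ + m₂) - q ^ (y₁ + y₂ + y₃)) * polyXi q A B C m₁ m₂ y₁ y₂ y₃ := by
  simp only [raise₃, polyXi]
  rcases Nat.lt_or_ge (y₂ + y₃) m₁ with h | h
  · rw [hahn_eq_zero hq0 B C h, hahn_eq_zero hq0 B C (by omega : y₂ - 1 + y₃ < m₁),
      hahn_eq_zero hq0 B C (by omega : y₂ + (y₃ - 1) < m₁)]
    ring
  obtain ⟨d, hd⟩ := Nat.exists_eq_add_of_le h
  set G := hahn q A (B * C * q ^ (2 * m₁)) m₂ with hG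
  set v := (q ^ (m₁ * y₁))⁻¹ with hv
  have e1 : (1 - q ^ y₁) * ((q ^ (m₁ * (y₁ - 1)))⁻¹ * hahn q B C m₁ y₂ y₃ *
      G (y₁ - 1) (y₂ + y₃ - m₁)) =
      (1 - q ^ y₁) * (q ^ m₁ * v * hahn q B C m₁ y₂ y₃ * G (y₁ - 1) d) :=
    one_sub_pow_mul_congr q fun h => by
      obtain ⟨x, rfl⟩ := Nat.exists_eq_succ_of_ne_zero h
      have := pow_pos hq0 m₁
      have := pow_pos hq0 (m₁ * x)
      rw [show y₂ + y₃ - m₁ = d by omega, hv, Nat.succ_eq_add_one, mul_add, pow_add,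
        Nat.add_sub_cancel, mul_one]
      field_simp
  have e2 : (1 - q ^ y₂) * (v * hahn q B C m₁ (y₂ - 1) y₃ * G y₁ (y₂ - 1 + y₃ - m₁)) =
      (1 - q ^ y₂) * (v * hahn q B C m₁ (y₂ - 1) y₃ * G y₁ (d - 1)) :=
    one_sub_pow_mul_congr q fun h => by rw [show y₂ - 1 + y₃ - m₁ = d - 1 by omega]
  have e3 : (1 - q ^ y₃) * (v * hahn q B C m₁ y₂ (y₃ - 1) * G y₁ (y₂ + (y₃ - 1) - m₁)) =
      (1 - q ^ y₃) * (v * hahn q B C m₁ y₂ (y₃ - 1) * G y₁ (d - 1)) :=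
    one_sub_pow_mul_congr q fun h => by rw [show y₂ + (y₃ - 1) - m₁ = d - 1 by omega]
  have h1 := hahn_raise hq0 B C m₁ y₂ y₃
  have h2 := hahn_raise hq0 A (B * C * q ^ (2 * m₁)) m₂ y₁ d
  rw [← hG] at h2
  rw [e1, mul_assoc (q ^ y₁), e2, mul_assoc (q ^ (y₁ + y₂)), e3,
    show y₂ + y₃ - m₁ = d by omega]
  rw [add_assoc y₁ y₂ y₃]
  rw [hd] at h1 ⊢
  simp only [pow_add] at h1 h2 ⊢
  linear_combination q ^ y₁ * v * G y₁ (d - 1) * h1 + q ^ m₁ * v * hahn q B C m₁ y₂ y₃ * h2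

/-- As for `raise₃`, the operator collapses to `lower` on the second factor, now with first
parameter A B q^(2n₁). That sits one level below its degree n₂, where `lower_hahn` gives zero. -/
theorem lower₃_polyPsi {q A B C : ℝ} (hq0 : 0 < q) (hq1 : q < 1) (hA0 : 0 < A) (hA1 : A < 1)
    (hB0 : 0 < B) (hB1 : B < 1) {n₁ n₂ y₁ y₂ y₃ : ℕ} (h : y₁ + y₂ + y₃ + 1 = n₁ + n₂) :
    lower₃ q A B C (polyPsi q A B C n₁ n₂) y₁ y₂ y₃ = 0 := by
  have hA'0 : 0 < A * B * q ^ (2 * n₁) := by positivity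
  have hA'1 : A * B * q ^ (2 * n₁) < 1 := by
    have := one_sub_mul_pow_pos hq0 hq1 (by positivity : 0 ≤ A * B) (by nlinarith) (2 * n₁)
    linarith
  have h1 := lower_hahn hq0 hq1 hA0 hA1 B n₁ _ y₁ y₂ rfl
  apply mul_left_cancel₀ (pow_pos hq0 n₁).ne'
  simp only [lower₃, polyPsi, lower] at h1 ⊢
  rw [show y₁ + (y₂ + 1) = y₁ + 1 + y₂ by ring]
  rcases Nat.lt_or_ge (y₁ + y₂) n₁ with hs | hs
  · rw [hahn_eq_zero hq0 A B hs] at h1 ⊢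
    linear_combination hahn q (A * B * q ^ (2 * n₁)) C n₂ (y₁ + 1 + y₂ - n₁) y₃ * h1
  obtain ⟨d, hd⟩ := Nat.exists_eq_add_of_le hs
  have h2 := lower_hahn hq0 hq1 hA'0 hA'1 C n₂ _ d y₃ rfl
  rw [hahn_eq_zero hq0 _ _ (by omega : d + y₃ < n₂), mul_zero, mul_eq_zero] at h2
  replace h2 := h2.resolve_left (pow_pos hq0 n₂).ne'
  rw [show y₁ + 1 + y₂ - n₁ = d + 1 by omega, show y₁ + y₂ - n₁ = d by omega]
  rw [hd] at h1 ⊢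
  simp only [lower] at h2
  simp only [pow_add, two_mul] at h1 h2 ⊢
  linear_combination hahn q (A * B * (q ^ n₁ * q ^ n₁)) C n₂ (d + 1) y₃ * h1 +
    hahn q A B n₁ y₁ y₂ * h2

theorem lower₃_polyXi {q A B C : ℝ} (hq0 : 0 < q) (hq1 : q < 1) (hA0 : 0 < A) (hA1 : A < 1)
    (hB0 : 0 < B) (hB1 : B < 1) {m₁ m₂ y₁ y₂ y₃ : ℕ} (h : y₁ + y₂ + y₃ + 1 = m₁ + m₂) :
    lower₃ q A B C (polyXi q A B C m₁ m₂) y₁ y₂ y₃ = 0 := by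
  have h1 := lower_hahn hq0 hq1 hB0 hB1 C m₁ _ y₂ y₃ rfl
  have hm := pow_pos hq0 m₁
  have hmy := pow_pos hq0 (m₁ * y₁)
  have e1 : (q ^ (m₁ * (y₁ + 1)))⁻¹ = (q ^ (m₁ * y₁))⁻¹ * (q ^ m₁)⁻¹ := by
    rw [mul_add, mul_one, pow_add, mul_inv]
  apply mul_left_cancel₀ hm.ne'
  simp only [lower₃, polyXi, lower, e1] at h1 ⊢
  rw [show y₂ + (y₃ + 1) = y₂ + 1 + y₃ by ring]
  generalize (q ^ (m₁ * y₁))⁻¹ = v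
  rcases Nat.lt_or_ge (y₂ + y₃) m₁ with hs | hs
  · rw [hahn_eq_zero hq0 B C hs] at h1 ⊢
    rw [pow_add]
    linear_combination v * A * q ^ y₁ *
      hahn q A (B * C * q ^ (2 * m₁)) m₂ y₁ (y₂ + 1 + y₃ - m₁) * h1
  obtain ⟨d, hd⟩ := Nat.exists_eq_add_of_le hs
  have h2 := lower_hahn hq0 hq1 hA0 hA1 (B * C * q ^ (2 * m₁)) m₂ _ y₁ d rfl
  rw [hahn_eq_zero hq0 _ _ (by omega : y₁ + d < m₂), mul_zero, mul_eq_zero] at h2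
  replace h2 := h2.resolve_left (pow_pos hq0 m₂).ne'
  rw [show y₂ + 1 + y₃ - m₁ = d + 1 by omega, show y₂ + y₃ - m₁ = d by omega]
  rw [hd] at h1
  have e2 : q ^ m₁ * (q ^ m₁)⁻¹ = 1 := mul_inv_cancel₀ hm.ne'
  simp only [lower] at h2
  simp only [pow_add, two_mul] at h1 h2 ⊢
  linear_combination
    v * A * q ^ y₁ * hahn q A (B * C * (q ^ m₁ * q ^ m₁)) m₂ y₁ (d + 1) * h1 +
    v * hahn q B C m₁ y₂ y₃ * h2 + (1 - A * q ^ y₁) * v * hahn q B C m₁ y₂ y₃ *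
      hahn q A (B * C * (q ^ m₁ * q ^ m₁)) m₂ (y₁ + 1) d * e2

/-- An element of the kernel of `lower₃` is determined by its values at `y₁ = 0`. -/
theorem eq_zero_of_lower₃ {q A : ℝ} (hq0 : 0 < q) (hq1 : q < 1) (hA0 : 0 < A) (hA1 : A < 1)
    (B C : ℝ) (K : ℕ) (f : ℕ → ℕ → ℕ → ℝ)
    (h : ∀ y₁ y₂ y₃, y₁ + y₂ + y₃ + 1 = K → lower₃ q A B C f y₁ y₂ y₃ = 0)
    (h0 : ∀ y₂ y₃, y₂ + y₃ = K → f 0 y₂ y₃ = 0) (y₁ : ℕ) :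
    ∀ y₂ y₃, y₁ + y₂ + y₃ = K → f y₁ y₂ y₃ = 0 := by
  induction y₁ with
  | zero => exact fun y₂ y₃ hy => h0 y₂ y₃ (by omega)
  | succ y₁ ih =>
    intro y₂ y₃ hy
    have h1 := h y₁ y₂ y₃ (by omega)
    rw [lower₃, ih (y₂ + 1) y₃ (by omega), ih y₂ (y₃ + 1) (by omega), mul_zero, mul_zero,
      add_zero, add_zero] at h1
    exact (mul_eq_zero.1 h1).resolve_left (one_sub_mul_pow_pos hq0 hq1 hA0.le hA1 y₁).ne'

/-! ### A terminating very-well-poised sum -/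

/-- Summand of a limiting case of the very-well-poised `₆φ₅` series, divided by the sum. -/
noncomputable def vwpTerm (q a b : ℝ) (i l : ℕ) : ℝ :=
  (1 - a * q ^ (2 * l)) / (1 - a) * (qPoch a q l * qPoch b q l * qPoch (q ^ i)⁻¹ q l) *
    (qPoch (a * q / b) q i * b ^ i) /
    (qPoch q q l * qPoch (a * q / b) q l * qPoch (a * q) q (i + l)) *
    ((-1) ^ l * (q ^ (l.choose 2))⁻¹ * (q ^ i / b) ^ l)

/-- A WZ-type telescoping: with the summand divided by the expected sum, its difference in i has
partial sums over l in closed form. -/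
theorem sum_range_vwpTerm_sub {q a b : ℝ} (hq0 : 0 < q) (hq1 : q < 1) (ha0 : 0 < a) (ha1 : a < 1)
    (hb : b ≠ 0) (i : ℕ) (hD : ∀ l < i + 1, 1 - a * q / b * q ^ l ≠ 0) (L : ℕ) (hL : L ≤ i + 1) :
    ∑ l ∈ Finset.range (L + 1), (vwpTerm q a b (i + 1) l - vwpTerm q a b i l) =
      -(qPoch a q (L + 1) * qPoch b q (L + 1) * qPoch (q ^ i)⁻¹ q L *
        (qPoch (a * q / b) q i * b ^ i) /
        ((1 - a) * qPoch q q L * qPoch (a * q / b) q L * qPoch (a * q) q (i + L + 1)) *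
        ((-1) ^ L * (q ^ (L.choose 2))⁻¹ * (q ^ i / b) ^ L)) := by
  have ha : 1 - a ≠ 0 := by linarith
  have haq0 : 0 ≤ a * q := by positivity
  have haq1 : a * q < 1 := by nlinarith
  have hi := (pow_pos hq0 i).ne'
  set D := a * q / b with hDdef
  have hbD : b * D = a * q := by rw [hDdef]; field_simp
  clear_value D
  induction L with
  | zero =>
    have h1 := (qPoch_pos hq0 hq1 haq0 haq1 i).ne'
    have h2 := (one_sub_mul_pow_pos hq0 hq1 haq0 haq1 i).ne'
    simp only [vwpTerm, Finset.sum_range_one, qPoch_zero, zero_add, add_zero, mul_zero,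
      pow_zero, mul_one, Nat.choose_zero_succ, inv_one, one_mul, qPoch_succ, ← hDdef]
    generalize hw : 1 - a * q * q ^ i = w at *
    rw [div_self ha, pow_succ]
    field_simp
    linear_combination qPoch D q i * hw - q ^ i * qPoch D q i * hbD
  | succ L ih =>
    have hL' := (pow_pos hq0 L).ne'
    have h1 := (qPoch_pos hq0 hq1 haq0 haq1 (i + L + 1)).ne'
    have h2 := (one_sub_mul_pow_pos hq0 hq1 haq0 haq1 (i + L + 1)).ne'
    have h3 := (qPoch_self_pos hq0 hq1 L).ne'
    have h4 := (one_sub_mul_pow_pos hq0 hq1 hq0.le hq1 L).ne'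
    have h5 : qPoch D q L ≠ 0 := Finset.prod_ne_zero_iff.2 fun l hl =>
      hD l (by have := Finset.mem_range.1 hl; omega)
    have h6 := hD L (by omega)
    have hc := (pow_pos hq0 (L.choose 2)).ne'
    have e1 : (q ^ (i + 1))⁻¹ * q = (q ^ i)⁻¹ := by field_simp; ring
    have e2 : (q ^ (i + 1) / b) ^ (L + 1) = (q ^ i / b) ^ L * q ^ L * (q ^ i * q / b) := by
      rw [pow_succ q i, mul_div_right_comm, mul_pow, pow_succ (q ^ i / b), pow_succ q L]
      ring
    rw [Finset.sum_range_succ, ih (by omega)]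
    simp only [vwpTerm, ← hDdef]
    rw [show i + 1 + (L + 1) = i + L + 1 + 1 by ring, show i + (L + 1) = i + L + 1 by ring, e2,
      qPoch_succ_left (q ^ (i + 1))⁻¹, e1, qPoch_succ (q ^ i)⁻¹, qPoch_succ a q (L + 1),
      qPoch_succ b q (L + 1), qPoch_succ q q L, qPoch_succ D q L, qPoch_succ D q i,
      qPoch_succ (a * q) q (i + L + 1), choose_two_succ, pow_add q L, pow_succ (q ^ i / b) L,
      pow_succ (-1 : ℝ) L, pow_succ b i]
    have hw : b * (1 - D * q ^ i) = b - a * q * q ^ i := by linear_combination -q ^ i * hbD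
    have h7 : b - a * q * q ^ L ≠ 0 := by
      have : b - a * q * q ^ L = b * (1 - D * q ^ L) := by linear_combination q ^ L * hbD
      rw [this]; exact mul_ne_zero hb h6
    have hw' : 1 - D * q ^ L = (b - a * q * q ^ L) / b := by
      rw [eq_div_iff hb]; linear_combination -q ^ L * hbD
    have hw'' : 1 - D * q ^ i = (b - a * q * q ^ i) / b := by
      rw [eq_div_iff hb]; linear_combination -q ^ i * hbD
    rw [hw', hw'']
    have e3 : q ^ (2 * (L + 1)) = (q ^ L) ^ 2 * q ^ 2 := by ring
    have e4 : q ^ (i + L + 1) = q ^ i * q ^ L * q := by ring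
    have e5 : q ^ (i + 1) = q ^ i * q := by ring
    have e6 : q ^ (L + 1) = q ^ L * q := by ring
    rw [e4] at h2
    rw [e3, e4, e5, e6]
    generalize qPoch (a * q) q (i + L + 1) = M at *
    generalize qPoch a q (L + 1) = aL at *
    generalize qPoch b q (L + 1) = bL at *
    generalize qPoch D q L = DL at *
    generalize qPoch D q i = Di at *
    generalize qPoch q q L = qL at *
    generalize qPoch (q ^ i)⁻¹ q L = X at *
    generalize (q ^ i / b) ^ L = t at *
    generalize q ^ (L.choose 2) = c at *
    generalize q ^ L = u at *
    generalize q ^ i = w at *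
    generalize h8 : 1 - a * q * (w * u * q) = p at *
    generalize h9 : 1 - q * u = p' at *
    generalize h10 : b - a * q * u = p'' at *
    field_simp
    subst p p' p''
    ring

/-- The closed form of the partial sum contains (q^(-i);q)_L, which vanishes at L = i + 1; so the
sum does not depend on i and equals its value 1 at i = 0. -/
theorem sum_vwpTerm {q a b : ℝ} (hq0 : 0 < q) (hq1 : q < 1) (ha0 : 0 < a) (ha1 : a < 1)
    (hb : b ≠ 0) (i : ℕ) (hD : ∀ l < i, 1 - a * q / b * q ^ l ≠ 0) :
    ∑ l ∈ Finset.range (i + 1), vwpTerm q a b i l = 1 := by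
  induction i with
  | zero =>
    have : 1 - a ≠ 0 := by linarith
    simp [vwpTerm, qPoch_zero, div_self this]
  | succ i ih =>
    have h := sum_range_vwpTerm_sub hq0 hq1 ha0 ha1 hb i hD (i + 1) le_rfl
    rw [qPoch_inv_pow_eq_zero hq0 (Nat.lt_succ_self i), Finset.sum_sub_distrib,
      Finset.sum_range_succ (vwpTerm q a b i), ih fun l hl => hD l (by omega)] at h
    have h0 : vwpTerm q a b i (i + 1) = 0 := by
      rw [vwpTerm, qPoch_inv_pow_eq_zero hq0 (Nat.lt_succ_self i)]; ring
    rw [h0] at h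
    linear_combination h

/-! ### Connection coefficients of the unnormalised bases -/

theorem pow_mul_self_eq (q : ℝ) (n : ℕ) : q ^ (n * n) = q ^ n * (q ^ n.choose 2) ^ 2 := by
  rw [← pow_mul, ← pow_add]
  congr 1
  rw [Nat.choose_two_right, Nat.div_mul_cancel (Nat.even_mul_pred_self n).two_dvd]
  cases n <;> simp; ring

theorem pow_choose_two_add (q : ℝ) (m n : ℕ) :
    q ^ ((m + n).choose 2) = q ^ (m.choose 2) * q ^ (n.choose 2) * q ^ (m * n) := by
  rw [← pow_add, ← pow_add]
  congr 1
  induction n with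
  | zero => simp
  | succ n ih => rw [← add_assoc, choose_two_succ, choose_two_succ, ih]; ring

/-- The `n`-dependent factor of the connection coefficients between `polyPsi` and `polyXi`. -/
noncomputable def connFactor (q A B C : ℝ) (K n : ℕ) : ℝ :=
  (-1) ^ n * ((1 - A * B / q * q ^ (2 * n)) / (1 - A * B / q)) *
    (qPoch (A * B / q) q n * qPoch (A * B * C / q * q ^ K) q n * qPoch (q ^ K)⁻¹ q n *
      (q ^ n.choose 2 * q ^ n)) /
    (qPoch q q n * qPoch A q n * qPoch (A * B) q (K + n) * qPoch (q ^ K)⁻¹ q K)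

/-- The restriction of `connFactor * polyPsi` to `y₁ = 0`. -/
noncomputable def boundaryTerm (q A B C : ℝ) (K n k : ℕ) : ℝ :=
  (-1) ^ n * ((1 - A * B / q * q ^ (2 * n)) / (1 - A * B / q)) *
    (qPoch (A * B / q) q n * qPoch (A * B * C / q * q ^ K) q n * qPoch (q ^ k)⁻¹ q n *
      qPoch (q / (C * q ^ K)) q k * (q ^ (k * n) * (q ^ n.choose 2)⁻¹)) /
    (qPoch q q n * qPoch (q / (C * q ^ K)) q n * qPoch (A * B) q (n + k)) *
    ((A * B * C / q * q ^ K) ^ k / (A * B * C / q * q ^ K) ^ n)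

theorem one_sub_div_ne_zero {q C : ℝ} (hq0 : 0 < q) (hq1 : q < 1) (hC0 : 0 < C) (hC1 : C < 1)
    {K l : ℕ} (hl : l < K) : 1 - q / (C * q ^ K) * q ^ l ≠ 0 := by
  have h1 : q ^ K ≤ q ^ (l + 1) := pow_le_pow_of_le_one hq0.le hq1.le hl
  have h2 := pow_pos hq0 K
  have h3 : 1 < q / (C * q ^ K) * q ^ l := by
    rw [div_mul_eq_mul_div, one_lt_div (by positivity)]
    rw [pow_succ'] at h1
    nlinarith
  linarith

theorem qPoch_div_ne_zero {q C : ℝ} (hq0 : 0 < q) (hq1 : q < 1) (hC0 : 0 < C) (hC1 : C < 1)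
    {K l : ℕ} (hl : l ≤ K) : qPoch (q / (C * q ^ K)) q l ≠ 0 :=
  Finset.prod_ne_zero_iff.2 fun _ hi =>
    one_sub_div_ne_zero hq0 hq1 hC0 hC1 (lt_of_lt_of_le (Finset.mem_range.1 hi) hl)

/-- At y₁ = 0 and level K both factors of `polyPsi` are products: the first by `hahn_zero_left`, the
second because it has top degree. Here k = n + x. -/
theorem connFactor_mul_polyPsi {q A B C : ℝ} (hq0 : 0 < q) (hq1 : q < 1) (hA0 : 0 < A)
    (hA1 : A < 1) (hB0 : 0 < B) (hB1 : B < 1) (hC0 : 0 < C) (hC1 : C < 1) (n x k' : ℕ) :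
    connFactor q A B C (n + x + k') n * polyPsi q A B C n (x + k') 0 (n + x) k' =
      boundaryTerm q A B C (n + x + k') n (n + x) := by
  have hAB0 : 0 < A * B := by positivity
  have hAB1 : A * B < 1 := by nlinarith
  have hA'0 : 0 < A * B * q ^ (2 * n) := by positivity
  have hA'1 : A * B * q ^ (2 * n) < 1 := by
    have := one_sub_mul_pow_pos hq0 hq1 hAB0.le hAB1 (2 * n)
    linarith
  have hn := (pow_pos hq0 n).ne'
  have hprod : ∏ i ∈ Finset.range x,
      (A * B * q ^ (2 * n) * C / q * q ^ (x + k') - A * B * q ^ (2 * n) * q ^ i) =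
      (A * B * C / q * q ^ (n + x + k')) ^ x * q ^ (n * x) *
        qPoch (q / (C * q ^ (n + x + k')) * q ^ n) q x := by
    have : (A * B * C / q * q ^ (n + x + k')) ^ x * q ^ (n * x) =
        ∏ _i ∈ Finset.range x, (A * B * C / q * q ^ (n + x + k') * q ^ n) := by
      rw [Finset.prod_const, Finset.card_range, mul_pow _ (q ^ n), pow_mul]
    rw [this, qPoch, ← Finset.prod_mul_distrib]
    refine Finset.prod_congr rfl fun _ _ => ?_
    rw [two_mul, add_assoc n, pow_add q n, pow_add q n (x + k')]
    have := (pow_pos hq0 (x + k')).ne'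
    field_simp
  have e1 : qPoch (A * B) q (n + x + k' + n) =
      qPoch (A * B) q (2 * n) * qPoch (A * B * q ^ (2 * n)) q (x + k') := by
    rw [← qPoch_add]; congr 1; ring
  have e2 : qPoch (A * B) q (n + (n + x)) =
      qPoch (A * B) q (2 * n) * qPoch (A * B * q ^ (2 * n)) q x := by
    rw [← qPoch_add]; congr 1; ring
  have e3 : qPoch (q ^ (n + x + k'))⁻¹ q (n + x + k') =
      qPoch (q ^ (n + x + k'))⁻¹ q n * qPoch (q ^ (x + k'))⁻¹ q (x + k') := by
    rw [add_assoc, qPoch_add]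
    congr 2
    rw [pow_add]; field_simp
  have f1 := (qPoch_pos hq0 hq1 hA0.le hA1 n).ne'
  have f2 := (qPoch_pos hq0 hq1 hAB0.le hAB1 (2 * n)).ne'
  have f3 := (qPoch_pos hq0 hq1 hA'0.le hA'1 x).ne'
  have f4 := (qPoch_pos hq0 hq1 hA'0.le hA'1 (x + k')).ne'
  have f5 := qPoch_inv_pow_ne_zero hq0 hq1 (show n ≤ n + x + k' by omega)
  have f6 := qPoch_inv_pow_ne_zero hq0 hq1 (le_refl (x + k'))
  have f7 := qPoch_div_ne_zero hq0 hq1 hC0 hC1 (show n ≤ n + x + k' by omega)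
  have f8 := (qPoch_self_pos hq0 hq1 n).ne'
  have f9 : 0 < A * B * C / q * q ^ (n + x + k') := by positivity
  have f10 := (pow_pos hq0 (n.choose 2)).ne'
  rw [connFactor, polyPsi, boundaryTerm, hahn_zero_left, hahn_top hq0 hq1 hA'0 hA'1 C
    (show 0 + (n + x) - n + k' = x + k' by omega), show 0 + (n + x) - n = x by omega, hprod,
    e1, e2, e3, qPoch_add (q / (C * q ^ (n + x + k'))) q n x, add_mul n x n, pow_add q (n * n),
    pow_mul_self_eq, pow_add (A * B * C / q * q ^ (n + x + k')) n x,
    mul_comm x n]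
  generalize qPoch (q / (C * q ^ (n + x + k'))) q n = D at *
  generalize qPoch (q / (C * q ^ (n + x + k')) * q ^ n) q x = D' at *
  generalize qPoch (q ^ (n + x + k'))⁻¹ q n = P1 at *
  generalize qPoch (q ^ (x + k'))⁻¹ q (x + k') = P2 at *
  generalize qPoch (q ^ (n + x))⁻¹ q n = P3 at *
  generalize qPoch (A * B * C / q * q ^ (n + x + k')) q n = P4 at *
  generalize A * B * C / q * q ^ (n + x + k') = E at *
  generalize qPoch (A * B) q (2 * n) = P5 at *
  generalize qPoch (A * B * q ^ (2 * n)) q x = P6 at *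
  generalize qPoch (A * B * q ^ (2 * n)) q (x + k') = P7 at *
  generalize qPoch (A * B / q) q n = P8 at *
  generalize (1 - A * B / q * q ^ (2 * n)) / (1 - A * B / q) = P9 at *
  field_simp

-- After the shifts n = j + l and k = j + i, the term is very-well-poised with a = A B q^(2j-1) and
-- b = A B C q^(K+j-1).
set_option maxHeartbeats 1000000 in
theorem sum_boundaryTerm_aux {q A B C : ℝ} (hq0 : 0 < q) (hq1 : q < 1) (hA0 : 0 < A)
    (hAq : A < q) (hB0 : 0 < B) (hB1 : B < 1) (hC0 : 0 < C) (hC1 : C < 1) {K j i l : ℕ}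
    (hk : j + i ≤ K) (hl : l ≤ i) :
    boundaryTerm q A B C K (j + l) (j + i) *
        (qPoch (q ^ (j + l))⁻¹ q j * qPoch (A * B / q * q ^ (j + l)) q j) =
      qPoch (A * B * C / q * q ^ K) q j * qPoch (q ^ (j + i))⁻¹ q j *
        vwpTerm q (A * B / q * q ^ (2 * j)) (A * B * C / q * q ^ K * q ^ j) i l := by
  have hAB0 : 0 < A * B := by positivity
  have hABq : A * B / q < 1 := by rw [div_lt_one hq0]; nlinarith
  have ha0 : 0 < A * B / q := by positivity
  have hAB : A * B = A * B / q * q := by field_simp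
  have hE0 : 0 < A * B * C / q * q ^ K := by positivity
  have hD : A * B / q * q ^ (2 * j) * q / (A * B * C / q * q ^ K * q ^ j) =
      q / (C * q ^ K) * q ^ j := by
    rw [two_mul, pow_add]; field_simp
  have f7 := qPoch_div_ne_zero hq0 hq1 hC0 hC1 (show j + l ≤ K by omega)
  have hJ := (pow_pos hq0 j).ne'
  have g1 : qPoch (A * B / q) q (j + l) * qPoch (A * B / q * q ^ (j + l)) q j =
      qPoch (A * B / q) q (2 * j) * qPoch (A * B / q * q ^ (2 * j)) q l := by
    rw [← qPoch_add, ← qPoch_add]; congr 1; ring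
  have g2 : qPoch (A * B) q (j + l + (j + i)) =
      qPoch (A * B) q (2 * j) * qPoch (A * B / q * q ^ (2 * j) * q) q (i + l) := by
    rw [show A * B / q * q ^ (2 * j) * q = A * B * q ^ (2 * j) by field_simp, ← qPoch_add]
    congr 1; ring
  have g3 : (1 - A * B / q) * qPoch (A * B) q (2 * j) =
      qPoch (A * B / q) q (2 * j) * (1 - A * B / q * q ^ (2 * j)) := by
    rw [← qPoch_succ, qPoch_succ_left, ← hAB]
  have g4 : (q ^ (j + i))⁻¹ * q ^ j = (q ^ i)⁻¹ := by rw [pow_add]; field_simp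
  have g5 := qPoch_inv_pow hq0 j l
  have ha'0 : 0 < A * B / q * q ^ (2 * j) := by positivity
  have ha'1 := one_sub_mul_pow_pos hq0 hq1 ha0.le hABq (2 * j)
  have h1 : 1 - A * B / q ≠ 0 := by linarith
  have h2 := (qPoch_pos hq0 hq1 ha0.le hABq (2 * j)).ne'
  have h3 := (qPoch_pos hq0 hq1 hAB0.le (by nlinarith) (2 * j)).ne'
  have h4 := (qPoch_pos hq0 hq1 (by positivity : 0 ≤ A * B / q * q ^ (2 * j) * q)
    (by nlinarith) (i + l)).ne'
  have h5 := (qPoch_self_pos hq0 hq1 l).ne'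
  have h6 := (qPoch_self_pos hq0 hq1 (j + l)).ne'
  have hcj := (pow_pos hq0 (j.choose 2)).ne'
  have hcl := (pow_pos hq0 (l.choose 2)).ne'
  have hjl := (pow_pos hq0 (j * l)).ne'
  have hji := (pow_pos hq0 (j * i)).ne'
  rw [mul_add, mul_one, pow_add q (j * l)] at g5
  have g6 : qPoch (q ^ (j + l))⁻¹ q j =
      (-1) ^ j * qPoch q q (j + l) / (qPoch q q l * (q ^ (j * l) * q ^ j * q ^ j.choose 2)) := by
    rw [eq_div_iff (by positivity)]; linear_combination g5
  have g7 : q ^ (2 * (j + l)) = q ^ (2 * j) * q ^ (2 * l) := by ring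
  have g8 : q ^ ((j + i) * (j + l)) = q ^ j * (q ^ j.choose 2) ^ 2 * q ^ (j * l) *
      q ^ (j * i) * q ^ (i * l) := by
    rw [← pow_mul_self_eq]; ring
  have g9 : (q ^ i / (A * B * C / q * q ^ K * q ^ j)) ^ l =
      q ^ (i * l) / ((A * B * C / q * q ^ K) ^ l * q ^ (j * l)) := by
    rw [div_pow, mul_pow (A * B * C / q * q ^ K), ← pow_mul, ← pow_mul]
  have g10 : (A * B * C / q * q ^ K * q ^ j) ^ i =
      (A * B * C / q * q ^ K) ^ i * q ^ (j * i) := by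
    rw [mul_pow (A * B * C / q * q ^ K), ← pow_mul]
  have g11 : ((-1 : ℝ) ^ j) * (-1) ^ j = 1 := by rw [← mul_pow]; simp
  have g12 : qPoch (A * B / q) q (j + l) = qPoch (A * B / q) q (2 * j) *
      qPoch (A * B / q * q ^ (2 * j)) q l / qPoch (A * B / q * q ^ (j + l)) q j := by
    rw [← g1, mul_div_cancel_right₀]
    exact (qPoch_pos hq0 hq1 (by positivity) (by
      have := one_sub_mul_pow_pos hq0 hq1 ha0.le hABq (j + l); linarith) j).ne'
  have h7 : qPoch (A * B / q * q ^ (j + l)) q j ≠ 0 :=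
    (qPoch_pos hq0 hq1 (by positivity) (by
      have := one_sub_mul_pow_pos hq0 hq1 ha0.le hABq (j + l); linarith) j).ne'
  have g13 : qPoch (A * B) q (2 * j) = qPoch (A * B / q) q (2 * j) *
      (1 - A * B / q * q ^ (2 * j)) / (1 - A * B / q) := by
    rw [← g3, mul_div_cancel_left₀ _ h1]
  rw [qPoch_add] at f7
  obtain ⟨f8, f9⟩ := mul_ne_zero_iff.1 f7
  rw [boundaryTerm, vwpTerm, hD, g2, g6, g7, g8, g9, g10, g12, g13, pow_choose_two_add,
    qPoch_add (q / (C * q ^ K)) q j l, qPoch_add (q / (C * q ^ K)) q j i,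
    qPoch_add (A * B * C / q * q ^ K) q j l, qPoch_add (q ^ (j + i))⁻¹ q j l, g4,
    pow_add (-1 : ℝ) j l, pow_add (A * B * C / q * q ^ K) j i,
    pow_add (A * B * C / q * q ^ K) j l, ← mul_assoc (A * B / q)]
  clear g1 g2 g3 g4 g5 g6 g7 g8 g9 g10 g12 g13 f7 hD hAB
  replace ha'1 := ha'1.ne'
  generalize qPoch (A * B / q * q ^ (j + l)) q j = X1 at *
  generalize qPoch (A * B / q * q ^ (2 * j) * q) q (i + l) = X2 at *
  generalize qPoch (A * B / q * q ^ (2 * j)) q l = X3 at *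
  generalize qPoch (A * B / q) q (2 * j) = X4 at *
  generalize qPoch (q / (C * q ^ K)) q j = X5 at *
  generalize qPoch (q / (C * q ^ K) * q ^ j) q l = X6 at *
  generalize qPoch (q / (C * q ^ K) * q ^ j) q i = X7 at *
  generalize qPoch (A * B * C / q * q ^ K * q ^ j) q l = X8 at *
  generalize qPoch (A * B * C / q * q ^ K) q j = X9 at *
  generalize A * B * C / q * q ^ K = E at *
  generalize qPoch (q ^ (j + i))⁻¹ q j = X10 at *
  generalize qPoch (q ^ i)⁻¹ q l = X11 at *
  generalize 1 - A * B / q * q ^ (2 * j) = X12 at *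
  generalize 1 - A * B / q * q ^ (2 * j) * q ^ (2 * l) = X13 at *
  generalize 1 - A * B / q = X14 at *
  generalize qPoch q q (j + l) = X15 at *
  generalize qPoch q q l = X16 at *
  generalize (-1 : ℝ) ^ j = σ at *
  field_simp
  linear_combination X13 * X3 * X9 * X8 * X10 * X11 * X7 * g11

/-- Transforms the functions of n in which `racah` is expanded into the functions (q^(-k);q)_j of k
in which the q-Hahn polynomial is expanded. Terms with n < j vanish, and the others add up by
`sum_vwpTerm`. -/
theorem sum_boundaryTerm {q A B C : ℝ} (hq0 : 0 < q) (hq1 : q < 1) (hA0 : 0 < A)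
    (hAq : A < q) (hB0 : 0 < B) (hB1 : B < 1) (hC0 : 0 < C) (hC1 : C < 1) {K k : ℕ}
    (hk : k ≤ K) (j : ℕ) :
    ∑ n ∈ Finset.range (k + 1), boundaryTerm q A B C K n k *
        (qPoch (q ^ n)⁻¹ q j * qPoch (A * B / q * q ^ n) q j) =
      qPoch (A * B * C / q * q ^ K) q j * qPoch (q ^ k)⁻¹ q j := by
  rcases Nat.lt_or_ge k j with hj | hj
  · rw [qPoch_inv_pow_eq_zero hq0 hj, mul_zero]
    refine Finset.sum_eq_zero fun n hn => ?_
    have := Finset.mem_range.1 hn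
    rw [qPoch_inv_pow_eq_zero hq0 (by omega : n < j)]; ring
  obtain ⟨i, rfl⟩ := Nat.exists_eq_add_of_le hj
  have hABq : A * B / q < 1 := by rw [div_lt_one hq0]; nlinarith
  have ha0 : 0 < A * B / q := by positivity
  have ha'1 := one_sub_mul_pow_pos hq0 hq1 ha0.le hABq (2 * j)
  have hD : A * B / q * q ^ (2 * j) * q / (A * B * C / q * q ^ K * q ^ j) =
      q / (C * q ^ K) * q ^ j := by
    have := pow_pos hq0 j
    rw [two_mul, pow_add]; field_simp
  rw [add_assoc, Finset.sum_range_add, Finset.sum_eq_zero, zero_add,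
    Finset.sum_congr rfl fun l hl => sum_boundaryTerm_aux hq0 hq1 hA0 hAq hB0 hB1 hC0 hC1 hk
      (Nat.lt_succ_iff.1 (Finset.mem_range.1 hl)), ← Finset.mul_sum,
    sum_vwpTerm hq0 hq1 (by positivity) (by linarith) (by positivity) i, mul_one]
  · intro l hl
    rw [hD, mul_assoc, ← pow_add]
    exact one_sub_div_ne_zero hq0 hq1 hC0 hC1 (by omega)
  · intro n hn
    rw [qPoch_inv_pow_eq_zero hq0 (Finset.mem_range.1 hn)]; ring

/-- The `q`-Racah polynomial, up to a power of `q`. -/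
noncomputable def racah (q A B C : ℝ) (K m n : ℕ) : ℝ :=
  ∑ j ∈ Finset.range (m + 1), hahnCoeff q B C m j * qPoch (q ^ j * (q ^ K)⁻¹) q (m - j) *
    qPoch (A * B * C / q * q ^ K * q ^ j) q (m - j) *
    (qPoch (q ^ n)⁻¹ q j * qPoch (A * B / q * q ^ n) q j)

/-- The connection coefficients between `polyPsi` and `polyXi`. -/
noncomputable def polyConn (q A B C : ℝ) (m m' n : ℕ) : ℝ :=
  qPoch A q m' * qPoch (q ^ m')⁻¹ q m' / qPoch (A * B * C / q * q ^ (m + m')) q m *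
    connFactor q A B C (m + m') n * racah q A B C (m + m') m n

/-- At y₁ = 0 the second factor of `polyXi` is constant on the level. The first is expanded in j,
and each term is matched by `sum_boundaryTerm`. -/
theorem polyXi_boundary {q A B C : ℝ} (hq0 : 0 < q) (hq1 : q < 1) (hA0 : 0 < A)
    (hAq : A < q) (hB0 : 0 < B) (hB1 : B < 1) (hC0 : 0 < C) (hC1 : C < 1) {m m' k k' : ℕ}
    (h : k + k' = m + m') :
    polyXi q A B C m m' 0 k k' = ∑ n ∈ Finset.range (m + m' + 1),
      polyConn q A B C m m' n * polyPsi q A B C n (m + m' - n) 0 k k' := by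
  have hABq : A * B < q := by nlinarith
  have hE0 : 0 < A * B * C / q * q ^ (m + m') := by positivity
  have hE1 : A * B * C / q * q ^ (m + m') < 1 := by
    have h1 : A * B * C / q < 1 := by
      rw [div_lt_one hq0]; nlinarith [mul_pos hA0 hB0]
    have := one_sub_mul_pow_pos hq0 hq1 (by positivity) h1 (m + m')
    linarith
  have hsum : ∀ n ∈ Finset.range (k + 1),
      polyConn q A B C m m' n * polyPsi q A B C n (m + m' - n) 0 k k' =
      qPoch A q m' * qPoch (q ^ m')⁻¹ q m' / qPoch (A * B * C / q * q ^ (m + m')) q m *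
        (boundaryTerm q A B C (m + m') n k * racah q A B C (m + m') m n) := by
    intro n hn
    obtain ⟨x, rfl⟩ := Nat.exists_eq_add_of_le (Nat.lt_succ_iff.1 (Finset.mem_range.1 hn))
    have := connFactor_mul_polyPsi hq0 hq1 hA0 (hAq.trans hq1) hB0 hB1 hC0 hC1 n x k'
    rw [polyConn, ← h, show n + x + k' - n = x + k' by omega]
    linear_combination qPoch A q m' * qPoch (q ^ m')⁻¹ q m' /
      qPoch (A * B * C / q * q ^ (n + x + k')) q m * racah q A B C (n + x + k') m n * this
  have hzero : ∀ n ∈ Finset.range (m + m' + 1), n ∉ Finset.range (k + 1) →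
      polyConn q A B C m m' n * polyPsi q A B C n (m + m' - n) 0 k k' = 0 := by
    intro n _ hn
    rw [polyPsi, hahn_eq_zero hq0 A B (by simp at hn; omega : 0 + k < n)]; ring
  rw [← Finset.sum_subset (Finset.range_mono (by omega)) hzero, Finset.sum_congr rfl hsum,
    ← Finset.mul_sum]
  simp only [racah, Finset.mul_sum]
  rw [polyXi, show k + k' - m = m' by omega, hahn_zero_left, hahn, h]
  rw [Finset.sum_comm]
  simp only [mul_zero, pow_zero, inv_one, one_mul, Finset.sum_mul]
  refine Finset.sum_congr rfl fun j hj => ?_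
  have hS := sum_boundaryTerm hq0 hq1 hA0 hAq hB0 hB1 hC0 hC1 (by omega : k ≤ m + m') j
  have hj := Nat.lt_succ_iff.1 (Finset.mem_range.1 hj)
  have hEm := (qPoch_pos hq0 hq1 hE0.le hE1 m).ne'
  have hEj := qPoch_add (A * B * C / q * q ^ (m + m')) q j (m - j)
  rw [show j + (m - j) = m by omega] at hEj
  -- With E = A B C q^(m+m'-1), (E;q)_m = (E;q)_j (E q^j;q)_(m-j): the denominator in `polyConn`
  -- cancels exactly what the sum over n produces.
  calc _ = qPoch A q m' * qPoch (q ^ m')⁻¹ q m' / qPoch (A * B * C / q * q ^ (m + m')) q m *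
        (hahnCoeff q B C m j * qPoch (q ^ j * (q ^ (m + m'))⁻¹) q (m - j)) *
        qPoch (A * B * C / q * q ^ (m + m') * q ^ j) q (m - j) *
        (qPoch (A * B * C / q * q ^ (m + m')) q j * qPoch (q ^ k)⁻¹ q j) := by
        rw [eq_comm, div_mul_eq_mul_div, div_mul_eq_mul_div, div_mul_eq_mul_div, div_eq_iff hEm,
          hEj]
        ring
    _ = _ := by
        rw [← hS, Finset.mul_sum]
        exact Finset.sum_congr rfl fun n _ => by ring

/-- Induction on the excess d of the level over the degree: at d = 0 both sides lie in the kernel of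
`lower₃` and agree at y₁ = 0; `raise₃` has the same nonzero eigenvalue on all members involved and
carries the identity upwards. -/
theorem polyXi_eq_sum {q A B C : ℝ} (hq0 : 0 < q) (hq1 : q < 1) (hA0 : 0 < A)
    (hAq : A < q) (hB0 : 0 < B) (hB1 : B < 1) (hC0 : 0 < C) (hC1 : C < 1) (m m' d : ℕ) :
    ∀ y₁ y₂ y₃ : ℕ, y₁ + y₂ + y₃ = m + m' + d →
      polyXi q A B C m m' y₁ y₂ y₃ = ∑ n ∈ Finset.range (m + m' + 1),
        polyConn q A B C m m' n * polyPsi q A B C n (m + m' - n) y₁ y₂ y₃ := by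
  have hA1 := hAq.trans hq1
  induction d with
  | zero =>
    intro y₁ y₂ y₃ hy
    rw [← sub_eq_zero]
    refine eq_zero_of_lower₃ hq0 hq1 hA0 hA1 B C (m + m') (fun y₁ y₂ y₃ =>
      polyXi q A B C m m' y₁ y₂ y₃ - ∑ n ∈ Finset.range (m + m' + 1),
        polyConn q A B C m m' n * polyPsi q A B C n (m + m' - n) y₁ y₂ y₃) ?_ ?_ y₁ y₂ y₃ hy
    · intro y₁ y₂ y₃ hy
      have h1 := lower₃_polyXi (C := C) hq0 hq1 hA0 hA1 hB0 hB1 hy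
      have h2 : ∑ n ∈ Finset.range (m + m' + 1), polyConn q A B C m m' n *
          lower₃ q A B C (polyPsi q A B C n (m + m' - n)) y₁ y₂ y₃ = 0 := by
        refine Finset.sum_eq_zero fun n hn => ?_
        have := Finset.mem_range.1 hn
        rw [lower₃_polyPsi hq0 hq1 hA0 hA1 hB0 hB1 (by omega), mul_zero]
      simp only [lower₃] at h1 h2 ⊢
      simp only [mul_add, Finset.sum_add_distrib] at h2
      have e : ∀ c : ℝ, ∀ f : ℕ → ℝ, ∑ n ∈ Finset.range (m + m' + 1),
          polyConn q A B C m m' n * (c * f n) =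
          c * ∑ n ∈ Finset.range (m + m' + 1), (polyConn q A B C m m' n * f n) :=
        fun c f => by rw [Finset.mul_sum]; exact Finset.sum_congr rfl fun n _ => by ring
      rw [e, e, e] at h2
      linear_combination h1 - h2
    · intro y₂ y₃ hy
      rw [sub_eq_zero]
      exact polyXi_boundary hq0 hq1 hA0 hAq hB0 hB1 hC0 hC1 hy
  | succ d ih =>
    intro y₁ y₂ y₃ hy
    have hne : q ^ (m + m') - q ^ (y₁ + y₂ + y₃) ≠ 0 := by
      have := pow_lt_pow_right_of_lt_one₀ hq0 hq1 (show m + m' < y₁ + y₂ + y₃ by omega)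
      linarith
    apply mul_left_cancel₀ hne
    rw [← raise₃_polyXi hq0, Finset.mul_sum]
    have h2 : ∀ n ∈ Finset.range (m + m' + 1), (q ^ (m + m') - q ^ (y₁ + y₂ + y₃)) *
        (polyConn q A B C m m' n * polyPsi q A B C n (m + m' - n) y₁ y₂ y₃) =
        polyConn q A B C m m' n * raise₃ q (polyPsi q A B C n (m + m' - n)) y₁ y₂ y₃ := by
      intro n hn
      have := Finset.mem_range.1 hn
      rw [raise₃_polyPsi hq0, show n + (m + m' - n) = m + m' by omega]
      ring
    rw [Finset.sum_congr rfl h2]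
    simp only [raise₃, mul_add, Finset.sum_add_distrib]
    have e : ∀ c : ℝ, ∀ f : ℕ → ℝ, ∑ n ∈ Finset.range (m + m' + 1),
        polyConn q A B C m m' n * (c * f n) =
        c * ∑ n ∈ Finset.range (m + m' + 1), (polyConn q A B C m m' n * f n) :=
      fun c f => by rw [Finset.mul_sum]; exact Finset.sum_congr rfl fun n _ => by ring
    rw [e, e, e]
    congr 1
    · congr 1
      · exact one_sub_pow_mul_congr q fun h => ih _ _ _ (by omega)
      · rw [mul_assoc, mul_assoc, one_sub_pow_mul_congr q fun h => ih _ _ _ (by omega)]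
    · rw [mul_assoc, mul_assoc, one_sub_pow_mul_congr q fun h => ih _ _ _ (by omega)]

/-! ### From hypergeometric series and real powers to polynomials in A, B -/

theorem basicHyp_three_two {a₁ a₂ a₃ b₁ b₂ q z : ℝ} {n : ℕ} (h : ∀ k, n < k → qPoch a₁ q k = 0) :
    basicHyp [a₁, a₂, a₃] [b₁, b₂] q z = ∑ k ∈ Finset.range (n + 1),
      qPoch a₁ q k * qPoch a₂ q k * qPoch a₃ q k /
        (qPoch q q k * (qPoch b₁ q k * qPoch b₂ q k)) * z ^ k := by
  unfold basicHyp
  rw [tsum_eq_sum (s := Finset.range (n + 1))]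
  · refine Finset.sum_congr rfl fun k _ => ?_
    simp [mul_assoc]
  · intro k hk
    simp [h k (by simpa using hk)]

theorem basicHyp_four_three {a₁ a₂ a₃ a₄ b₁ b₂ b₃ q z : ℝ} {n : ℕ}
    (h : ∀ k, n < k → qPoch a₁ q k = 0) :
    basicHyp [a₁, a₂, a₃, a₄] [b₁, b₂, b₃] q z = ∑ k ∈ Finset.range (n + 1),
      qPoch a₁ q k * qPoch a₂ q k * qPoch a₃ q k * qPoch a₄ q k /
        (qPoch q q k * (qPoch b₁ q k * qPoch b₂ q k * qPoch b₃ q k)) * z ^ k := by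
  unfold basicHyp
  rw [tsum_eq_sum (s := Finset.range (n + 1))]
  · refine Finset.sum_congr rfl fun k _ => ?_
    simp [mul_assoc]
  · intro k hk
    simp [h k (by simpa using hk)]

theorem rpow_neg_natCast_eq {q : ℝ} (hq0 : 0 < q) (n : ℕ) : q ^ (-(n : ℝ)) = (q ^ n)⁻¹ := by
  rw [Real.rpow_neg hq0.le, Real.rpow_natCast]

theorem rpow_natCast_mul_eq {q : ℝ} (hq0 : 0 < q) (n : ℕ) (s : ℝ) :
    q ^ ((n : ℝ) * s) = (q ^ s) ^ n := by
  rw [mul_comm, Real.rpow_mul hq0.le, Real.rpow_natCast]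

/-- The bound by q, not only by 1, is what α > 0 gives; it makes AB/q < 1, hence 1 - q^(α+β+1) > 0.
-/
theorem rpow_add_one_pos_lt {q : ℝ} (hq0 : 0 < q) (hq1 : q < 1) {α : ℝ} (hα : 0 < α) :
    0 < q ^ (α + 1) ∧ q ^ (α + 1) < q ∧ q ^ (α + 1) < 1 := by
  have : q ^ (α + 1) < q := by
    conv_rhs => rw [← Real.rpow_one q]
    exact Real.rpow_lt_rpow_of_exponent_gt hq0 hq1 (by linarith)
  exact ⟨Real.rpow_pos_of_pos hq0 _, this, this.trans hq1⟩

theorem rpow_add_add_one {q : ℝ} (hq0 : 0 < q) (n : ℕ) (α β : ℝ) :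
    q ^ ((n : ℝ) + α + β + 1) = q ^ (α + 1) * q ^ (β + 1) / q * q ^ n := by
  rw [← Real.rpow_natCast q n, ← Real.rpow_add hq0]
  conv_rhs => rw [div_mul_eq_mul_div, ← Real.rpow_add hq0, ← Real.rpow_sub_one hq0.ne']
  congr 1; ring

theorem rpow_add_one {q : ℝ} (hq0 : 0 < q) (α β : ℝ) :
    q ^ (α + β + 1) = q ^ (α + 1) * q ^ (β + 1) / q := by
  have := rpow_add_add_one hq0 0 α β
  simpa using this

theorem rpow_add_two {q : ℝ} (hq0 : 0 < q) (α β : ℝ) :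
    q ^ (α + β + 2) = q ^ (α + 1) * q ^ (β + 1) := by
  rw [← Real.rpow_add hq0]; congr 1; ring

/-- The prefactors clear the denominators of the ₃φ₂ term by term; n ≤ N keeps (q^(-N);q)_j nonzero,
so that no division by zero intervenes. -/
theorem qHahn_eq {q : ℝ} (hq0 : 0 < q) (hq1 : q < 1) {n x N : ℕ} {α : ℝ} (hα : 0 < α) (β : ℝ)
    (hx : x ≤ N) (hn : n ≤ N) :
    qHahn q n x α β N = hahn q (q ^ (α + 1)) (q ^ (β + 1)) n x (N - x) := by
  obtain ⟨hA0, -, hA1⟩ := rpow_add_one_pos_lt hq0 hq1 hα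
  rw [qHahn, basicHyp_three_two (n := n) fun k hk => by
    rw [rpow_neg_natCast_eq hq0, qPoch_inv_pow_eq_zero hq0 hk], hahn, Finset.mul_sum]
  refine Finset.sum_congr rfl fun j hj => ?_
  obtain ⟨i, rfl⟩ := Nat.exists_eq_add_of_le (Nat.lt_succ_iff.1 (Finset.mem_range.1 hj))
  have h1 := (qPoch_pos hq0 hq1 hA0.le hA1 j).ne'
  have h2 := (qPoch_self_pos hq0 hq1 j).ne'
  have h3 := qPoch_inv_pow_ne_zero hq0 hq1 (show j ≤ N by omega)
  rw [rpow_neg_natCast_eq hq0, rpow_neg_natCast_eq hq0, rpow_neg_natCast_eq hq0,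
    rpow_add_add_one hq0, hahnCoeff, qPoch_add _ q j i, qPoch_add (q ^ N)⁻¹ q j i,
    show x + (N - x) = N by omega, Nat.add_sub_cancel_left, mul_comm (q ^ j)]
  generalize qPoch (q ^ N)⁻¹ q j = X at *
  field_simp

theorem qHahnWeight_eq {q : ℝ} (hq0 : 0 < q) (x N : ℕ) (α β : ℝ) :
    qHahnWeight q x α β N = wt q (q ^ (α + 1)) (q ^ (β + 1)) x (N - x) := by
  rw [qHahnWeight, wt, rpow_natCast_mul_eq hq0]

/-- The squared norm of the `q`-Hahn polynomial. -/
noncomputable def hahnNorm (q A B : ℝ) (n N : ℕ) : ℝ :=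
  qPoch (A * B) q (n + N) / qPoch q q (N - n) * (q ^ (N * n))⁻¹ ^ 2 * normFactor q A B n

theorem qHahnNorm_eq {q : ℝ} (hq0 : 0 < q) (hq1 : q < 1) {α β : ℝ} (hα : 0 < α) (hβ : 0 < β)
    (n N : ℕ) :
    qHahnNorm q n α β N = hahnNorm q (q ^ (α + 1)) (q ^ (β + 1)) n N := by
  obtain ⟨hA0, hAq, hA1⟩ := rpow_add_one_pos_lt hq0 hq1 hα
  obtain ⟨hB0, -, hB1⟩ := rpow_add_one_pos_lt hq0 hq1 hβ
  have e1 : q ^ (2 * (n.choose 2 : ℝ) - 2 * (N : ℝ) * (n : ℝ)) =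
      (q ^ n.choose 2) ^ 2 * (q ^ (N * n))⁻¹ ^ 2 := by
    have h1 : q ^ (2 * (n.choose 2 : ℝ)) = (q ^ n.choose 2) ^ 2 := by
      rw [← pow_mul, ← Real.rpow_natCast q (n.choose 2 * 2)]
      congr 1; push_cast; ring
    have h2 : q ^ (2 * (N : ℝ) * (n : ℝ)) = (q ^ (N * n)) ^ 2 := by
      rw [← pow_mul, ← Real.rpow_natCast q (N * n * 2)]
      congr 1; push_cast; ring
    rw [Real.rpow_sub hq0, h1, h2, div_eq_mul_inv, inv_pow]
  have e2 : q ^ (2 * (n : ℝ) + α + β + 1) = q ^ (α + 1) * q ^ (β + 1) / q * q ^ (2 * n) := by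
    rw [← rpow_add_add_one hq0]; push_cast; rfl
  rw [qHahnNorm, hahnNorm, normFactor, e1, e2, rpow_add_two hq0, rpow_add_one hq0,
    rpow_natCast_mul_eq hq0]
  generalize q ^ (α + 1) = A at *
  generalize q ^ (β + 1) = B at *
  have ha0 : 0 < A * B / q := by positivity
  have ha1 : A * B / q < 1 := by rw [div_lt_one hq0]; nlinarith
  -- Both sides are (AB/q;q)_(2n+1), split after the first factor on the left, and after n and 2n
  -- factors on the right.
  have g1 : (1 - A * B / q) * qPoch (A * B) q (2 * n) =
      qPoch (A * B / q) q n * qPoch (A * B / q * q ^ n) q n * (1 - A * B / q * q ^ (2 * n)) := by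
    rw [← qPoch_add, ← two_mul, ← qPoch_succ, qPoch_succ_left, div_mul_cancel₀ _ hq0.ne']
  have h1 := (qPoch_pos hq0 hq1 ha0.le ha1 n).ne'
  have h2 := (qPoch_pos hq0 hq1 (by positivity : 0 ≤ A * B) (by nlinarith) (2 * n)).ne'
  have h3 := (one_sub_mul_pow_pos hq0 hq1 ha0.le ha1 (2 * n)).ne'
  have g2 : (1 - A * B / q) / (1 - A * B / q * q ^ (2 * n)) / qPoch (A * B / q) q n =
      qPoch (A * B / q * q ^ n) q n / qPoch (A * B) q (2 * n) := by
    rw [div_div, div_eq_div_iff (mul_ne_zero h3 h1) h2]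
    linear_combination g1
  linear_combination qPoch (A * B) q (n + N) / qPoch q q (N - n) *
    ((q ^ n.choose 2) ^ 2 * (q ^ (N * n))⁻¹ ^ 2) *
    (qPoch q q n * qPoch A q n * qPoch B q n) * A ^ n * g2

theorem normFactor_pos {q A B : ℝ} (hq0 : 0 < q) (hq1 : q < 1) (hA0 : 0 < A) (hAq : A < q)
    (hB0 : 0 < B) (hB1 : B < 1) (n : ℕ) : 0 < normFactor q A B n := by
  have ha0 : 0 < A * B / q := by positivity
  have ha1 : A * B / q < 1 := by rw [div_lt_one hq0]; nlinarith
  have h1 := qPoch_pos hq0 hq1 hA0.le (hAq.trans hq1) n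
  have h2 := qPoch_pos hq0 hq1 hB0.le hB1 n
  have h3 := qPoch_self_pos hq0 hq1 n
  have h4 := qPoch_pos hq0 hq1 (by positivity : 0 ≤ A * B) (by nlinarith) (2 * n)
  have h5 := qPoch_pos hq0 hq1 (by positivity : 0 ≤ A * B / q * q ^ n)
    (by have := one_sub_mul_pow_pos hq0 hq1 ha0.le ha1 n; linarith) n
  unfold normFactor
  positivity

theorem hahnNorm_pos {q A B : ℝ} (hq0 : 0 < q) (hq1 : q < 1) (hA0 : 0 < A) (hAq : A < q)
    (hB0 : 0 < B) (hB1 : B < 1) (n N : ℕ) : 0 < hahnNorm q A B n N := by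
  have h1 := normFactor_pos hq0 hq1 hA0 hAq hB0 hB1 n
  have h2 := qPoch_self_pos hq0 hq1 (N - n)
  have h4 := qPoch_pos hq0 hq1 (by positivity : 0 ≤ A * B) (by nlinarith) (n + N)
  unfold hahnNorm
  positivity

theorem wt_pos {q A B : ℝ} (hq0 : 0 < q) (hq1 : q < 1) (hA0 : 0 < A) (hA1 : A < 1)
    (hB0 : 0 < B) (hB1 : B < 1) (x x' : ℕ) : 0 < wt q A B x x' := by
  have h1 := qPoch_pos hq0 hq1 hA0.le hA1 x
  have h2 := qPoch_pos hq0 hq1 hB0.le hB1 x'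
  have h3 := qPoch_self_pos hq0 hq1 x
  have h4 := qPoch_self_pos hq0 hq1 x'
  unfold wt
  positivity

/-! ### Orthonormality of the q-Hahn functions and of Ψ -/

/-- The `q`-Hahn function in terms of `A = q^(α+1)`, `B = q^(β+1)`, `N = x + x'`. -/
noncomputable def hahnFun (q A B : ℝ) (n x x' : ℕ) : ℝ :=
  Real.sqrt (wt q A B x x' / hahnNorm q A B n (x + x')) * hahn q A B n x x'

/-- No condition n ≤ N is needed: beyond it the left side is zero by convention and the right side
by `hahn_eq_zero`. -/
theorem qHahnFun_eq {q : ℝ} (hq0 : 0 < q) (hq1 : q < 1) {α β : ℝ} (hα : 0 < α) (hβ : 0 < β)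
    (n : ℕ) {x x' N : ℕ} (h : x + x' = N) :
    qHahnFun q n x α β N = hahnFun q (q ^ (α + 1)) (q ^ (β + 1)) n x x' := by
  rw [qHahnFun, hahnFun]
  by_cases hn : n ≤ N
  · rw [if_pos ⟨by omega, hn⟩, qHahn_eq hq0 hq1 hα β (by omega) hn, qHahnWeight_eq hq0,
      qHahnNorm_eq hq0 hq1 hα hβ, show N - x = x' by omega, h]
  · rw [if_neg (by tauto), hahn_eq_zero hq0 _ _ (by omega), mul_zero]

theorem hahnFun_eq_zero {q : ℝ} (hq0 : 0 < q) (A B : ℝ) {n x x' : ℕ} (h : x + x' < n) :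
    hahnFun q A B n x x' = 0 := by
  rw [hahnFun, hahn_eq_zero hq0 _ _ h, mul_zero]

theorem sum_hahnFun_mul {q A B : ℝ} (hq0 : 0 < q) (hq1 : q < 1) (hA0 : 0 < A) (hAq : A < q)
    (hB0 : 0 < B) (hB1 : B < 1) (n m N : ℕ) :
    ∑ p ∈ antidiagonal N, hahnFun q A B n p.1 p.2 * hahnFun q A B m p.1 p.2 =
      if n = m ∧ n ≤ N then 1 else 0 := by
  have hA1 := hAq.trans hq1
  have key : ∀ p ∈ antidiagonal N, hahnFun q A B n p.1 p.2 * hahnFun q A B m p.1 p.2 =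
      (Real.sqrt (hahnNorm q A B n N) * Real.sqrt (hahnNorm q A B m N))⁻¹ *
      (wt q A B p.1 p.2 * (hahn q A B n p.1 p.2 * hahn q A B m p.1 p.2)) := by
    intro p hp
    have hw := wt_pos hq0 hq1 hA0 hA1 hB0 hB1 p.1 p.2
    rw [hahnFun, hahnFun, Finset.HasAntidiagonal.mem_antidiagonal.1 hp, Real.sqrt_div hw.le,
      Real.sqrt_div hw.le]
    have := Real.mul_self_sqrt hw.le
    rw [mul_inv, div_eq_mul_inv, div_eq_mul_inv]
    linear_combination (Real.sqrt (hahnNorm q A B n N))⁻¹ * (Real.sqrt (hahnNorm q A B m N))⁻¹ *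
      (hahn q A B n p.1 p.2 * hahn q A B m p.1 p.2) * this
  rw [Finset.sum_congr rfl key, ← Finset.mul_sum]
  by_cases hnm : n = m
  · subst hnm
    by_cases hn : n ≤ N
    · obtain ⟨d, rfl⟩ := Nat.exists_eq_add_of_le hn
      have hN := hahnNorm_pos hq0 hq1 hA0 hAq hB0 hB1 n (n + d)
      rw [if_pos ⟨rfl, hn⟩, sum_hahn_sq hq0 hq1 hA0 hA1 hB0 hB1, Real.mul_self_sqrt hN.le]
      have : qPoch (A * B) q (2 * n + d) / qPoch q q d * (q ^ ((n + d) * n))⁻¹ ^ 2 *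
          normFactor q A B n = hahnNorm q A B n (n + d) := by
        rw [hahnNorm, Nat.add_sub_cancel_left, ← add_assoc, ← two_mul]
      rw [this, inv_mul_cancel₀ hN.ne']
    · rw [if_neg (by tauto), Finset.sum_eq_zero, mul_zero]
      intro p hp
      rw [hahn_eq_zero hq0 A B (by have := Finset.HasAntidiagonal.mem_antidiagonal.1 hp; omega)]
      ring
  · rw [if_neg (by tauto), sum_hahn_mul_hahn_eq_zero hq0 hq1 hA0 hA1 B N n m hnm, mul_zero]

theorem sum_antidiagonalTuple_three (L : ℕ) (f : (Fin 3 → ℕ) → ℝ) :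
    ∑ y ∈ Finset.Nat.antidiagonalTuple 3 L, f y =
      ∑ p ∈ antidiagonal L, ∑ r ∈ antidiagonal p.1, f ![r.1, r.2, p.2] := by
  rw [Finset.sum_sigma']
  refine Finset.sum_bij' (fun y _ => ⟨(y 0 + y 1, y 2), (y 0, y 1)⟩)
    (fun s _ => ![s.2.1, s.2.2, s.1.2]) ?_ ?_ ?_ ?_ ?_
  · intro y hy
    have := Finset.Nat.mem_antidiagonalTuple.1 hy
    rw [Fin.sum_univ_three] at this
    simpa using this
  · rintro ⟨⟨a, b⟩, ⟨c, d⟩⟩ hs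
    simp only [Finset.mem_sigma, Finset.HasAntidiagonal.mem_antidiagonal] at hs
    rw [Finset.Nat.mem_antidiagonalTuple, Fin.sum_univ_three]
    simp; omega
  · intro y _
    ext i; fin_cases i <;> rfl
  · rintro ⟨⟨a, b⟩, ⟨c, d⟩⟩ hs
    simp only [Finset.mem_sigma, Finset.HasAntidiagonal.mem_antidiagonal] at hs
    obtain ⟨h1, rfl⟩ := hs
    simp
  · intro y _
    congr 1
    ext i; fin_cases i <;> rfl

/-- For fixed y₁ + y₂ = s the second factors are constant, so the inner sum gives δ for n₁, m₁ and
the condition n₁ ≤ s. The outer sum, shifted by n₁, is again a one-variable relation. -/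
theorem sum_hahnFun_nested {q A B C : ℝ} (hq0 : 0 < q) (hq1 : q < 1) (hA0 : 0 < A) (hAq : A < q)
    (hB0 : 0 < B) (hB1 : B < 1) (hC0 : 0 < C) (hC1 : C < 1) {n₁ n₂ m₁ m₂ L : ℕ}
    (hL : n₁ + n₂ ≤ L) :
    ∑ p ∈ antidiagonal L, ∑ r ∈ antidiagonal p.1,
      (hahnFun q A B n₁ r.1 r.2 *
        hahnFun q (A * B * q ^ (2 * n₁)) C n₂ (r.1 + r.2 - n₁) p.2) *
      (hahnFun q A B m₁ r.1 r.2 *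
        hahnFun q (A * B * q ^ (2 * m₁)) C m₂ (r.1 + r.2 - m₁) p.2) =
      if n₁ = m₁ ∧ n₂ = m₂ then 1 else 0 := by
  have hA'0 : 0 < A * B * q ^ (2 * n₁) := by positivity
  have hA'q : A * B * q ^ (2 * n₁) < q := by
    have h1 : A * B * q ^ (2 * n₁) ≤ A * B * 1 :=
      mul_le_mul_of_nonneg_left (pow_le_one₀ hq0.le hq1.le) (by positivity)
    nlinarith
  have inner : ∀ p ∈ antidiagonal L, ∑ r ∈ antidiagonal p.1,
      (hahnFun q A B n₁ r.1 r.2 *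
        hahnFun q (A * B * q ^ (2 * n₁)) C n₂ (r.1 + r.2 - n₁) p.2) *
      (hahnFun q A B m₁ r.1 r.2 *
        hahnFun q (A * B * q ^ (2 * m₁)) C m₂ (r.1 + r.2 - m₁) p.2) =
      (if n₁ = m₁ ∧ n₁ ≤ p.1 then 1 else 0) *
        (hahnFun q (A * B * q ^ (2 * n₁)) C n₂ (p.1 - n₁) p.2 *
          hahnFun q (A * B * q ^ (2 * m₁)) C m₂ (p.1 - m₁) p.2) := by
    intro p _
    rw [← sum_hahnFun_mul hq0 hq1 hA0 hAq hB0 hB1 n₁ m₁ p.1, Finset.sum_mul]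
    refine Finset.sum_congr rfl fun r hr => ?_
    rw [Finset.HasAntidiagonal.mem_antidiagonal.1 hr]
    ring
  rw [Finset.sum_congr rfl inner]
  by_cases h : n₁ = m₁
  · subst h
    obtain ⟨M, rfl⟩ := Nat.exists_eq_add_of_le (show n₁ ≤ L by omega)
    have h2 := sum_hahnFun_mul hq0 hq1 hA'0 hA'q hC0 hC1 n₂ m₂ M
    rw [Finset.Nat.sum_antidiagonal_eq_sum_range_succ_mk] at h2 ⊢
    -- The first n₁ values of s contribute nothing; the rest are s = n₁ + d with d ≤ M.
    rw [Nat.succ_eq_add_one, add_assoc, Finset.sum_range_add, Finset.sum_eq_zero, zero_add]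
    · simp only [true_and, le_add_iff_nonneg_right, zero_le, if_true, one_mul,
        Nat.add_sub_cancel_left, Nat.add_sub_add_left]
      rw [h2]
      exact if_congr (by constructor <;> (rintro h; omega)) rfl rfl
    · intro k hk
      have := Finset.mem_range.1 hk
      rw [if_neg (by simp; omega), zero_mul]
  · rw [if_neg (by tauto)]
    exact Finset.sum_eq_zero fun p _ => by rw [if_neg (by tauto), zero_mul]

theorem rpow_param {q : ℝ} (hq0 : 0 < q) (n : ℕ) (a b : ℝ) :
    q ^ (2 * (n : ℝ) + a + b + 1 + 1) = q ^ (a + 1) * q ^ (b + 1) * q ^ (2 * n) := by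
  rw [← Real.rpow_natCast q (2 * n), ← Real.rpow_add hq0, ← Real.rpow_add hq0]
  congr 1; push_cast; ring

theorem Psi_eq {q : ℝ} {α : Fin 3 → ℝ}
    (hq0 : 0 < q) (hq1 : q < 1) (hα : ∀ i, 0 < α i) {n y : Fin 3 → ℕ}
    (h : n 0 + n 1 + n 2 = y 0 + y 1 + y 2) :
    Psi q α n y = hahnFun q (q ^ (α 0 + 1)) (q ^ (α 1 + 1)) (n 0) (y 0) (y 1) *
      hahnFun q (q ^ (α 0 + 1) * q ^ (α 1 + 1) * q ^ (2 * n 0)) (q ^ (α 2 + 1)) (n 1)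
        (y 0 + y 1 - n 0) (y 2) := by
  rw [Psi, if_pos h, qHahnFun_eq hq0 hq1 (hα 0) (hα 1) _ rfl]
  rcases Nat.lt_or_ge (y 0 + y 1) (n 0) with hy | hy
  · rw [hahnFun_eq_zero hq0 _ _ hy, zero_mul, zero_mul]
  · rw [qHahnFun_eq hq0 hq1 (by have := hα 0; have := hα 1; positivity) (hα 2) (x' := y 2) _
      (by omega), rpow_param hq0]

theorem Xi_eq {q : ℝ} {α : Fin 3 → ℝ}
    (hq0 : 0 < q) (hq1 : q < 1) (hα : ∀ i, 0 < α i) {m y : Fin 3 → ℕ}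
    (h : m 0 + m 1 + m 2 = y 0 + y 1 + y 2) :
    Xi q α m y = hahnFun q (q ^ (α 1 + 1)) (q ^ (α 2 + 1)) (m 0) (y 1) (y 2) *
      hahnFun q (q ^ (α 0 + 1)) (q ^ (α 1 + 1) * q ^ (α 2 + 1) * q ^ (2 * m 0)) (m 1)
        (y 0) (y 1 + y 2 - m 0) := by
  rw [Xi, if_pos h, qHahnFun_eq hq0 hq1 (hα 1) (hα 2) _ rfl]
  rcases Nat.lt_or_ge (y 1 + y 2) (m 0) with hy | hy
  · rw [hahnFun_eq_zero hq0 _ _ hy, zero_mul, zero_mul]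
  · rw [qHahnFun_eq hq0 hq1 (hα 0) (by have := hα 1; have := hα 2; positivity)
      (x' := y 1 + y 2 - m 0) _ (by omega), rpow_param hq0]

theorem sum_Psi_mul_Psi {q : ℝ} {α : Fin 3 → ℝ}
    (hq0 : 0 < q) (hq1 : q < 1) (hα : ∀ i, 0 < α i) {n m : Fin 3 → ℕ}
    {L : ℕ} (hn : n 0 + n 1 + n 2 = L) (hm : m 0 + m 1 + m 2 = L) :
    ∑ y ∈ Finset.Nat.antidiagonalTuple 3 L, Psi q α n y * Psi q α m y =
      if n = m then 1 else 0 := by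
  obtain ⟨hA0, hAq, hA1⟩ := rpow_add_one_pos_lt hq0 hq1 (hα 0)
  obtain ⟨hB0, -, hB1⟩ := rpow_add_one_pos_lt hq0 hq1 (hα 1)
  obtain ⟨hC0, -, hC1⟩ := rpow_add_one_pos_lt hq0 hq1 (hα 2)
  have hnm : n = m ↔ n 0 = m 0 ∧ n 1 = m 1 := by
    constructor
    · rintro rfl; exact ⟨rfl, rfl⟩
    · rintro ⟨h0, h1⟩
      ext i; fin_cases i
      · exact h0
      · exact h1
      · change n 2 = m 2; omega
  simp only [hnm]
  rw [← sum_hahnFun_nested hq0 hq1 hA0 hAq hB0 hB1 hC0 hC1 (show n 0 + n 1 ≤ L by omega),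
    sum_antidiagonalTuple_three]
  refine Finset.sum_congr rfl fun p hp => Finset.sum_congr rfl fun r hr => ?_
  have hp := Finset.HasAntidiagonal.mem_antidiagonal.1 hp
  have hr := Finset.HasAntidiagonal.mem_antidiagonal.1 hr
  have hy : ![r.1, r.2, p.2] 0 + ![r.1, r.2, p.2] 1 + ![r.1, r.2, p.2] 2 = L := by
    change r.1 + r.2 + p.2 = L
    omega
  rw [Psi_eq hq0 hq1 hα (hn.trans hy.symm), Psi_eq hq0 hq1 hα (hm.trans hy.symm)]
  rfl

/-! ### Weights and norms of the two bases -/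

/-- The weight of the bases `Ψ` and `Ξ`. -/
noncomputable def wt₃ (q A B C : ℝ) (y₁ y₂ y₃ : ℕ) : ℝ :=
  qPoch A q y₁ * qPoch B q y₂ * qPoch C q y₃ / (qPoch q q y₁ * qPoch q q y₂ * qPoch q q y₃) *
    A ^ y₂ * (A * B) ^ y₃

/-- The part of the squared norms that is common to `polyPsi` and `polyXi`. -/
noncomputable def normCommon (q A B C : ℝ) (K k : ℕ) : ℝ :=
  qPoch (A * B * C) q (2 * K + k) / qPoch q q k * (q ^ ((K + k) * K))⁻¹ ^ 2

noncomputable def normPsi (q A B C : ℝ) (n₁ n₂ : ℕ) : ℝ :=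
  normFactor q A B n₁ * qPoch (A * B) q (2 * n₁) * normFactor q (A * B * q ^ (2 * n₁)) C n₂ /
    qPoch (A * B * C) q (2 * n₁) * (q ^ (n₁ * n₂)) ^ 2

noncomputable def normXi (q A B C : ℝ) (m₁ m₂ : ℕ) : ℝ :=
  A ^ m₁ * normFactor q B C m₁ * qPoch (B * C) q (2 * m₁) *
    normFactor q A (B * C * q ^ (2 * m₁)) m₂ / qPoch (A * B * C) q (2 * m₁) *
    (q ^ (m₁ * m₂)) ^ 2

/-- The y-dependence of the two q-Hahn normalisations collapses to `wt₃`. The q-powers match because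
n₁ (d + y₃) = n₁ (n₂ + n₃). -/
theorem wt_div_hahnNorm_psi {q A B C : ℝ} (hq0 : 0 < q) (hq1 : q < 1) (hA0 : 0 < A) (hAq : A < q)
    (hB0 : 0 < B) (hB1 : B < 1) (hC0 : 0 < C) (hC1 : C < 1) {n₁ n₂ n₃ y₁ y₂ y₃ d : ℕ}
    (hd : y₁ + y₂ = n₁ + d) (hy : d + y₃ = n₂ + n₃) :
    wt q A B y₁ y₂ / hahnNorm q A B n₁ (y₁ + y₂) *
      (wt q (A * B * q ^ (2 * n₁)) C d y₃ / hahnNorm q (A * B * q ^ (2 * n₁)) C n₂ (d + y₃)) =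
    wt₃ q A B C y₁ y₂ y₃ / (normPsi q A B C n₁ n₂ * normCommon q A B C (n₁ + n₂) n₃) := by
  have hA1 := hAq.trans hq1
  have hAB0 : 0 < A * B := by positivity
  have hABq : A * B < q := by nlinarith
  have hA'0 : 0 < A * B * q ^ (2 * n₁) := by positivity
  have hA'q : A * B * q ^ (2 * n₁) < q := by
    have h1 : A * B * q ^ (2 * n₁) ≤ A * B * 1 :=
      mul_le_mul_of_nonneg_left (pow_le_one₀ hq0.le hq1.le) (by positivity)
    linarith
  have f1 := (normFactor_pos hq0 hq1 hA0 hAq hB0 hB1 n₁).ne'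
  have f2 := (normFactor_pos hq0 hq1 hA'0 hA'q hC0 hC1 n₂).ne'
  have f3 := (qPoch_pos hq0 hq1 hAB0.le (hABq.trans hq1) (2 * n₁)).ne'
  have f4 := (qPoch_pos hq0 hq1 hA'0.le (hA'q.trans hq1) d).ne'
  have hABC0 : 0 < A * B * C := by positivity
  have hABC1 : A * B * C < 1 := by nlinarith
  have f5 := (qPoch_pos hq0 hq1 hABC0.le hABC1 (2 * n₁)).ne'
  have hABCn := one_sub_mul_pow_pos hq0 hq1 hABC0.le hABC1 (2 * n₁)
  have f6 := (qPoch_pos hq0 hq1 (by positivity : 0 ≤ A * B * C * q ^ (2 * n₁)) (by linarith)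
    (n₂ + (n₂ + n₃))).ne'
  have f7 := (qPoch_self_pos hq0 hq1 d).ne'
  have f8 := (qPoch_self_pos hq0 hq1 n₃).ne'
  have e1 : qPoch (A * B) q (n₁ + (n₁ + d)) =
      qPoch (A * B) q (2 * n₁) * qPoch (A * B * q ^ (2 * n₁)) q d := by
    rw [← qPoch_add]; congr 1; ring
  have e2 : qPoch (A * B * C) q (2 * (n₁ + n₂) + n₃) =
      qPoch (A * B * C) q (2 * n₁) * qPoch (A * B * C * q ^ (2 * n₁)) q (n₂ + (n₂ + n₃)) := by
    rw [← qPoch_add]; congr 1; ring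
  have e3 : A * B * q ^ (2 * n₁) * C = A * B * C * q ^ (2 * n₁) := by ring
  have e4 : (q ^ ((n₁ + n₂ + n₃) * (n₁ + n₂))) =
      q ^ ((n₁ + d) * n₁) * (q ^ n₁) ^ y₃ * q ^ ((n₂ + n₃) * n₂) * q ^ (n₁ * n₂) := by
    rw [← pow_mul, ← pow_add, ← pow_add, ← pow_add]
    congr 1
    have : n₁ * (d + y₃) = n₁ * (n₂ + n₃) := by rw [hy]
    linarith
  have e5 : (A * B * q ^ (2 * n₁)) ^ y₃ = (A * B) ^ y₃ * ((q ^ n₁) ^ y₃) ^ 2 := by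
    rw [mul_pow (A * B), two_mul, pow_add, mul_pow (q ^ n₁), sq]
  rw [hd, hy, wt, wt, hahnNorm, hahnNorm, wt₃, normPsi, normCommon, Nat.add_sub_cancel_left,
    Nat.add_sub_cancel_left, e1, e2, e3, e4, e5]
  have p1 := pow_pos hq0 ((n₁ + d) * n₁)
  have p2 := pow_pos (pow_pos hq0 n₁) y₃
  have p3 := pow_pos hq0 ((n₂ + n₃) * n₂)
  have p4 := pow_pos hq0 (n₁ * n₂)
  have g1 := (qPoch_self_pos hq0 hq1 y₁).ne'
  have g2 := (qPoch_self_pos hq0 hq1 y₂).ne'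
  have g3 := (qPoch_self_pos hq0 hq1 y₃).ne'
  generalize normFactor q A B n₁ = F1 at *
  generalize normFactor q (A * B * q ^ (2 * n₁)) C n₂ = F2 at *
  generalize qPoch (A * B) q (2 * n₁) = F3 at *
  generalize qPoch (A * B * q ^ (2 * n₁)) q d = F4 at *
  generalize qPoch (A * B * C) q (2 * n₁) = F5 at *
  generalize qPoch (A * B * C * q ^ (2 * n₁)) q (n₂ + (n₂ + n₃)) = F6 at *
  generalize q ^ ((n₁ + d) * n₁) = Q1 at *
  generalize (q ^ n₁) ^ y₃ = Q2 at *
  generalize q ^ ((n₂ + n₃) * n₂) = Q3 at *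
  generalize q ^ (n₁ * n₂) = Q4 at *
  generalize (A * B) ^ y₃ = Q5 at *
  field_simp

/-- The same weight `wt₃` appears as for Ψ, except for q^(-2 m₁ y₁), whose square root is the extra
factor in `polyXi`. -/
theorem wt_div_hahnNorm_xi {q A B C : ℝ} (hq0 : 0 < q) (hq1 : q < 1) (hA0 : 0 < A) (hAq : A < q)
    (hB0 : 0 < B) (hBq : B < q) (hC0 : 0 < C) (hC1 : C < 1) {m₁ m₂ m₃ y₁ y₂ y₃ d : ℕ}
    (hd : y₂ + y₃ = m₁ + d) (hy : y₁ + d = m₂ + m₃) :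
    wt q B C y₂ y₃ / hahnNorm q B C m₁ (y₂ + y₃) *
      (wt q A (B * C * q ^ (2 * m₁)) y₁ d / hahnNorm q A (B * C * q ^ (2 * m₁)) m₂ (y₁ + d)) =
    wt₃ q A B C y₁ y₂ y₃ / (normXi q A B C m₁ m₂ * normCommon q A B C (m₁ + m₂) m₃) *
      (q ^ (m₁ * y₁))⁻¹ ^ 2 := by
  have hB1 := hBq.trans hq1
  have hBC0 : 0 < B * C := by positivity
  have hBC1 : B * C < 1 := by nlinarith
  have hB'0 : 0 < B * C * q ^ (2 * m₁) := by positivity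
  have hB'1 : B * C * q ^ (2 * m₁) < 1 := by
    have := one_sub_mul_pow_pos hq0 hq1 hBC0.le hBC1 (2 * m₁)
    linarith
  have f1 := (normFactor_pos hq0 hq1 hB0 hBq hC0 hC1 m₁).ne'
  have f2 := (normFactor_pos hq0 hq1 hA0 hAq hB'0 hB'1 m₂).ne'
  have f3 := (qPoch_pos hq0 hq1 hBC0.le hBC1 (2 * m₁)).ne'
  have f4 := (qPoch_pos hq0 hq1 hB'0.le hB'1 d).ne'
  have hABC0 : 0 < A * B * C := by positivity
  have hABC1 : A * B * C < 1 := by nlinarith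
  have f5 := (qPoch_pos hq0 hq1 hABC0.le hABC1 (2 * m₁)).ne'
  have hABCn := one_sub_mul_pow_pos hq0 hq1 hABC0.le hABC1 (2 * m₁)
  have f6 := (qPoch_pos hq0 hq1 (by positivity : 0 ≤ A * B * C * q ^ (2 * m₁)) (by linarith)
    (m₂ + (m₂ + m₃))).ne'
  have f7 := (qPoch_self_pos hq0 hq1 d).ne'
  have f8 := (qPoch_self_pos hq0 hq1 m₃).ne'
  have e1 : qPoch (B * C) q (m₁ + (m₁ + d)) =
      qPoch (B * C) q (2 * m₁) * qPoch (B * C * q ^ (2 * m₁)) q d := by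
    rw [← qPoch_add]; congr 1; ring
  have e2 : qPoch (A * B * C) q (2 * (m₁ + m₂) + m₃) =
      qPoch (A * B * C) q (2 * m₁) * qPoch (A * B * C * q ^ (2 * m₁)) q (m₂ + (m₂ + m₃)) := by
    rw [← qPoch_add]; congr 1; ring
  have e3 : A * (B * C * q ^ (2 * m₁)) = A * B * C * q ^ (2 * m₁) := by ring
  have e4 : q ^ ((m₁ + m₂ + m₃) * (m₁ + m₂)) =
      q ^ ((m₁ + d) * m₁) * q ^ (m₁ * y₁) * q ^ ((m₂ + m₃) * m₂) * q ^ (m₁ * m₂) := by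
    rw [← pow_add, ← pow_add, ← pow_add]
    congr 1
    have : m₁ * (y₁ + d) = m₁ * (m₂ + m₃) := by rw [hy]
    linarith
  have e5 : A ^ y₂ * (A * B) ^ y₃ = A ^ m₁ * A ^ d * B ^ y₃ := by
    rw [mul_pow, ← mul_assoc, ← pow_add, hd, pow_add]
  rw [hd, hy, wt, wt, hahnNorm, hahnNorm, wt₃, normXi, normCommon, Nat.add_sub_cancel_left,
    Nat.add_sub_cancel_left, e1, e2, e3, e4, mul_assoc (_ / _) (A ^ y₂), e5]
  have p1 := pow_pos hq0 ((m₁ + d) * m₁)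
  have p2 := pow_pos hq0 (m₁ * y₁)
  have p3 := pow_pos hq0 ((m₂ + m₃) * m₂)
  have p4 := pow_pos hq0 (m₁ * m₂)
  have g1 := (qPoch_self_pos hq0 hq1 y₁).ne'
  have g2 := (qPoch_self_pos hq0 hq1 y₂).ne'
  have g3 := (qPoch_self_pos hq0 hq1 y₃).ne'
  generalize normFactor q B C m₁ = F1 at *
  generalize normFactor q A (B * C * q ^ (2 * m₁)) m₂ = F2 at *
  generalize qPoch (B * C) q (2 * m₁) = F3 at *
  generalize qPoch (B * C * q ^ (2 * m₁)) q d = F4 at *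
  generalize qPoch (A * B * C) q (2 * m₁) = F5 at *
  generalize qPoch (A * B * C * q ^ (2 * m₁)) q (m₂ + (m₂ + m₃)) = F6 at *
  generalize q ^ ((m₁ + d) * m₁) = Q1 at *
  generalize q ^ (m₁ * y₁) = Q2 at *
  generalize q ^ ((m₂ + m₃) * m₂) = Q3 at *
  generalize q ^ (m₁ * m₂) = Q4 at *
  field_simp

theorem hahnFun_mul_psi {q A B C : ℝ} (hq0 : 0 < q) (hq1 : q < 1) (hA0 : 0 < A) (hAq : A < q)
    (hB0 : 0 < B) (hB1 : B < 1) (hC0 : 0 < C) (hC1 : C < 1) {n₁ n₂ n₃ y₁ y₂ y₃ : ℕ}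
    (hy : y₁ + y₂ + y₃ = n₁ + n₂ + n₃) :
    hahnFun q A B n₁ y₁ y₂ * hahnFun q (A * B * q ^ (2 * n₁)) C n₂ (y₁ + y₂ - n₁) y₃ =
      Real.sqrt (wt₃ q A B C y₁ y₂ y₃ /
        (normPsi q A B C n₁ n₂ * normCommon q A B C (n₁ + n₂) n₃)) *
      polyPsi q A B C n₁ n₂ y₁ y₂ y₃ := by
  rcases Nat.lt_or_ge (y₁ + y₂) n₁ with h | h
  · rw [hahnFun_eq_zero hq0 _ _ h, polyPsi, hahn_eq_zero hq0 _ _ h]; ring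
  obtain ⟨d, hd⟩ := Nat.exists_eq_add_of_le h
  rw [show y₁ + y₂ - n₁ = d by omega,
    ← wt_div_hahnNorm_psi hq0 hq1 hA0 hAq hB0 hB1 hC0 hC1 hd (by omega : d + y₃ = n₂ + n₃),
    Real.sqrt_mul (div_pos (wt_pos hq0 hq1 hA0 (hAq.trans hq1) hB0 hB1 _ _)
      (hahnNorm_pos hq0 hq1 hA0 hAq hB0 hB1 _ _)).le, hahnFun, hahnFun, polyPsi,
    show y₁ + y₂ - n₁ = d by omega]
  ring

theorem hahnFun_mul_xi {q A B C : ℝ} (hq0 : 0 < q) (hq1 : q < 1) (hA0 : 0 < A) (hAq : A < q)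
    (hB0 : 0 < B) (hBq : B < q) (hC0 : 0 < C) (hC1 : C < 1) {m₁ m₂ m₃ y₁ y₂ y₃ : ℕ}
    (hy : y₁ + y₂ + y₃ = m₁ + m₂ + m₃) :
    hahnFun q B C m₁ y₂ y₃ * hahnFun q A (B * C * q ^ (2 * m₁)) m₂ y₁ (y₂ + y₃ - m₁) =
      Real.sqrt (wt₃ q A B C y₁ y₂ y₃ /
        (normXi q A B C m₁ m₂ * normCommon q A B C (m₁ + m₂) m₃)) *
      polyXi q A B C m₁ m₂ y₁ y₂ y₃ := by
  rcases Nat.lt_or_ge (y₂ + y₃) m₁ with h | h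
  · rw [hahnFun_eq_zero hq0 _ _ h, polyXi, hahn_eq_zero hq0 _ _ h]; ring
  obtain ⟨d, hd⟩ := Nat.exists_eq_add_of_le h
  have hs := congrArg Real.sqrt
    (wt_div_hahnNorm_xi hq0 hq1 hA0 hAq hB0 hBq hC0 hC1 hd (by omega : y₁ + d = m₂ + m₃))
  rw [Real.sqrt_mul (div_pos (wt_pos hq0 hq1 hB0 (hBq.trans hq1) hC0 hC1 _ _)
      (hahnNorm_pos hq0 hq1 hB0 hBq hC0 hC1 _ _)).le, Real.sqrt_mul' _ (sq_nonneg _),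
    Real.sqrt_sq (inv_nonneg.2 (pow_pos hq0 _).le)] at hs
  rw [hahnFun, hahnFun, polyXi, show y₂ + y₃ - m₁ = d by omega]
  linear_combination hahn q B C m₁ y₂ y₃ * hahn q A (B * C * q ^ (2 * m₁)) m₂ y₁ d * hs

/-! ### The q-Racah functions and the normalised connection coefficients -/

/-- The q-Racah weight with parameters (α₂, α₃, K + α₁ + α₂ + 1, K), where q^(c-N) becomes AB/q and
q^(b+c+1) becomes A B C q^(K-1). -/
noncomputable def racahWeight (q A B C : ℝ) (K n : ℕ) : ℝ :=
  (1 - A * B / q * q ^ (2 * n)) / (1 - A * B / q) *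
    (qPoch (A * B / q) q n * qPoch B q n * qPoch (A * B * C / q * q ^ K) q n *
      qPoch (q ^ K)⁻¹ q n / (qPoch q q n * qPoch A q n * qPoch (q / (C * q ^ K)) q n *
        qPoch (A * B * q ^ K) q n)) * ((B * C / q) ^ n)⁻¹

noncomputable def racahNorm (q A B C : ℝ) (K m : ℕ) : ℝ :=
  qPoch (q / (A * B * q ^ K)) q K * qPoch (B * C) q K /
      (qPoch (q / (A * q ^ K)) q K * qPoch C q K) *
    (qPoch q q m * qPoch B q m * qPoch C q m) *
    (qPoch (q / (A * q ^ K)) q m * qPoch (A * B * C / q * q ^ K) q m * qPoch (q ^ K)⁻¹ q m) *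
    ((1 - B * C / q) / (1 - B * C / q * q ^ (2 * m))) *
    (qPoch (B * C * q ^ K) q m / qPoch (B * C / q) q m)

theorem qRacahWeight_eq {q : ℝ} (hq0 : 0 < q) (a b c : ℝ) (K n : ℕ) :
    qRacahWeight q n b c ((K : ℝ) + a + b + 1) K =
      racahWeight q (q ^ (a + 1)) (q ^ (b + 1)) (q ^ (c + 1)) K n := by
  have e1 : q ^ (2 * (n : ℝ) + ((K : ℝ) + a + b + 1) - K) =
      q ^ (a + 1) * q ^ (b + 1) / q * q ^ (2 * n) := by
    rw [← rpow_add_add_one hq0]; congr 1; push_cast; ring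
  have e2 : q ^ ((K : ℝ) + a + b + 1 - K) = q ^ (a + 1) * q ^ (b + 1) / q := by
    rw [← rpow_add_one hq0]; congr 1; ring
  have e3 : q ^ (c + ((K : ℝ) + a + b + 1) + 1) =
      q ^ (a + 1) * q ^ (b + 1) * q ^ (c + 1) / q * q ^ K := by
    rw [← Real.rpow_natCast q K, div_mul_eq_mul_div, ← Real.rpow_add hq0, ← Real.rpow_add hq0,
      ← Real.rpow_add hq0, ← Real.rpow_sub_one hq0.ne']
    congr 1; ring
  have e4 : q ^ ((K : ℝ) + a + b + 1 - b - K) = q ^ (a + 1) := by congr 1; ring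
  have e5 : q ^ (-c - (K : ℝ)) = q / (q ^ (c + 1) * q ^ K) := by
    rw [← Real.rpow_natCast q K, ← Real.rpow_add hq0]
    conv_rhs => rw [← Real.rpow_one q, Real.rpow_one q]
    rw [eq_div_iff (Real.rpow_pos_of_pos hq0 _).ne', ← Real.rpow_add hq0]
    conv_rhs => rw [← Real.rpow_one q]
    congr 1; ring
  have e6 : q ^ ((K : ℝ) + a + b + 1 + 1) = q ^ (a + 1) * q ^ (b + 1) * q ^ K := by
    rw [← Real.rpow_natCast q K, ← Real.rpow_add hq0, ← Real.rpow_add hq0]; congr 1; ring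
  have e7 : q ^ (-((n : ℝ) * (b + c + 1))) = ((q ^ (b + 1) * q ^ (c + 1) / q) ^ n)⁻¹ := by
    rw [Real.rpow_neg hq0.le, rpow_natCast_mul_eq hq0, rpow_add_one hq0]
  rw [qRacahWeight, racahWeight, e1, e2, e3, e4, e5, e6, e7, rpow_neg_natCast_eq hq0]

theorem qRacahNorm_eq {q : ℝ} (hq0 : 0 < q) (a b c : ℝ) (K m : ℕ) :
    qRacahNorm q m b c ((K : ℝ) + a + b + 1) K =
      racahNorm q (q ^ (a + 1)) (q ^ (b + 1)) (q ^ (c + 1)) K m := by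
  have e1 : q ^ (-((K : ℝ) + a + b + 1)) = q / (q ^ (a + 1) * q ^ (b + 1) * q ^ K) := by
    rw [← Real.rpow_natCast q K, ← Real.rpow_add hq0, ← Real.rpow_add hq0,
      eq_div_iff (Real.rpow_pos_of_pos hq0 _).ne', ← Real.rpow_add hq0]
    conv_rhs => rw [← Real.rpow_one q]
    congr 1; ring
  have e2 : q ^ (b - ((K : ℝ) + a + b + 1) + 1) = q / (q ^ (a + 1) * q ^ K) := by
    rw [← Real.rpow_natCast q K, ← Real.rpow_add hq0,
      eq_div_iff (Real.rpow_pos_of_pos hq0 _).ne', ← Real.rpow_add hq0]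
    conv_rhs => rw [← Real.rpow_one q]
    congr 1; ring
  have e3 : q ^ (c + ((K : ℝ) + a + b + 1) + 1) =
      q ^ (a + 1) * q ^ (b + 1) * q ^ (c + 1) / q * q ^ K := by
    rw [← Real.rpow_natCast q K, div_mul_eq_mul_div, ← Real.rpow_add hq0, ← Real.rpow_add hq0,
      ← Real.rpow_add hq0, ← Real.rpow_sub_one hq0.ne']
    congr 1; ring
  have e4 : q ^ (2 * (m : ℝ) + b + c + 1) = q ^ (b + 1) * q ^ (c + 1) / q * q ^ (2 * m) := by
    rw [← rpow_add_add_one hq0]; push_cast; rfl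
  have e5 : q ^ ((K : ℝ) + b + c + 2) = q ^ (b + 1) * q ^ (c + 1) * q ^ K := by
    rw [← Real.rpow_natCast q K, ← Real.rpow_add hq0, ← Real.rpow_add hq0]; congr 1; ring
  rw [qRacahNorm, racahNorm, e1, e2, e3, e4, e5, rpow_neg_natCast_eq hq0, rpow_add_two hq0,
    rpow_add_one hq0]

/-- Since N - c = -(α₁ + α₂ + 1), the prefactor q^(m(N-c)/2) is the square root of (AB/q)^(-m). -/
theorem qRacah_eq {q : ℝ} (hq0 : 0 < q) (hq1 : q < 1) {a b c : ℝ} (ha : 0 < a) (hb : 0 < b)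
    (hc : 0 < c) {K m : ℕ} (hm : m ≤ K) (n : ℕ) :
    qRacah q m n b c ((K : ℝ) + a + b + 1) K =
      racah q (q ^ (a + 1)) (q ^ (b + 1)) (q ^ (c + 1)) K m n *
        Real.sqrt (((q ^ (a + 1) * q ^ (b + 1) / q) ^ m)⁻¹) := by
  obtain ⟨hA0, hAq, hA1⟩ := rpow_add_one_pos_lt hq0 hq1 ha
  obtain ⟨hB0, -, hB1⟩ := rpow_add_one_pos_lt hq0 hq1 hb
  obtain ⟨hC0, -, hC1⟩ := rpow_add_one_pos_lt hq0 hq1 hc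
  have e1 : q ^ ((n : ℝ) + ((K : ℝ) + a + b + 1) - K) =
      q ^ (a + 1) * q ^ (b + 1) / q * q ^ n := by
    rw [← rpow_add_add_one hq0]; congr 1; ring
  have e3 : q ^ (c + ((K : ℝ) + a + b + 1) + 1) =
      q ^ (a + 1) * q ^ (b + 1) * q ^ (c + 1) / q * q ^ K := by
    rw [← Real.rpow_natCast q K, div_mul_eq_mul_div, ← Real.rpow_add hq0, ← Real.rpow_add hq0,
      ← Real.rpow_add hq0, ← Real.rpow_sub_one hq0.ne']
    congr 1; ring
  have e4 : q ^ ((m : ℝ) * ((K : ℝ) - ((K : ℝ) + a + b + 1)) / 2) =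
      Real.sqrt (((q ^ (a + 1) * q ^ (b + 1) / q) ^ m)⁻¹) := by
    rw [Real.sqrt_eq_rpow, ← rpow_add_one hq0, ← rpow_natCast_mul_eq hq0, ← Real.rpow_neg hq0.le,
      ← Real.rpow_mul hq0.le]
    congr 1; ring
  rw [qRacah, e4, e1, e3, basicHyp_four_three (n := m) fun k hk => by
    rw [rpow_neg_natCast_eq hq0, qPoch_inv_pow_eq_zero hq0 hk], racah, Finset.mul_sum,
    Finset.sum_mul]
  refine Finset.sum_congr rfl fun j hj => ?_
  obtain ⟨i, rfl⟩ := Nat.exists_eq_add_of_le (Nat.lt_succ_iff.1 (Finset.mem_range.1 hj))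
  have h1 := (qPoch_pos hq0 hq1 hB0.le hB1 j).ne'
  have h2 := (qPoch_self_pos hq0 hq1 j).ne'
  have h3 := qPoch_inv_pow_ne_zero hq0 hq1 (show j ≤ K by omega)
  rw [rpow_neg_natCast_eq hq0, rpow_neg_natCast_eq hq0, rpow_neg_natCast_eq hq0,
    rpow_add_add_one hq0, hahnCoeff, qPoch_add _ q j i, qPoch_add (q ^ K)⁻¹ q j i,
    Nat.add_sub_cancel_left, mul_comm (q ^ j) (q ^ K)⁻¹,
    qPoch_add (q ^ (a + 1) * q ^ (b + 1) * q ^ (c + 1) / q * q ^ K) q j i]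
  generalize q ^ (a + 1) = A at *
  generalize q ^ (b + 1) = B at *
  generalize q ^ (c + 1) = C at *
  have hE0 : 0 < A * B * C / q * q ^ K := by positivity
  have hE1 : A * B * C / q * q ^ K < 1 := by
    have h1 : A * B * C / q < 1 := by
      have : A * B < q := by nlinarith
      rw [div_lt_one hq0]; nlinarith [mul_pos hA0 hB0]
    have := one_sub_mul_pow_pos hq0 hq1 (by positivity) h1 K
    linarith
  have h4 := (qPoch_pos hq0 hq1 hE0.le hE1 j).ne'
  generalize qPoch (q ^ K)⁻¹ q j = X at *
  generalize qPoch (A * B * C / q * q ^ K) q j = Y at *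
  generalize Real.sqrt _ = Z
  clear e1 e3 e4
  field_simp

theorem qPoch_level_mul {c q : ℝ} (hc : c ≠ 0) (hq : q ≠ 0) (n m : ℕ) :
    qPoch (q / (c * q ^ (n + m))) q n * qPoch c q m * (c ^ n * q ^ (m * n) * q ^ n.choose 2) =
      (-1) ^ n * qPoch c q (n + m) := by
  have h := qPoch_reverse (mul_ne_zero hc (pow_ne_zero m hq)) hq n
  rw [mul_assoc c, ← pow_add, add_comm m n, mul_pow, ← pow_mul] at h
  rw [add_comm n m, qPoch_add, add_comm m n]
  linear_combination qPoch c q m * h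

/-- The common value of `connFactor ^ 2 * normPsi / racahWeight`. -/
noncomputable def connConst (q A B C : ℝ) (K : ℕ) : ℝ :=
  qPoch q q K * qPoch C q K * qPoch (A * B * C / q) q (2 * K) /
    (qPoch (A * B) q K * qPoch (q ^ K)⁻¹ q K ^ 2 * qPoch (A * B * C / q) q K *
      qPoch (A * B * C) q (2 * K)) * (A ^ K * B ^ K * (q ^ K.choose 2) ^ 2)

theorem qPoch_split_double {q c : ℝ} (hq : q ≠ 0) (n n' : ℕ) :
    qPoch (c / q) q n * qPoch (c / q * q ^ n) q n * (1 - c / q * q ^ (2 * n)) *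
      qPoch (c * q ^ (2 * n)) q n' =
    (1 - c / q) * (qPoch c q (n + n') * qPoch (c * q ^ (n + n')) q n) := by
  rw [← qPoch_add, ← two_mul, ← qPoch_succ, qPoch_succ_left, div_mul_cancel₀ _ hq, mul_assoc,
    ← qPoch_add, ← qPoch_add]
  congr 2; ring

-- For fixed K the left side depends on n only through the q-Racah weight. All symbols are split or
-- reversed until those of length K, which go into `connConst`, separate off.
set_option maxHeartbeats 1000000 in
theorem connFactor_sq_mul_normPsi {q A B C : ℝ} (hq0 : 0 < q) (hq1 : q < 1) (hA0 : 0 < A)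
    (hAq : A < q) (hB0 : 0 < B) (hB1 : B < 1) (hC0 : 0 < C) (hC1 : C < 1) (n n' : ℕ) :
    connFactor q A B C (n + n') n ^ 2 * normPsi q A B C n n' =
      connConst q A B C (n + n') * racahWeight q A B C (n + n') n := by
  have hA1 := hAq.trans hq1
  have hAB0 : 0 < A * B := by positivity
  have hABq : A * B < q := by nlinarith
  have hAB1 := hABq.trans hq1
  have ha0 : 0 < A * B / q := by positivity
  have ha1 : A * B / q < 1 := (div_lt_one hq0).2 hABq
  have hG0 : 0 < A * B * C / q := by positivity
  have hG1 : A * B * C / q < 1 := by rw [div_lt_one hq0]; nlinarith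
  have hABC0 : 0 < A * B * C := by positivity
  have hABC1 : A * B * C < 1 := by nlinarith
  have lt1 : ∀ {c : ℝ} (k : ℕ), 0 < c → c < 1 → c * q ^ k < 1 := fun k h0 h1 => by
    have := one_sub_mul_pow_pos hq0 hq1 h0.le h1 k; linarith
  have r1 := qPoch_split_double (c := A * B) hq0.ne' n n'
  have r2 : qPoch (A * B) q (n + n' + n) = qPoch (A * B) q (n + n') *
      qPoch (A * B * q ^ (n + n')) q n := qPoch_add _ _ _ _
  have r3 : qPoch (A * B * C / q) q (2 * (n + n')) = qPoch (A * B * C / q) q (n + n') *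
      qPoch (A * B * C / q * q ^ (n + n')) q n *
      qPoch (A * B * q ^ (2 * n) * C / q * q ^ n') q n' := by
    rw [show A * B * q ^ (2 * n) * C / q * q ^ n' = A * B * C / q * q ^ (n + n' + n) by ring,
      ← qPoch_add, ← qPoch_add]
    congr 1; ring
  have r4 : qPoch (A * B * C) q (2 * (n + n')) = qPoch (A * B * C) q (2 * n) *
      qPoch (A * B * q ^ (2 * n) * C) q (2 * n') := by
    rw [show A * B * q ^ (2 * n) * C = A * B * C * q ^ (2 * n) by ring, ← qPoch_add]
    congr 1; ring
  have r5 := qPoch_inv_pow hq0 n n'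
  have r6 := qPoch_level_mul hC0.ne' hq0.ne' n n'
  have r7 : (A * B * q ^ (2 * n)) ^ n' = A ^ n' * B ^ n' * (q ^ (n * n')) ^ 2 := by ring
  have hs : ((-1 : ℝ) ^ n) * (-1) ^ n = 1 := by rw [← mul_pow]; simp
  have f1 := (qPoch_pos hq0 hq1 ha0.le ha1 n).ne'
  have f2 := (one_sub_mul_pow_pos hq0 hq1 ha0.le ha1 (2 * n)).ne'
  have f3 := (qPoch_pos hq0 hq1 (by positivity) (lt1 (2 * n) hAB0 hAB1) n').ne'
  have f4 := (qPoch_pos hq0 hq1 hAB0.le hAB1 (n + n')).ne'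
  have f5 := (qPoch_pos hq0 hq1 (by positivity) (lt1 (n + n') hAB0 hAB1) n).ne'
  have f6 := (qPoch_pos hq0 hq1 hG0.le hG1 (n + n')).ne'
  have f7 := (qPoch_pos hq0 hq1 hABC0.le hABC1 (2 * n)).ne'
  have f8 : qPoch (A * B * q ^ (2 * n) * C) q (2 * n') ≠ 0 := by
    rw [show A * B * q ^ (2 * n) * C = A * B * C * q ^ (2 * n) by ring]
    exact (qPoch_pos hq0 hq1 (by positivity) (lt1 (2 * n) hABC0 hABC1) _).ne'
  have f9 := (qPoch_self_pos hq0 hq1 n).ne'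
  have f10 := (qPoch_self_pos hq0 hq1 n').ne'
  have f11 := (qPoch_self_pos hq0 hq1 (n + n')).ne'
  have f12 := (qPoch_pos hq0 hq1 hA0.le hA1 n).ne'
  have f13 := (qPoch_pos hq0 hq1 hB0.le hB1 n).ne'
  have f14 := (qPoch_pos hq0 hq1 hC0.le hC1 n').ne'
  have f15 := (qPoch_pos hq0 hq1 hC0.le hC1 (n + n')).ne'
  have f16 := qPoch_inv_pow_ne_zero hq0 hq1 (le_refl (n + n'))
  have f17 : 1 - A * B / q ≠ 0 := by linarith
  have f18 := (qPoch_pos hq0 hq1 hAB0.le hAB1 (2 * n)).ne'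
  have p1 := pow_pos hq0 (n * n')
  have p2 := pow_pos hq0 n
  have p3 := pow_pos hq0 (n.choose 2)
  have r8 : qPoch (A * B / q * q ^ n) q n = (1 - A * B / q) *
      (qPoch (A * B) q (n + n') * qPoch (A * B * q ^ (n + n')) q n) /
      (qPoch (A * B / q) q n * (1 - A * B / q * q ^ (2 * n)) *
        qPoch (A * B * q ^ (2 * n)) q n') := by
    rw [eq_div_iff (mul_ne_zero (mul_ne_zero f1 f2) f3), ← r1]; ring
  have r9 : qPoch (q ^ (n + n'))⁻¹ q n = (-1) ^ n * qPoch q q (n + n') /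
      (qPoch q q n' * (q ^ (n * n') * q ^ n * q ^ n.choose 2)) := by
    rw [eq_div_iff (by positivity), ← r5]; ring
  have r10 : qPoch (q / (C * q ^ (n + n'))) q n = (-1) ^ n * qPoch C q (n + n') /
      (qPoch C q n' * (C ^ n * q ^ (n * n') * q ^ n.choose 2)) := by
    rw [eq_div_iff (by positivity), ← r6, mul_comm n' n]; ring
  rw [connFactor, normPsi, normFactor, normFactor, connConst, racahWeight, r2, r3, r4, r7, r8, r9,
    r10, pow_choose_two_add, pow_add A, pow_add B, div_pow (B * C) q n,
    mul_pow B C n]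
  clear r1 r2 r3 r4 r5 r6 r7 r8 r9 r10 lt1
  generalize qPoch (q ^ (n + n'))⁻¹ q (n + n') = Y at *
  generalize qPoch (A * B * q ^ (2 * n) * C / q * q ^ n') q n' = X1 at *
  generalize qPoch (A * B * q ^ (2 * n) * C) q (2 * n') = X2 at *
  generalize qPoch (A * B * q ^ (2 * n)) q n' = X3 at *
  generalize qPoch (A * B * q ^ (n + n')) q n = X4 at *
  generalize qPoch (A * B * C / q * q ^ (n + n')) q n = X5 at *
  generalize qPoch (A * B * C / q) q (n + n') = X6 at *
  generalize qPoch (A * B * C) q (2 * n) = X7 at *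
  generalize qPoch (A * B / q) q n = X8 at *
  generalize qPoch (A * B) q (n + n') = X9 at *
  generalize qPoch (A * B) q (2 * n) = X10 at *
  generalize 1 - A * B / q * q ^ (2 * n) = X11 at *
  generalize 1 - A * B / q = X12 at *
  generalize (-1 : ℝ) ^ n = σ at *
  have hσ : σ ≠ 0 := by rintro rfl; simp at hs
  field_simp
  linear_combination X5 ^ 2 * X1 * (σ ^ 2 + 1) * hs

-- The counterpart on the side of m: the same constant links the q-Racah norm to `normXi`, so it
-- drops out of the quotient of norms.
set_option maxHeartbeats 1000000 in
theorem racahNorm_mul_connConst {q A B C : ℝ} (hq0 : 0 < q) (hq1 : q < 1) (hA0 : 0 < A)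
    (hAq : A < q) (hB0 : 0 < B) (hBq : B < q) (hC0 : 0 < C) (hC1 : C < 1) (m m' : ℕ) :
    (qPoch A q m' * qPoch (q ^ m')⁻¹ q m' / qPoch (A * B * C / q * q ^ (m + m')) q m) ^ 2 *
      racahNorm q A B C (m + m') m * (A * B / q) ^ m * connConst q A B C (m + m') =
    normXi q A B C m m' := by
  have hA1 := hAq.trans hq1
  have hB1 := hBq.trans hq1
  have hAB0 : 0 < A * B := by positivity
  have hABq : A * B < q := by nlinarith
  have hAB1 := hABq.trans hq1
  have hBC0 : 0 < B * C := by positivity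
  have hBCq : B * C < q := by nlinarith
  have hBC1 := hBCq.trans hq1
  have hb0 : 0 < B * C / q := by positivity
  have hb1 : B * C / q < 1 := (div_lt_one hq0).2 hBCq
  have hG0 : 0 < A * B * C / q := by positivity
  have hG1 : A * B * C / q < 1 := by rw [div_lt_one hq0]; nlinarith
  have hABC0 : 0 < A * B * C := by positivity
  have hABC1 : A * B * C < 1 := by nlinarith
  have lt1 : ∀ {c : ℝ} (k : ℕ), 0 < c → c < 1 → c * q ^ k < 1 := fun k h0 h1 => by
    have := one_sub_mul_pow_pos hq0 hq1 h0.le h1 k; linarith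
  have r1 := qPoch_split_double (c := B * C) hq0.ne' m m'
  have r3 : qPoch (A * B * C / q) q (2 * (m + m')) = qPoch (A * B * C / q) q (m + m') *
      qPoch (A * B * C / q * q ^ (m + m')) q m *
      qPoch (A * (B * C * q ^ (2 * m)) / q * q ^ m') q m' := by
    rw [show A * (B * C * q ^ (2 * m)) / q * q ^ m' = A * B * C / q * q ^ (m + m' + m) by ring,
      ← qPoch_add, ← qPoch_add]
    congr 1; ring
  have r4 : qPoch (A * B * C) q (2 * (m + m')) = qPoch (A * B * C) q (2 * m) *
      qPoch (A * (B * C * q ^ (2 * m))) q (2 * m') := by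
    rw [show A * (B * C * q ^ (2 * m)) = A * B * C * q ^ (2 * m) by ring, ← qPoch_add]
    congr 1; ring
  have r5 := qPoch_inv_pow hq0 m m'
  have r6 := qPoch_level_mul hA0.ne' hq0.ne' m m'
  have r7 := qPoch_level_mul hA0.ne' hq0.ne' (m + m') 0
  have r8 := qPoch_level_mul hAB0.ne' hq0.ne' (m + m') 0
  rw [qPoch_zero, zero_mul, pow_zero, mul_one, mul_one, add_zero] at r7 r8
  have r9 : qPoch (q ^ (m + m'))⁻¹ q (m + m') =
      qPoch (q ^ (m + m'))⁻¹ q m * qPoch (q ^ m')⁻¹ q m' := by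
    have := (pow_pos hq0 m).ne'
    rw [qPoch_add]
    congr 2
    rw [pow_add]; field_simp
  have hs : ((-1 : ℝ) ^ m) * (-1) ^ m = 1 := by rw [← mul_pow]; simp
  have hs' : ((-1 : ℝ) ^ (m + m')) ≠ 0 := pow_ne_zero _ (by norm_num)
  have f1 := (qPoch_pos hq0 hq1 hb0.le hb1 m).ne'
  have f2 := (one_sub_mul_pow_pos hq0 hq1 hb0.le hb1 (2 * m)).ne'
  have f3 := (qPoch_pos hq0 hq1 (by positivity) (lt1 (2 * m) hBC0 hBC1) m').ne'
  have f4 := (qPoch_pos hq0 hq1 hAB0.le hAB1 (m + m')).ne'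
  have f5 := (qPoch_pos hq0 hq1 hBC0.le hBC1 (2 * m)).ne'
  have f6 := (qPoch_pos hq0 hq1 hG0.le hG1 (m + m')).ne'
  have f7 := (qPoch_pos hq0 hq1 hABC0.le hABC1 (2 * m)).ne'
  have f8 : qPoch (A * (B * C * q ^ (2 * m))) q (2 * m') ≠ 0 := by
    rw [show A * (B * C * q ^ (2 * m)) = A * B * C * q ^ (2 * m) by ring]
    exact (qPoch_pos hq0 hq1 (by positivity) (lt1 (2 * m) hABC0 hABC1) _).ne'
  have f9 := (qPoch_self_pos hq0 hq1 m).ne'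
  have f10 := (qPoch_self_pos hq0 hq1 m').ne'
  have f11 := (qPoch_self_pos hq0 hq1 (m + m')).ne'
  have f12 := (qPoch_pos hq0 hq1 hA0.le hA1 m').ne'
  have f13 := (qPoch_pos hq0 hq1 hA0.le hA1 (m + m')).ne'
  have f14 := (qPoch_pos hq0 hq1 hC0.le hC1 (m + m')).ne'
  have f15 := qPoch_inv_pow_ne_zero hq0 hq1 (le_refl m')
  have f16 := (qPoch_pos hq0 hq1 (by positivity) (lt1 (m + m') hG0 hG1) m).ne'
  have f17 : 1 - B * C / q ≠ 0 := by linarith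
  have p1 := pow_pos hq0 (m * m')
  have p2 := pow_pos hq0 m
  have p3 := pow_pos hq0 (m.choose 2)
  have p4 := pow_pos hq0 (m'.choose 2)
  have t1 : qPoch (B * C / q * q ^ m) q m = (1 - B * C / q) *
      (qPoch (B * C) q (m + m') * qPoch (B * C * q ^ (m + m')) q m) /
      (qPoch (B * C / q) q m * (1 - B * C / q * q ^ (2 * m)) *
        qPoch (B * C * q ^ (2 * m)) q m') := by
    rw [eq_div_iff (mul_ne_zero (mul_ne_zero f1 f2) f3), ← r1]; ring
  have t2 : qPoch (q ^ (m + m'))⁻¹ q m = (-1) ^ m * qPoch q q (m + m') /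
      (qPoch q q m' * (q ^ (m * m') * q ^ m * q ^ m.choose 2)) := by
    rw [eq_div_iff (by positivity), ← r5]; ring
  have t3 : qPoch (q / (A * q ^ (m + m'))) q m = (-1) ^ m * qPoch A q (m + m') /
      (qPoch A q m' * (A ^ m * q ^ (m * m') * q ^ m.choose 2)) := by
    rw [eq_div_iff (by positivity), ← r6, mul_comm m' m]; ring
  have t4 : qPoch (q / (A * q ^ (m + m'))) q (m + m') = (-1) ^ (m + m') * qPoch A q (m + m') /
      (A ^ (m + m') * q ^ (m + m').choose 2) := by
    rw [eq_div_iff (by positivity), ← r7]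
  have t5 : qPoch (q / (A * B * q ^ (m + m'))) q (m + m') =
      (-1) ^ (m + m') * qPoch (A * B) q (m + m') /
      ((A * B) ^ (m + m') * q ^ (m + m').choose 2) := by
    rw [eq_div_iff (by positivity), ← r8]
  rw [normXi, normFactor, normFactor, connConst, racahNorm, t4, t5, r9, r3, r4, t1, t2, t3,
    pow_choose_two_add, mul_pow A B, pow_add A, pow_add B, div_pow, div_pow, mul_pow A B m]
  clear r1 r3 r4 r5 r6 r7 r8 r9 t1 t2 t3 t4 t5 lt1
  generalize qPoch (q ^ m')⁻¹ q m' = Y at *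
  generalize qPoch (A * (B * C * q ^ (2 * m)) / q * q ^ m') q m' = X1 at *
  generalize qPoch (A * (B * C * q ^ (2 * m))) q (2 * m') = X2 at *
  generalize qPoch (B * C * q ^ (2 * m)) q m' = X3 at *
  generalize qPoch (B * C * q ^ (m + m')) q m = X4 at *
  generalize qPoch (A * B * C / q * q ^ (m + m')) q m = X5 at *
  generalize qPoch (A * B * C / q) q (m + m') = X6 at *
  generalize qPoch (A * B * C) q (2 * m) = X7 at *
  generalize qPoch (B * C / q) q m = X8 at *
  generalize qPoch (A * B) q (m + m') = X9 at *
  generalize qPoch (B * C) q (2 * m) = X10 at *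
  generalize 1 - B * C / q * q ^ (2 * m) = X11 at *
  generalize 1 - B * C / q = X12 at *
  generalize (-1 : ℝ) ^ m = σ at *
  generalize (-1 : ℝ) ^ (m + m') = σ' at *
  have hσ : σ ≠ 0 := by rintro rfl; simp at hs
  field_simp

theorem neg_one_pow_mul_qPoch_inv_pos {q : ℝ} (hq0 : 0 < q) (hq1 : q < 1) {x j : ℕ} (h : j ≤ x) :
    0 < (-1) ^ j * qPoch (q ^ x)⁻¹ q j := by
  have : (-1) ^ j * qPoch (q ^ x)⁻¹ q j =
      ∏ i ∈ Finset.range j, -(1 - (q ^ x)⁻¹ * q ^ i) := by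
    rw [Finset.prod_neg, Finset.card_range, qPoch]
  rw [this]
  refine Finset.prod_pos fun i hi => ?_
  have := inv_pow_mul_pow_ne_one hq0 hq1 (lt_of_lt_of_le (Finset.mem_range.1 hi) h)
  linarith

theorem normPsi_pos {q A B C : ℝ} (hq0 : 0 < q) (hq1 : q < 1) (hA0 : 0 < A) (hAq : A < q)
    (hB0 : 0 < B) (hB1 : B < 1) (hC0 : 0 < C) (hC1 : C < 1) (n₁ n₂ : ℕ) :
    0 < normPsi q A B C n₁ n₂ := by
  have hAB0 : 0 < A * B := by positivity
  have hABq : A * B < q := by nlinarith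
  have hA'q : A * B * q ^ (2 * n₁) < q := by
    have h1 : A * B * q ^ (2 * n₁) ≤ A * B * 1 :=
      mul_le_mul_of_nonneg_left (pow_le_one₀ hq0.le hq1.le) (by positivity)
    linarith
  have f1 := normFactor_pos hq0 hq1 hA0 hAq hB0 hB1 n₁
  have f2 := normFactor_pos hq0 hq1 (by positivity) hA'q hC0 hC1 n₂
  have f3 := qPoch_pos hq0 hq1 hAB0.le (hABq.trans hq1) (2 * n₁)
  have f5 := qPoch_pos hq0 hq1 (by positivity : 0 ≤ A * B * C) (by nlinarith) (2 * n₁)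
  unfold normPsi
  positivity

theorem normXi_pos {q A B C : ℝ} (hq0 : 0 < q) (hq1 : q < 1) (hA0 : 0 < A) (hAq : A < q)
    (hB0 : 0 < B) (hBq : B < q) (hC0 : 0 < C) (hC1 : C < 1) (m₁ m₂ : ℕ) :
    0 < normXi q A B C m₁ m₂ := by
  have hBC0 : 0 < B * C := by positivity
  have hBC1 : B * C < 1 := by nlinarith
  have hAB1 : A * B < 1 := by nlinarith
  have hB'1 := one_sub_mul_pow_pos hq0 hq1 hBC0.le hBC1 (2 * m₁)
  have f1 := normFactor_pos hq0 hq1 hB0 hBq hC0 hC1 m₁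
  have f2 := normFactor_pos hq0 hq1 hA0 hAq
    (by positivity : 0 < B * C * q ^ (2 * m₁)) (by linarith) m₂
  have f3 := qPoch_pos hq0 hq1 hBC0.le hBC1 (2 * m₁)
  have f5 := qPoch_pos hq0 hq1 (by positivity : 0 ≤ A * B * C)
    (by nlinarith [mul_pos hA0 hB0]) (2 * m₁)
  unfold normXi
  positivity

/-- The two preceding norm identities determine the square of the factor in front of `racah`. Taking
roots then requires its sign. -/
theorem polyConn_mul_sqrt {q A B C : ℝ} (hq0 : 0 < q) (hq1 : q < 1) (hA0 : 0 < A) (hAq : A < q)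
    (hB0 : 0 < B) (hBq : B < q) (hC0 : 0 < C) (hC1 : C < 1) {m m' n n' : ℕ}
    (h : n + n' = m + m') :
    polyConn q A B C m m' n * Real.sqrt (normPsi q A B C n n' / normXi q A B C m m') =
      (-1) ^ m * (Real.sqrt (racahWeight q A B C (m + m') n / racahNorm q A B C (m + m') m) *
        (racah q A B C (m + m') m n * Real.sqrt (((A * B / q) ^ m)⁻¹))) := by
  have hA1 := hAq.trans hq1
  have hB1 := hBq.trans hq1
  have hAB0 : 0 < A * B := by positivity
  have hABq : A * B < q := by nlinarith
  have hAB1 := hABq.trans hq1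
  have ha0 : 0 < A * B / q := by positivity
  have ha1 : A * B / q < 1 := (div_lt_one hq0).2 hABq
  have hG0 : 0 < A * B * C / q := by positivity
  have hG1 : A * B * C / q < 1 := by rw [div_lt_one hq0]; nlinarith
  have hABC1 : A * B * C < 1 := by nlinarith
  have hE1 := one_sub_mul_pow_pos hq0 hq1 hG0.le hG1 (m + m')
  have g1 := connFactor_sq_mul_normPsi hq0 hq1 hA0 hAq hB0 hB1 hC0 hC1 n n'
  have g2 := racahNorm_mul_connConst hq0 hq1 hA0 hAq hB0 hBq hC0 hC1 m m'
  rw [h] at g1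
  have s1 := neg_one_pow_mul_qPoch_inv_pos hq0 hq1 (show n ≤ m + m' by omega)
  have s2 := neg_one_pow_mul_qPoch_inv_pos hq0 hq1 (le_refl m')
  have s3 := neg_one_pow_mul_qPoch_inv_pos hq0 hq1 (le_refl (m + m'))
  have q1 := qPoch_pos hq0 hq1 hA0.le hA1 m'
  have q2 := fun k => qPoch_pos hq0 hq1 (by positivity : 0 ≤ A * B * C / q * q ^ (m + m'))
    (by linarith) k
  have q3 := qPoch_pos hq0 hq1 ha0.le ha1 n
  have q4 := qPoch_self_pos hq0 hq1 n
  have q5 := qPoch_pos hq0 hq1 hA0.le hA1 n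
  have q6 := qPoch_pos hq0 hq1 hAB0.le hAB1 (m + m' + n)
  have q7 := one_sub_mul_pow_pos hq0 hq1 ha0.le ha1 (2 * n)
  have q8 : 0 < 1 - A * B / q := by linarith
  set x := qPoch A q m' * qPoch (q ^ m')⁻¹ q m' / qPoch (A * B * C / q * q ^ (m + m')) q m with hx
  -- Signs: (q^(-m');q)_m' contributes (-1)^m', the reciprocal of (q^(-K);q)_K with K = m + m'
  -- contributes (-1)^(m+m'), and the two factors (-1)^n in `connFactor` cancel. This leaves (-1)^m.
  have hpos : 0 < (-1) ^ m * (x * connFactor q A B C (m + m') n) := by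
    have e : (-1) ^ m * (x * connFactor q A B C (m + m') n) =
        ((-1) ^ m' * qPoch (q ^ m')⁻¹ q m') * ((-1) ^ n * qPoch (q ^ (m + m'))⁻¹ q n) /
          ((-1) ^ (m + m') * qPoch (q ^ (m + m'))⁻¹ q (m + m')) *
        (qPoch A q m' / qPoch (A * B * C / q * q ^ (m + m')) q m *
          ((1 - A * B / q * q ^ (2 * n)) / (1 - A * B / q)) *
          (qPoch (A * B / q) q n * qPoch (A * B * C / q * q ^ (m + m')) q n *
            (q ^ n.choose 2 * q ^ n)) /
          (qPoch q q n * qPoch A q n * qPoch (A * B) q (m + m' + n))) := by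
      have hs : ((-1 : ℝ) ^ m)⁻¹ = (-1) ^ m := by
        rw [← inv_pow]; norm_num
      have hs' : ((-1 : ℝ) ^ m') * ((-1) ^ m')⁻¹ = 1 :=
        mul_inv_cancel₀ (pow_ne_zero _ (by norm_num))
      rw [hx, connFactor, pow_add (-1 : ℝ) m m']
      simp only [div_eq_mul_inv, mul_inv, hs]
      linear_combination (-((-1) ^ m * qPoch (q ^ m')⁻¹ q m' *
        ((-1) ^ n * qPoch (q ^ (m + m'))⁻¹ q n) * (qPoch (q ^ (m + m'))⁻¹ q (m + m'))⁻¹ *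
        (qPoch A q m' * (qPoch (A * B * C * q⁻¹ * q ^ (m + m')) q m)⁻¹ *
          ((1 - A * B * q⁻¹ * q ^ (2 * n)) * (1 - A * B * q⁻¹)⁻¹) *
          (qPoch (A * B * q⁻¹) q n * qPoch (A * B * C * q⁻¹ * q ^ (m + m')) q n *
            (q ^ n.choose 2 * q ^ n)) *
          ((qPoch q q n)⁻¹ * (qPoch A q n)⁻¹ * (qPoch (A * B) q (m + m' + n))⁻¹)))) * hs'
    rw [e]
    have := q2 m
    have := q2 n
    positivity
  have hx0 : x ≠ 0 := by rintro h0; rw [h0] at hpos; simp at hpos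
  have hZ := normXi_pos hq0 hq1 hA0 hAq hB0 hBq hC0 hC1 m m'
  have hκ : connConst q A B C (m + m') ≠ 0 := by
    rintro h0; rw [h0, mul_zero] at g2; exact hZ.ne g2
  have hsq : ((-1) ^ m * (x * connFactor q A B C (m + m') n)) ^ 2 *
      (normPsi q A B C n n' / normXi q A B C m m') =
      racahWeight q A B C (m + m') n / racahNorm q A B C (m + m') m * ((A * B / q) ^ m)⁻¹ := by
    have hs : ((-1 : ℝ) ^ m) ^ 2 = 1 := by rw [← pow_mul, mul_comm, pow_mul]; simp
    rw [mul_pow, hs, one_mul, mul_pow, ← mul_div_assoc, mul_assoc, g1, ← g2, ← div_eq_mul_inv,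
      div_div]
    rw [show x ^ 2 * (connConst q A B C (m + m') * racahWeight q A B C (m + m') n) =
      (x ^ 2 * connConst q A B C (m + m')) * racahWeight q A B C (m + m') n by ring,
      show x ^ 2 * racahNorm q A B C (m + m') m * (A * B / q) ^ m * connConst q A B C (m + m') =
      (x ^ 2 * connConst q A B C (m + m')) *
        (racahNorm q A B C (m + m') m * (A * B / q) ^ m) by ring]
    exact mul_div_mul_left _ _ (mul_ne_zero (pow_ne_zero 2 hx0) hκ)
  have hroot := congrArg Real.sqrt hsq
  rw [Real.sqrt_mul (sq_nonneg _), Real.sqrt_sq hpos.le,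
    Real.sqrt_mul' _ (inv_nonneg.2 (pow_pos ha0 m).le)] at hroot
  have hs : ((-1 : ℝ) ^ m) * (-1) ^ m = 1 := by rw [← mul_pow]; simp
  rw [polyConn, ← hx]
  linear_combination (-1) ^ m * racah q A B C (m + m') m n * hroot -
    (x * connFactor q A B C (m + m') n * racah q A B C (m + m') m n *
      Real.sqrt (normPsi q A B C n n' / normXi q A B C m m')) * hs

/-! ### Existence and uniqueness of the connection coefficients -/

/-- The connection coefficients from `Ψ` to `Ξ`. -/
noncomputable def connCoeff (q : ℝ) (α : Fin 3 → ℝ) (m n : Fin 3 → ℕ) : ℝ :=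
  if m 2 = n 2 ∧ m 0 + m 1 = n 0 + n 1 then
    (-1) ^ (m 0) * qRacahFun q (m 0) (n 0) (α 1) (α 2)
      (((n 0 + n 1 : ℕ) : ℝ) + α 0 + α 1 + 1) (n 0 + n 1)
  else 0

/-- The root of `normPsi` / `normXi` exchanges the normalisation of Ψ for that of Ξ. The factor
`normCommon` is shared because the degrees and the third indices agree. -/
theorem connCoeff_mul_Psi {q : ℝ} {α : Fin 3 → ℝ} (hq0 : 0 < q) (hq1 : q < 1) (hα : ∀ i, 0 < α i)
    {m n y : Fin 3 → ℕ} (h2 : m 2 = n 2) (h01 : n 0 + n 1 = m 0 + m 1)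
    (hy : y 0 + y 1 + y 2 = n 0 + n 1 + n 2) :
    connCoeff q α m n * Psi q α n y =
      Real.sqrt (wt₃ q (q ^ (α 0 + 1)) (q ^ (α 1 + 1)) (q ^ (α 2 + 1)) (y 0) (y 1) (y 2) /
        (normXi q (q ^ (α 0 + 1)) (q ^ (α 1 + 1)) (q ^ (α 2 + 1)) (m 0) (m 1) *
          normCommon q (q ^ (α 0 + 1)) (q ^ (α 1 + 1)) (q ^ (α 2 + 1)) (m 0 + m 1) (m 2))) *
      (polyConn q (q ^ (α 0 + 1)) (q ^ (α 1 + 1)) (q ^ (α 2 + 1)) (m 0) (m 1) (n 0) *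
        polyPsi q (q ^ (α 0 + 1)) (q ^ (α 1 + 1)) (q ^ (α 2 + 1)) (n 0) (n 1)
          (y 0) (y 1) (y 2)) := by
  obtain ⟨hA0, hAq, hA1⟩ := rpow_add_one_pos_lt hq0 hq1 (hα 0)
  obtain ⟨hB0, hBq, hB1⟩ := rpow_add_one_pos_lt hq0 hq1 (hα 1)
  obtain ⟨hC0, -, hC1⟩ := rpow_add_one_pos_lt hq0 hq1 (hα 2)
  rw [connCoeff, if_pos ⟨h2, h01.symm⟩, qRacahFun,
    qRacah_eq hq0 hq1 (hα 0) (hα 1) (hα 2) (by omega), qRacahWeight_eq hq0, qRacahNorm_eq hq0,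
    Psi_eq hq0 hq1 hα hy.symm, hahnFun_mul_psi hq0 hq1 hA0 hAq hB0 hB1 hC0 hC1 hy, h01, h2]
  generalize q ^ (α 0 + 1) = A at *
  generalize q ^ (α 1 + 1) = B at *
  generalize q ^ (α 2 + 1) = C at *
  rw [← polyConn_mul_sqrt hq0 hq1 hA0 hAq hB0 hBq hC0 hC1 h01]
  have hP := normPsi_pos hq0 hq1 hA0 hAq hB0 hB1 hC0 hC1 (n 0) (n 1)
  have hX := normXi_pos hq0 hq1 hA0 hAq hB0 hBq hC0 hC1 (m 0) (m 1)
  have : wt₃ q A B C (y 0) (y 1) (y 2) /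
      (normXi q A B C (m 0) (m 1) * normCommon q A B C (m 0 + m 1) (n 2)) =
      normPsi q A B C (n 0) (n 1) / normXi q A B C (m 0) (m 1) *
      (wt₃ q A B C (y 0) (y 1) (y 2) /
        (normPsi q A B C (n 0) (n 1) * normCommon q A B C (m 0 + m 1) (n 2))) := by
    field_simp
  rw [this, Real.sqrt_mul (div_pos hP hX).le]
  ring

theorem Psi_eq_zero {q : ℝ} {α : Fin 3 → ℝ} {n y : Fin 3 → ℕ}
    (h : n 0 + n 1 + n 2 ≠ y 0 + y 1 + y 2) : Psi q α n y = 0 := if_neg h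

theorem isConnectionCoeff_connCoeff {q : ℝ} {α : Fin 3 → ℝ} (hq0 : 0 < q) (hq1 : q < 1)
    (hα : ∀ i, 0 < α i) : IsConnectionCoeff q α (connCoeff q α) := by
  obtain ⟨hA0, hAq, hA1⟩ := rpow_add_one_pos_lt hq0 hq1 (hα 0)
  obtain ⟨hB0, hBq, hB1⟩ := rpow_add_one_pos_lt hq0 hq1 (hα 1)
  obtain ⟨hC0, -, hC1⟩ := rpow_add_one_pos_lt hq0 hq1 (hα 2)
  intro m y
  by_cases hmy : m 0 + m 1 + m 2 = y 0 + y 1 + y 2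
  -- The coefficient vanishes unless n₃ = m₃ and n₁ + n₂ = m₁ + m₂, so n₁ alone parametrises the
  -- terms.
  · let e : ℕ → Fin 3 → ℕ := fun i => ![i, m 0 + m 1 - i, m 2]
    have he : Function.Injective e := fun i j hij => congrFun hij 0
    have hsum : Xi q α m y = ∑ n ∈ (Finset.range (m 0 + m 1 + 1)).image e,
        connCoeff q α m n * Psi q α n y := by
      rw [Finset.sum_image fun i _ j _ hij => he hij, Xi_eq hq0 hq1 hα hmy,
        hahnFun_mul_xi hq0 hq1 hA0 hAq hB0 hBq hC0 hC1 hmy.symm,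
        polyXi_eq_sum hq0 hq1 hA0 hAq hB0 hB1 hC0 hC1 (m 0) (m 1) (m 2) _ _ _ hmy.symm,
        Finset.mul_sum]
      refine Finset.sum_congr rfl fun i hi => ?_
      have hi := Finset.mem_range.1 hi
      have h01 : e i 0 + e i 1 = m 0 + m 1 := by
        change i + (m 0 + m 1 - i) = _
        omega
      have h2 : m 2 = e i 2 := rfl
      rw [connCoeff_mul_Psi hq0 hq1 hα h2 h01 (by omega)]
      rfl
    rw [hsum]
    refine hasSum_sum_of_ne_finset_zero fun n hn => ?_
    by_cases h : m 2 = n 2 ∧ m 0 + m 1 = n 0 + n 1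
    · refine absurd (Finset.mem_image.2 ⟨n 0, Finset.mem_range.2 (by omega), ?_⟩) hn
      ext i; fin_cases i
      · rfl
      · change m 0 + m 1 - n 0 = n 1
        omega
      · exact h.1
    · rw [connCoeff, if_neg h, zero_mul]
  · rw [Xi, if_neg hmy]
    have : (fun n => connCoeff q α m n * Psi q α n y) = fun _ => 0 := by
      funext n
      by_cases h : m 2 = n 2 ∧ m 0 + m 1 = n 0 + n 1
      · rw [Psi_eq_zero (by omega), mul_zero]
      · rw [connCoeff, if_neg h, zero_mul]
    rw [this]
    exact hasSum_zero

/-- Pairing the expansion of Ξ_m with Ψ_n recovers the coefficient by orthonormality of Ψ on the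
level of n; this holds for every admissible R and so gives uniqueness. -/
theorem hasSum_Xi_mul_Psi {q : ℝ} {α : Fin 3 → ℝ} (hq0 : 0 < q) (hq1 : q < 1) (hα : ∀ i, 0 < α i)
    {R : (Fin 3 → ℕ) → (Fin 3 → ℕ) → ℝ} (hR : IsConnectionCoeff q α R) (m n : Fin 3 → ℕ) :
    HasSum (fun y => Xi q α m y * Psi q α n y) (R m n) := by
  set L := n 0 + n 1 + n 2 with hL
  have hmem : ∀ y : Fin 3 → ℕ, y ∈ Finset.Nat.antidiagonalTuple 3 L ↔ y 0 + y 1 + y 2 = L := by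
    intro y
    rw [Finset.Nat.mem_antidiagonalTuple, Fin.sum_univ_three]
  have hXi : ∀ y ∈ Finset.Nat.antidiagonalTuple 3 L,
      Xi q α m y = ∑ k ∈ Finset.Nat.antidiagonalTuple 3 L, R m k * Psi q α k y := by
    intro y hy
    refine (hR m y).unique (hasSum_sum_of_ne_finset_zero fun k hk => ?_)
    rw [Psi_eq_zero fun h => hk ((hmem k).2 (h.trans ((hmem y).1 hy))), mul_zero]
  have hsum : R m n = ∑ y ∈ Finset.Nat.antidiagonalTuple 3 L, Xi q α m y * Psi q α n y := by
    have h1 : ∀ y ∈ Finset.Nat.antidiagonalTuple 3 L, Xi q α m y * Psi q α n y =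
        ∑ k ∈ Finset.Nat.antidiagonalTuple 3 L, R m k * (Psi q α k y * Psi q α n y) := by
      intro y hy
      rw [hXi y hy, Finset.sum_mul]
      exact Finset.sum_congr rfl fun k _ => mul_assoc _ _ _
    rw [Finset.sum_congr rfl h1, Finset.sum_comm]
    simp only [← Finset.mul_sum]
    rw [Finset.sum_congr rfl fun k hk => by
      rw [sum_Psi_mul_Psi hq0 hq1 hα ((hmem k).1 hk) hL.symm]]
    simp [(hmem n).2 hL.symm]
  rw [hsum]
  refine hasSum_sum_of_ne_finset_zero fun y hy => ?_
  rw [Psi_eq_zero fun h => hy ((hmem y).2 h.symm), mul_zero]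

end QRacah

theorem proposition5 (q : ℝ) (hq0 : 0 < q) (hq1 : q < 1) (α : Fin 3 → ℝ) (hα : ∀ i, 0 < α i) :
    (∃! R : (Fin 3 → ℕ) → (Fin 3 → ℕ) → ℝ, QRacah.IsConnectionCoeff q α R) ∧
    ∀ R : (Fin 3 → ℕ) → (Fin 3 → ℕ) → ℝ, QRacah.IsConnectionCoeff q α R →
      ∀ m n : Fin 3 → ℕ,
        HasSum (fun y : Fin 3 → ℕ => QRacah.Xi q α m y * QRacah.Psi q α n y) (R m n) ∧
        R m n =
          if m 2 = n 2 ∧ m 0 + m 1 = n 0 + n 1 then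
            (-1) ^ (m 0) *
              QRacah.qRacahFun q (m 0) (n 0) (α 1) (α 2)
                (((n 0 + n 1 : ℕ) : ℝ) + α 0 + α 1 + 1) (n 0 + n 1)
          else 0 := by
  have hconn := QRacah.isConnectionCoeff_connCoeff hq0 hq1 hα
  -- Any two families are sums of the same series ∑ Ξ Ψ, hence equal.
  have huniq : ∀ R, QRacah.IsConnectionCoeff q α R → R = QRacah.connCoeff q α := fun R hR =>
    funext fun m => funext fun n => (QRacah.hasSum_Xi_mul_Psi hq0 hq1 hα hR m n).unique
      (QRacah.hasSum_Xi_mul_Psi hq0 hq1 hα hconn m n)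
  refine ⟨⟨_, hconn, huniq⟩, fun R hR m n =>
    ⟨QRacah.hasSum_Xi_mul_Psi hq0 hq1 hα hR m n, ?_⟩⟩
  rw [huniq R hR, QRacah.connCoeff]
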